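/- Let $V$ be a Euclidean space of dimension $\ell\ge 2$ and let $W\subset \mathrm{GL}(V)$ be a (real, irreducible) Coxeter group, i.e. a finite group generated by orthogonal reflections and acting irreducibly on $V$. Let $x_1,\dots,x_\ell$ be an orthonormal basis of $V^*$, $S=\mathbf R[x_1,\dots,x_\ell]$ the algebra of polynomial functions on $V$ with $\partial_i=\partial/\partial x_i$, $R=S^W$ its invariant subring, $\Omega^p\cong S\otimes_{\mathbf R}\bigwedge^pV^*$ the $S$-module of polynomial $p$-forms on $V$ (with $\Omega^0=S$), and $$(\Omega^p)^{\det}=\{\omega\in\Omega^p \mid w\omega=\det(w)\,\omega \text{ for all } w\in W\}$$ the $R$-module of anti-invariant $p$-forms. Let $Q=\prod_H\alpha_H$, where $H$ runs over the reflecting hyperplanes of $W$ and $\alpha_H\in V^*$ is any linear form with kernel $H$. Let $D$ be a Saito (primitive) derivation: $D=\partial/\partial P_k$ for some system $P_1,\dots,P_\ell$ of basic invariants (algebraically independent homogeneous generators of the $\mathbf R$-algebra $R$) with $P_k$ of the highest degree; that is, $D$ is the derivation of the fraction field of $S$ with $D P_j=\delta_{jk}$. Put $$\hat d f=\sum_{i=1}^{\ell}(\partial_i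 f)\, d\bigl(Q\,(D x_i)\bigr)\qquad (f\in S).$$ Then for all basic invariants $f_1,\dots,f_\ell$ of $W$ and all $0\le p\le \ell$, $$(\Omega^{p})^{\det}=\bigoplus_{1\le i_1<\cdots<i_p\le\ell} R\,Q^{1-p}\,(\hat d f_{i_1}\wedge\cdots\wedge\hat d f_{i_p}),$$ i.e. the forms $Q^{1-p}(\hat d f_{i_1}\wedge\cdots\wedge\hat d f_{i_p})$ are polynomial, anti-invariant, and form a basis of the free $R$-module $(\Omega^p)^{\det}$. -/

import Mathlib

namespace CoxeterForms

noncomputable section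

/-- The Euclidean space of dimension `ℓ`. -/
abbrev V (ℓ : ℕ) : Type := EuclideanSpace ℝ (Fin ℓ)

/-- The algebra `S` of polynomial functions on `V`; the variable `X i` is the coordinate `x_i`. -/
abbrev S (ℓ : ℕ) : Type := MvPolynomial (Fin ℓ) ℝ

/-- The field of fractions of `S`, i.e. the field of rational functions on `V`. -/
abbrev F (ℓ : ℕ) : Type := FractionRing (S ℓ)

variable {ℓ : ℕ}

/-- The `i`-th vector of the standard orthonormal basis. -/
def stdVec (i : Fin ℓ) : V ℓ := EuclideanSpace.single i 1

/-- The orthogonal reflection that sends `v` to `-v` and fixes the orthogonal complement of `v`. -/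
def reflectionIn (v : V ℓ) : V ℓ ≃ₗᵢ[ℝ] V ℓ := (ℝ ∙ v)ᗮ.reflection

/-- `W` is a finite group generated by orthogonal reflections that acts irreducibly on `V`. -/
structure IsRealCoxeterGroup (W : Subgroup (V ℓ ≃ₗᵢ[ℝ] V ℓ)) : Prop where
  finite : Finite W
  generated : Subgroup.closure {s | s ∈ W ∧ ∃ v : V ℓ, v ≠ 0 ∧ s = reflectionIn v} = W
  nontrivial : Nontrivial (V ℓ)
  irreducible : ∀ U : Submodule ℝ (V ℓ),
    (∀ w ∈ W, ∀ u ∈ U, w u ∈ U) → U = ⊥ ∨ U = ⊤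

/-- The set of reflecting hyperplanes of `W`. -/
def reflectingHyperplanes (W : Subgroup (V ℓ ≃ₗᵢ[ℝ] V ℓ)) : Set (Submodule ℝ (V ℓ)) :=
  {H | ∃ v : V ℓ, v ≠ 0 ∧ reflectionIn v ∈ W ∧ H = (ℝ ∙ v)ᗮ}

/-- A linear form on `V`, as a polynomial function of degree one. -/
def linearForm (φ : Module.Dual ℝ (V ℓ)) : S ℓ :=
  ∑ j, MvPolynomial.C (φ (stdVec j)) * MvPolynomial.X j

/-- The product `Q` of the chosen linear forms `α H`, one for each reflecting hyperplane `H`. -/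
def definingPolynomial (W : Subgroup (V ℓ ≃ₗᵢ[ℝ] V ℓ))
    (α : Submodule ℝ (V ℓ) → Module.Dual ℝ (V ℓ)) : S ℓ :=
  ∏ᶠ H ∈ reflectingHyperplanes W, linearForm (α H)

/-- The contragredient action on polynomial functions: `(w f)(v) = f (w⁻¹ v)`. -/
def act (w : V ℓ ≃ₗᵢ[ℝ] V ℓ) : S ℓ →ₐ[ℝ] S ℓ :=
  MvPolynomial.aeval fun i => ∑ j, MvPolynomial.C ((w⁻¹ (stdVec j)) i) * MvPolynomial.X j

/-- The ring `R = S^W` of invariant polynomial functions. -/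
def invariants (W : Subgroup (V ℓ ≃ₗᵢ[ℝ] V ℓ)) : Subalgebra ℝ (S ℓ) where
  carrier := {f | ∀ w ∈ W, act w f = f}
  mul_mem' ha hb w hw := by rw [map_mul, ha w hw, hb w hw]
  add_mem' ha hb w hw := by rw [map_add, ha w hw, hb w hw]
  algebraMap_mem' r w _ := (act w).commutes r

/-- Basic invariants: algebraically independent homogeneous generators of the algebra `R`. -/
structure IsBasicInvariants (W : Subgroup (V ℓ ≃ₗᵢ[ℝ] V ℓ)) (f : Fin ℓ → S ℓ) : Prop where
  algebraicIndependent : AlgebraicIndependent ℝ f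
  homogeneous : ∀ i, (f i).IsHomogeneous (f i).totalDegree
  adjoin_eq : Algebra.adjoin ℝ (Set.range f) = invariants W

/-- A Saito (primitive) derivation: `D = ∂/∂P_k` for a system of basic invariants `P` in which
`P_k` has the highest degree, as a derivation of the field of rational functions on `V`. -/
def IsSaitoDerivation (W : Subgroup (V ℓ ≃ₗᵢ[ℝ] V ℓ)) (D : Derivation ℝ (F ℓ) (F ℓ)) : Prop :=
  ∃ (P : Fin ℓ → S ℓ) (k : Fin ℓ), IsBasicInvariants W P ∧
    (∀ j, (P j).totalDegree ≤ (P k).totalDegree) ∧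
    ∀ j, D (algebraMap (S ℓ) (F ℓ) (P j)) = if j = k then 1 else 0

/-- The quotient rule for `∂_i` on rational functions. -/
def quotientRule (i : Fin ℓ) (a b : S ℓ) : F ℓ :=
  (algebraMap (S ℓ) (F ℓ) (MvPolynomial.pderiv i a) * algebraMap (S ℓ) (F ℓ) b
    - algebraMap (S ℓ) (F ℓ) a * algebraMap (S ℓ) (F ℓ) (MvPolynomial.pderiv i b))
    / algebraMap (S ℓ) (F ℓ) b ^ 2

theorem algebraMap_ne_zero {b : S ℓ} (hb : b ≠ 0) : algebraMap (S ℓ) (F ℓ) b ≠ 0 := by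
  simpa using hb

theorem quotientRule_congr (i : Fin ℓ) {a b a' b' : S ℓ} (hb : b ≠ 0) (hb' : b' ≠ 0)
    (h : algebraMap (S ℓ) (F ℓ) a / algebraMap (S ℓ) (F ℓ) b
      = algebraMap (S ℓ) (F ℓ) a' / algebraMap (S ℓ) (F ℓ) b') :
    quotientRule i a b = quotientRule i a' b' := by
  have h1 := algebraMap_ne_zero hb
  have h2 := algebraMap_ne_zero hb'
  rw [div_eq_div_iff h1 h2, ← map_mul, ← map_mul] at h
  have h3 : a * b' = a' * b := IsFractionRing.injective (S ℓ) (F ℓ) h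
  have h4 := congrArg (algebraMap (S ℓ) (F ℓ)) (congrArg (MvPolynomial.pderiv i) h3)
  simp only [Derivation.leibniz, smul_eq_mul, map_add, map_mul] at h4
  rw [map_mul, map_mul] at h
  unfold quotientRule
  rw [div_eq_div_iff (pow_ne_zero 2 h1) (pow_ne_zero 2 h2)]
  linear_combination (algebraMap (S ℓ) (F ℓ) b * algebraMap (S ℓ) (F ℓ) b') * h4
    - (algebraMap (S ℓ) (F ℓ) b * algebraMap (S ℓ) (F ℓ) (MvPolynomial.pderiv i b')
      + algebraMap (S ℓ) (F ℓ) b' * algebraMap (S ℓ) (F ℓ) (MvPolynomial.pderiv i b)) * h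

/-- A polynomial numerator of a rational function. -/
def ratNum (g : F ℓ) : S ℓ := (IsFractionRing.div_surjective (A := S ℓ) g).choose

/-- A polynomial denominator of a rational function, matching `ratNum`. -/
def ratDen (g : F ℓ) : S ℓ := (IsFractionRing.div_surjective (A := S ℓ) g).choose_spec.choose

theorem ratDen_ne_zero (g : F ℓ) : ratDen g ≠ 0 :=
  nonZeroDivisors.ne_zero
    (IsFractionRing.div_surjective (A := S ℓ) g).choose_spec.choose_spec.1

theorem num_div_den (g : F ℓ) :
    algebraMap (S ℓ) (F ℓ) (ratNum g) / algebraMap (S ℓ) (F ℓ) (ratDen g) = g :=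
  (IsFractionRing.div_surjective (A := S ℓ) g).choose_spec.choose_spec.2

theorem quotientRule_num_den (i : Fin ℓ) (g : F ℓ) {a b : S ℓ} (hb : b ≠ 0)
    (h : algebraMap (S ℓ) (F ℓ) a / algebraMap (S ℓ) (F ℓ) b = g) :
    quotientRule i (ratNum g) (ratDen g) = quotientRule i a b :=
  quotientRule_congr i (ratDen_ne_zero g) hb ((num_div_den g).trans h.symm)

/-- The partial derivative `∂_i` as a derivation of the field of rational functions. -/
def ratPderiv (i : Fin ℓ) : Derivation ℝ (F ℓ) (F ℓ) :=
  Derivation.mk'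
    { toFun := fun g => quotientRule i (ratNum g) (ratDen g)
      map_add' := fun g h => by
        have hg := algebraMap_ne_zero (ratDen_ne_zero g)
        have hh := algebraMap_ne_zero (ratDen_ne_zero h)
        rw [quotientRule_num_den i (g + h) (a := ratNum g * ratDen h + ratNum h * ratDen g)
          (b := ratDen g * ratDen h) (mul_ne_zero (ratDen_ne_zero g) (ratDen_ne_zero h))]
        · simp only [quotientRule, Derivation.leibniz, smul_eq_mul, map_add, map_mul]
          field_simp
          ring
        · conv_rhs => rw [← num_div_den g, ← num_div_den h]
          simp only [map_add, map_mul]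
          field_simp
      map_smul' := fun c g => by
        have hc : ∀ a : S ℓ, algebraMap (S ℓ) (F ℓ) (c • a)
            = c • algebraMap (S ℓ) (F ℓ) a := fun a => by
          simp only [Algebra.algebraMap_eq_smul_one, smul_assoc]
        rw [quotientRule_num_den i (c • g) (a := c • ratNum g) (b := ratDen g) (ratDen_ne_zero g)]
        · simp only [quotientRule, Derivation.map_smul, RingHom.id_apply, hc, smul_mul_assoc,
            ← smul_sub, smul_div_assoc]
        · conv_rhs => rw [← num_div_den g]
          rw [hc, smul_div_assoc] }
    (fun g h => by
      have hg := algebraMap_ne_zero (ratDen_ne_zero g)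
      have hh := algebraMap_ne_zero (ratDen_ne_zero h)
      change quotientRule i (ratNum (g * h)) (ratDen (g * h))
        = g • quotientRule i (ratNum h) (ratDen h) + h • quotientRule i (ratNum g) (ratDen g)
      rw [quotientRule_num_den i (g * h) (a := ratNum g * ratNum h)
        (b := ratDen g * ratDen h) (mul_ne_zero (ratDen_ne_zero g) (ratDen_ne_zero h))]
      · conv_rhs =>
          rw [smul_eq_mul, smul_eq_mul]
          enter [1, 1]
          rw [← num_div_den g]
        conv_rhs =>
          enter [2, 1]
          rw [← num_div_den h]
        simp only [quotientRule, Derivation.leibniz, smul_eq_mul, map_add, map_mul]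
        field_simp
        ring
      · conv_rhs => rw [← num_div_den g, ← num_div_den h]
        simp only [map_mul]
        field_simp)

theorem ratPderiv_algebraMap (i : Fin ℓ) (a : S ℓ) :
    ratPderiv i (algebraMap (S ℓ) (F ℓ) a)
      = algebraMap (S ℓ) (F ℓ) (MvPolynomial.pderiv i a) := by
  change quotientRule i (ratNum _) (ratDen _) = _
  rw [quotientRule_num_den i _ (a := a) (b := 1) one_ne_zero (by simp)]
  simp [quotientRule]

/-- Polynomial `p`-forms, `Ω^p = S ⊗ ⋀^p V*`, as alternating maps on `V` with values in `S`. -/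
abbrev PolyForm (ℓ p : ℕ) : Type := V ℓ [⋀^Fin p]→ₗ[ℝ] S ℓ

/-- Rational `p`-forms, as alternating maps on `V` with values in the rational functions. -/
abbrev RatForm (ℓ p : ℕ) : Type := V ℓ [⋀^Fin p]→ₗ[ℝ] F ℓ

/-- A polynomial `p`-form, regarded as a rational `p`-form. -/
def PolyForm.toRat {p : ℕ} (ω : PolyForm ℓ p) : RatForm ℓ p :=
  ((Algebra.linearMap (S ℓ) (F ℓ)).restrictScalars ℝ).compAlternatingMap ω

/-- The action on polynomial forms: `(w ω)(v_1, …, v_p) = w (ω (w⁻¹ v_1, …, w⁻¹ v_p))`. -/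
def actForm {p : ℕ} (w : V ℓ ≃ₗᵢ[ℝ] V ℓ) (ω : PolyForm ℓ p) : PolyForm ℓ p :=
  (act w).toLinearMap.compAlternatingMap
    (ω.compLinearMap (w⁻¹).toLinearEquiv.toLinearMap)

/-- The `R`-module of anti-invariant `p`-forms: `w ω = det(w) ω` for all `w ∈ W`. -/
def antiInvariantForms (W : Subgroup (V ℓ ≃ₗᵢ[ℝ] V ℓ)) (p : ℕ) :
    Submodule (invariants W) (PolyForm ℓ p) where
  carrier := {ω | ∀ w ∈ W, actForm w ω = LinearMap.det w.toLinearEquiv.toLinearMap • ω}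
  zero_mem' w _ := by ext; simp [actForm]
  add_mem' {a b} ha hb w hw := by
    rw [smul_add, ← ha w hw, ← hb w hw]
    ext; simp [actForm]
  smul_mem' r ω hω w hw := by
    rw [smul_comm, ← hω w hw]
    ext v : 1
    simp only [actForm, LinearMap.compAlternatingMap_apply, AlternatingMap.compLinearMap_apply,
      AlternatingMap.smul_apply, AlgHom.toLinearMap_apply, Subalgebra.smul_def, smul_eq_mul,
      map_mul]
    rw [r.2 w hw]

instance (W : Subgroup (V ℓ ≃ₗᵢ[ℝ] V ℓ)) (p : ℕ) :
    Module (invariants W) (antiInvariantForms W p) :=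
  Submodule.module (antiInvariantForms W p)

instance (W : Subgroup (V ℓ ≃ₗᵢ[ℝ] V ℓ)) (p : ℕ) :
    SMul (invariants W) (antiInvariantForms W p) :=
  (Submodule.module (antiInvariantForms W p)).toSMul

/-- The differential of a rational function as a rational 1-form: `dg = ∑ (∂_i g) dx_i`,
that is, `dg(v) = ∑ v_i ∂_i g`. -/
def ratD (g : F ℓ) : V ℓ →ₗ[ℝ] F ℓ where
  toFun v := ∑ i, v i • ratPderiv i g
  map_add' u v := by simp [add_smul, Finset.sum_add_distrib]
  map_smul' c v := by simp [mul_smul, Finset.smul_sum]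

/-- The operator `d̂ f = ∑ (∂_i f) d(Q (D x_i))`. -/
def hatD (Q : S ℓ) (D : Derivation ℝ (F ℓ) (F ℓ)) (f : S ℓ) : V ℓ →ₗ[ℝ] F ℓ :=
  ∑ i, algebraMap (S ℓ) (F ℓ) (MvPolynomial.pderiv i f) •
    ratD (algebraMap (S ℓ) (F ℓ) Q * D (algebraMap (S ℓ) (F ℓ) (MvPolynomial.X i)))

/-- The exterior product of rational 1-forms:
`(η_1 ∧ … ∧ η_p)(v_1, …, v_p) = det (η_i (v_j))`. -/
def wedge {p : ℕ} (η : Fin p → (V ℓ →ₗ[ℝ] F ℓ)) : RatForm ℓ p where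
  toFun v := Matrix.det (Matrix.of fun j i => η i (v j))
  map_update_add' {inst} v j x y := by
    obtain rfl := Subsingleton.elim inst (instDecidableEqFin p)
    have key : ∀ z : V ℓ, (Matrix.of fun k i => η i (Function.update v j z k))
        = Matrix.updateRow (Matrix.of fun k i => η i (v k)) j (fun i => η i z) := by
      intro z
      ext k i
      by_cases h : k = j
      · subst h; simp
      · simp [h]
    have hadd : (fun i => η i (x + y)) = (fun i => η i x) + fun i => η i y := by
      ext i; simp
    rw [key, key, key, hadd, Matrix.det_updateRow_add]
  map_update_smul' {inst} v j c x := by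
    obtain rfl := Subsingleton.elim inst (instDecidableEqFin p)
    have key : ∀ z : V ℓ, (Matrix.of fun k i => η i (Function.update v j z k))
        = Matrix.updateRow (Matrix.of fun k i => η i (v k)) j (fun i => η i z) := by
      intro z
      ext k i
      by_cases h : k = j
      · subst h; simp
      · simp [h]
    have hsmul : (fun i => η i (c • x)) = algebraMap ℝ (F ℓ) c • fun i => η i x := by
      ext i; simp [Algebra.smul_def]
    rw [key, key, hsmul, Matrix.det_updateRow_smul, Algebra.smul_def]
  map_eq_zero_of_eq' v i j h hij :=
    Matrix.det_zero_of_row_eq hij (by ext k; simp [h])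

end

end CoxeterForms

open CoxeterForms

namespace CoxeterForms

noncomputable section

open MvPolynomial

variable {ℓ : ℕ}

/-! ### Linear substitutions and chain rules -/

/-! Write `J(P)` for the Jacobian matrix of basic invariants `P` and `y_a = Q (D x_a)`. Cramer's
rule shows that `y` is a polynomial vector field, determined by `J(P) y = Q e_k`. The coefficient
matrix of the 1-forms `hatD f_i` is `Θ = J(f) ∂y`, where `∂y` is the Jacobian matrix of `y`
(`fieldJac y`).

The theorem reduces to the existence of a frame `U` of `W`-invariant vector fields with `U Θᵀ = Q`
and `det U = e Q`, `e` a nonzero constant (`exists_dual_frame`). Given such a frame, an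
anti-invariant form evaluated on `p` rows of `U` is an anti-invariant polynomial, hence `Q` times an
invariant. These invariants are its coordinates with respect to the forms `e⁻¹ det(U with the rows I
replaced by v)`. The complementary minor identity `replaceForm_mul_det` identifies the latter with
`Q^(1-p)` times the wedge products of the `hatD f_i` (`exists_basis_of_dual`).

The frame comes from `exists_pairing_matrix`: `J(P) ∂y J(P)ᵀ = Q M` with `M` a matrix of invariants
and `det M` a nonzero constant. Divisibility by `Q` is anti-invariance. That `det M` is constant is
a degree count resting on `2 ∑ d_i = ℓ (h + 2)`, with `d_i` the degrees and `h` the highest one.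
That it is nonzero is seen at a regular eigenvector `v`: all `P_j` with `j ≠ k` vanish at `v`, some
`w ∈ W` multiplies `v` by a primitive `h`-th root of unity, and `v` lies on no reflecting
hyperplane. There the pairing matrix is a diagonal matrix times the Gram matrix of the gradients,
and both are invertible.

Two classical facts are needed on the way: `det J(P) = c Q` (`exists_det_jac_eq`) and the regularity
of `v` (`aeval_linPoly_ne_zero_of_axis`). Both are obtained by jet interpolation: over any extension
field of the reals, a jet at a point, summed over the stabilizer of that point, is the jet of a
polynomial in the basic invariants. Testing this on a linear form and on its square controls the
first and second derivatives of the invariants. Positivity of sums of real squares then gives the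
contradictions. -/

/-- The chain rule for a derivation applied to a polynomial expression. -/
theorem derivation_aeval {k A M σ : Type*} [CommRing k] [CommRing A] [Algebra k A] [AddCommGroup M]
    [Module k M] [Module A M] [IsScalarTower k A M] [Fintype σ] (Δ : Derivation k A M) (P : σ → A)
    (Φ : MvPolynomial σ k) :
    Δ (aeval P Φ) = ∑ i, aeval P (pderiv i Φ) • Δ (P i) := by
  classical
  induction Φ using MvPolynomial.induction_on with
  | C a => simp
  | add f g hf hg => simp [hf, hg, add_smul, Finset.sum_add_distrib]
  | mul_X f j hf =>
    simp only [map_mul, aeval_X, Derivation.leibniz, hf, map_add, smul_eq_mul, add_smul,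
      Finset.sum_add_distrib, pderiv_X, Finset.smul_sum, smul_smul]
    congr 1
    rw [Finset.sum_eq_single j]
    · simp
    · intro b _ hb
      simp [hb]
    · simp

/-- The substitution `f(x) ↦ f(A x)` on polynomials. -/
def subst {K : Type*} [CommRing K] (A : Matrix (Fin ℓ) (Fin ℓ) K) :
    MvPolynomial (Fin ℓ) K →ₐ[K] MvPolynomial (Fin ℓ) K :=
  aeval fun i => ∑ j, C (A i j) * X j

section subst

variable {K : Type*} [CommRing K] (A : Matrix (Fin ℓ) (Fin ℓ) K)

@[simp] theorem subst_X (i : Fin ℓ) : subst A (X i) = ∑ j, C (A i j) * X j := aeval_X _ _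

@[simp] theorem subst_C (c : K) : subst A (C c) = C c := (subst A).commutes c

theorem pderiv_subst (i : Fin ℓ) (f : MvPolynomial (Fin ℓ) K) :
    pderiv i (subst A f) = ∑ j, C (A j i) * subst A (pderiv j f) := by
  classical
  rw [subst, derivation_aeval]
  refine Finset.sum_congr rfl fun j _ => ?_
  have : pderiv i (∑ m, C (A j m) * X m : MvPolynomial (Fin ℓ) K) = C (A j i) := by
    simp only [map_sum, pderiv_C_mul, pderiv_X]
    rw [Finset.sum_eq_single i]
    · simp
    · intro b _ hb
      simp [hb]
    · simp
  rw [this, smul_eq_mul, mul_comm]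

theorem eval_subst (p : Fin ℓ → K) (f : MvPolynomial (Fin ℓ) K) :
    eval p (subst A f) = eval (A.mulVec p) f := by
  have : (eval p).comp (subst A : MvPolynomial (Fin ℓ) K →+* MvPolynomial (Fin ℓ) K)
      = eval (A.mulVec p) := by
    apply MvPolynomial.ringHom_ext
    · intro r; simp
    · intro i; simp [Matrix.mulVec, dotProduct]
  exact congrArg (fun h => h f) this

theorem aeval_subst {L : Type*} [CommRing L] [Algebra K L] (p : Fin ℓ → L)
    (f : MvPolynomial (Fin ℓ) K) :
    aeval p (subst A f) = aeval ((A.map (algebraMap K L)).mulVec p) f := by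
  have : (aeval p).comp (subst A) = aeval ((A.map (algebraMap K L)).mulVec p) := by
    apply MvPolynomial.algHom_ext
    intro i; simp [Matrix.mulVec, dotProduct]
  exact congrArg (fun h => h f) this

theorem map_subst {L : Type*} [CommRing L] (φ : K →+* L) (f : MvPolynomial (Fin ℓ) K) :
    map φ (subst A f) = subst (A.map φ) (map φ f) := by
  have : (map φ).comp (subst A : MvPolynomial (Fin ℓ) K →+* MvPolynomial (Fin ℓ) K)
      = (subst (A.map φ) : MvPolynomial (Fin ℓ) L →+* MvPolynomial (Fin ℓ) L).comp (map φ) := by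
    apply MvPolynomial.ringHom_ext
    · intro r; simp
    · intro i; simp
  exact congrArg (fun h => h f) this

theorem subst_subst (B : Matrix (Fin ℓ) (Fin ℓ) K) (f : MvPolynomial (Fin ℓ) K) :
    subst A (subst B f) = subst (B * A) f := by
  have : (subst A).comp (subst B) = subst (B * A) := by
    apply MvPolynomial.algHom_ext
    intro i
    simp only [AlgHom.comp_apply, subst_X, map_sum, map_mul, subst_C, Matrix.mul_apply,
      Finset.mul_sum, Finset.sum_mul]
    rw [Finset.sum_comm]
    simp [mul_assoc]
  exact congrArg (fun h => h f) this

@[simp] theorem subst_one (f : MvPolynomial (Fin ℓ) K) : subst 1 f = f := by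
  have : subst (1 : Matrix (Fin ℓ) (Fin ℓ) K) = AlgHom.id K _ := by
    apply MvPolynomial.algHom_ext
    intro i
    simp [Matrix.one_apply, apply_ite C]
  rw [this]; rfl

/-- The linear polynomial `∑ a_j x_j`. -/
def linPoly (a : Fin ℓ → K) : MvPolynomial (Fin ℓ) K := ∑ j, C (a j) * X j

theorem subst_linPoly (a : Fin ℓ → K) : subst A (linPoly a) = linPoly (A.vecMul a) := by
  simp only [linPoly, map_sum, map_mul, subst_C, subst_X, Finset.mul_sum, Matrix.vecMul,
    dotProduct, Finset.sum_mul]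
  rw [Finset.sum_comm]
  simp [mul_assoc]

theorem pderiv_linPoly (a : Fin ℓ → K) (i : Fin ℓ) : pderiv i (linPoly a) = C (a i) := by
  classical
  simp only [linPoly, map_sum, pderiv_C_mul, pderiv_X]
  rw [Finset.sum_eq_single i]
  · simp
  · intro b _ hb
    simp [hb]
  · simp

theorem eval_linPoly (a p : Fin ℓ → K) : eval p (linPoly a) = a ⬝ᵥ p := by
  simp [linPoly, dotProduct]

theorem aeval_linPoly {L : Type*} [CommRing L] [Algebra K L] (a : Fin ℓ → K) (p : Fin ℓ → L) :
    aeval p (linPoly a) = (fun i => algebraMap K L (a i)) ⬝ᵥ p := by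
  simp [linPoly, dotProduct]

theorem coeff_linPoly (a : Fin ℓ → K) (i : Fin ℓ) :
    coeff (Finsupp.single i 1) (linPoly a) = a i := by
  classical
  simp only [linPoly, coeff_sum, coeff_C_mul, coeff_X, Finsupp.single_left_inj one_ne_zero]
  rw [Finset.sum_eq_single i] <;> simp +contextual [Ne.symm]

theorem linPoly_smul (c : K) (a : Fin ℓ → K) : linPoly (c • a) = C c * linPoly a := by
  simp [linPoly, Finset.mul_sum, mul_assoc]

theorem linPoly_isHomogeneous (a : Fin ℓ → K) : (linPoly a).IsHomogeneous 1 := by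
  refine IsHomogeneous.sum _ _ _ fun i _ => ?_
  simpa using (isHomogeneous_C (Fin ℓ) (a i)).mul (isHomogeneous_X K i)

/-- The derivative in the direction `a`. -/
def dirD (a : Fin ℓ → K) : Derivation K (MvPolynomial (Fin ℓ) K) (MvPolynomial (Fin ℓ) K) :=
  ∑ j, a j • pderiv j

theorem dirD_apply (a : Fin ℓ → K) (f : MvPolynomial (Fin ℓ) K) :
    dirD a f = ∑ j, C (a j) * pderiv j f := by
  simp only [dirD]
  rw [← Derivation.coeFnAddMonoidHom_apply, map_sum, Finset.sum_apply]
  simp [Derivation.coeFnAddMonoidHom, MvPolynomial.smul_eq_C_mul]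

theorem map_dirD {L : Type*} [CommRing L] (φ : K →+* L) (a : Fin ℓ → K)
    (f : MvPolynomial (Fin ℓ) K) :
    map φ (dirD a f) = dirD (fun i => φ (a i)) (map φ f) := by
  simp [dirD_apply, pderiv_map]

theorem dirD_linPoly (a b : Fin ℓ → K) : dirD a (linPoly b) = C (b ⬝ᵥ a) := by
  simp [dirD_apply, pderiv_linPoly, dotProduct, mul_comm]

theorem dirD_subst (a : Fin ℓ → K) (f : MvPolynomial (Fin ℓ) K) :
    dirD a (subst A f) = subst A (dirD (A.mulVec a) f) := by
  simp only [dirD_apply, pderiv_subst, map_sum, map_mul, subst_C, Matrix.mulVec, dotProduct,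
    Finset.mul_sum, Finset.sum_mul]
  rw [Finset.sum_comm]
  refine Finset.sum_congr rfl fun i _ => Finset.sum_congr rfl fun j _ => ?_
  ring

end subst

/-! ### The matrices of the group elements -/

/-- The matrix of an isometry in the standard basis. -/
def mat (w : V ℓ ≃ₗᵢ[ℝ] V ℓ) : Matrix (Fin ℓ) (Fin ℓ) ℝ := Matrix.of fun i j => (w (stdVec j)) i

theorem act_eq_subst (w : V ℓ ≃ₗᵢ[ℝ] V ℓ) : act w = subst (mat w⁻¹) := rfl

theorem sum_smul_stdVec (v : V ℓ) : ∑ j, v j • stdVec j = v := by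
  ext i
  simp [stdVec, Pi.single_apply]

theorem mat_mulVec (w : V ℓ ≃ₗᵢ[ℝ] V ℓ) (v : V ℓ) (i : Fin ℓ) :
    (mat w).mulVec (fun j => v j) i = (w v) i := by
  conv_rhs => rw [← sum_smul_stdVec v]
  simp [Matrix.mulVec, dotProduct, mat, mul_comm]

theorem mat_one : mat (1 : V ℓ ≃ₗᵢ[ℝ] V ℓ) = 1 := by
  ext i j
  simp [mat, stdVec, Matrix.one_apply]

theorem mat_mul (w u : V ℓ ≃ₗᵢ[ℝ] V ℓ) : mat (w * u) = mat w * mat u := by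
  ext i j
  have := mat_mulVec w (u (stdVec j)) i
  simp only [Matrix.mulVec, dotProduct] at this
  simp only [Matrix.mul_apply]
  exact this.symm

theorem mat_inv_mul (w : V ℓ ≃ₗᵢ[ℝ] V ℓ) : mat w⁻¹ * mat w = 1 := by
  rw [← mat_mul, inv_mul_cancel, mat_one]

theorem mat_mul_inv (w : V ℓ ≃ₗᵢ[ℝ] V ℓ) : mat w * mat w⁻¹ = 1 := by
  rw [← mat_mul, mul_inv_cancel, mat_one]

theorem mat_transpose (w : V ℓ ≃ₗᵢ[ℝ] V ℓ) : (mat w).transpose = mat w⁻¹ := by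
  have key : ∀ (u : V ℓ ≃ₗᵢ[ℝ] V ℓ) (i j : Fin ℓ), mat u i j = inner ℝ (stdVec i) (u (stdVec j)) := by
    intro u i j
    simp [stdVec, mat, EuclideanSpace.inner_single_left]
  ext i j
  rw [Matrix.transpose_apply, key, key]
  have h := w.inner_map_map (stdVec i) (w⁻¹ (stdVec j))
  have h2 : w (w⁻¹ (stdVec j)) = stdVec j := w.apply_symm_apply _
  rw [← h, h2, real_inner_comm]

theorem mat_injective : Function.Injective (mat : (V ℓ ≃ₗᵢ[ℝ] V ℓ) → _) := by
  intro w u h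
  ext v i
  rw [← mat_mulVec, ← mat_mulVec, h]

theorem det_mat (w : V ℓ ≃ₗᵢ[ℝ] V ℓ) :
    (mat w).det = LinearMap.det w.toLinearEquiv.toLinearMap := by
  rw [← LinearMap.det_toMatrix (EuclideanSpace.basisFun (Fin ℓ) ℝ).toBasis]
  congr 1

theorem mem_invariants {W : Subgroup (V ℓ ≃ₗᵢ[ℝ] V ℓ)} {f : S ℓ} :
    f ∈ invariants W ↔ ∀ w ∈ W, subst (mat w) f = f := by
  constructor
  · intro h w hw
    have := h w⁻¹ (inv_mem hw)
    rwa [act_eq_subst, inv_inv] at this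
  · intro h w hw
    rw [act_eq_subst]
    exact h _ (inv_mem hw)

end

end CoxeterForms

namespace CoxeterForms

noncomputable section

open MvPolynomial

variable {ℓ : ℕ}

/-! ### Interpolation of jets by invariant polynomials -/

section jets

variable {K : Type*} [Field K]

theorem derivation_mem_pow {k A : Type*} [CommRing k] [CommRing A] [Algebra k A]
    (Δ : Derivation k A A) (I : Ideal A) (n : ℕ) {f : A} (hf : f ∈ I ^ (n + 1)) : Δ f ∈ I ^ n := by
  induction n generalizing f with
  | zero => simp
  | succ n ih =>
    rw [pow_succ] at hf
    induction hf using Submodule.mul_induction_on' with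
    | mem_mul_mem a ha b hb =>
      rw [Derivation.leibniz, smul_eq_mul, smul_eq_mul]
      refine add_mem (Ideal.mul_mem_right _ _ ha) ?_
      rw [pow_succ, mul_comm b]
      exact Ideal.mul_mem_mul (ih ha) hb
    | add x _ y _ hx hy => rw [map_add]; exact add_mem hx hy

/-- The ideal of polynomials that vanish at `p`. -/
def pointIdeal (p : Fin ℓ → K) : Ideal (MvPolynomial (Fin ℓ) K) := RingHom.ker (eval p)

theorem mem_pointIdeal {p : Fin ℓ → K} {f : MvPolynomial (Fin ℓ) K} :
    f ∈ pointIdeal p ↔ eval p f = 0 := RingHom.mem_ker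

theorem eval_eq_zero_of_mem_pow {p : Fin ℓ → K} {f : MvPolynomial (Fin ℓ) K} {n : ℕ} (hn : n ≠ 0)
    (hf : f ∈ pointIdeal p ^ n) : eval p f = 0 :=
  mem_pointIdeal.1 (Ideal.pow_le_self hn hf)

theorem isCoprime_pointIdeal {p q : Fin ℓ → K} (h : p ≠ q) :
    IsCoprime (pointIdeal p) (pointIdeal q) := by
  obtain ⟨i, hi⟩ := Function.ne_iff.1 h
  rw [Ideal.isCoprime_iff_exists]
  have hi' : q i - p i ≠ 0 := sub_ne_zero.2 (Ne.symm hi)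
  refine ⟨C (q i - p i)⁻¹ * (X i - C (p i)), ?_, C (q i - p i)⁻¹ * (C (q i) - X i), ?_, ?_⟩
  · simp [mem_pointIdeal]
  · simp [mem_pointIdeal]
  · have : (C (q i - p i)⁻¹ * C (q i - p i) : MvPolynomial (Fin ℓ) K) = 1 := by
      rw [← C_mul, inv_mul_cancel₀ hi', C_1]
    rw [C_sub] at this
    linear_combination this

theorem subst_mem_pow {A : Matrix (Fin ℓ) (Fin ℓ) K} {p : Fin ℓ → K} {n : ℕ}
    {f : MvPolynomial (Fin ℓ) K} (hf : f ∈ pointIdeal (A.mulVec p) ^ n) :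
    subst A f ∈ pointIdeal p ^ n := by
  have h1 : pointIdeal (A.mulVec p) ≤ (pointIdeal p).comap (subst A) := by
    intro g hg
    rw [Ideal.mem_comap, mem_pointIdeal, eval_subst]
    exact mem_pointIdeal.1 hg
  exact Ideal.le_comap_pow (subst A) n (Ideal.pow_right_mono h1 n hf)

/-- Chinese remainder theorem: distinct points have coprime ideals, and so have the powers of these
ideals. -/
theorem exists_jets (T : Set (Fin ℓ → K)) (hT : T.Finite) (n : ℕ)
    (q : (Fin ℓ → K) → MvPolynomial (Fin ℓ) K) :
    ∃ g, ∀ u ∈ T, g - q u ∈ pointIdeal u ^ n := by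
  have := hT.to_subtype
  have hc : Pairwise (Function.onFun IsCoprime fun u : T => pointIdeal u.1 ^ n) := by
    intro u v huv
    exact IsCoprime.pow (isCoprime_pointIdeal fun h => huv (Subtype.ext h))
  obtain ⟨g, hg⟩ := Ideal.exists_forall_sub_mem_ideal hc fun u => q u.1
  exact ⟨g, fun u hu => hg ⟨u, hu⟩⟩

variable [Algebra ℝ K]

/-- The matrix of an isometry, with entries in a field extension. -/
def matK (K : Type*) [Field K] [Algebra ℝ K] (w : V ℓ ≃ₗᵢ[ℝ] V ℓ) : Matrix (Fin ℓ) (Fin ℓ) K :=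
  (mat w).map (algebraMap ℝ K)

theorem matK_one : matK K (1 : V ℓ ≃ₗᵢ[ℝ] V ℓ) = 1 := by
  simp [matK, mat_one, Matrix.map_one]

theorem matK_mul (w u : V ℓ ≃ₗᵢ[ℝ] V ℓ) : matK K (w * u) = matK K w * matK K u := by
  simp [matK, mat_mul, Matrix.map_mul]

variable {W : Subgroup (V ℓ ≃ₗᵢ[ℝ] V ℓ)} {P : Fin ℓ → S ℓ}

theorem exists_aeval_eq (hP : Algebra.adjoin ℝ (Set.range P) = invariants W) {f : S ℓ}
    (hf : f ∈ invariants W) : ∃ Φ : MvPolynomial (Fin ℓ) ℝ, aeval P Φ = f := by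
  rw [← hP, Algebra.adjoin_range_eq_range_aeval] at hf
  exact hf

variable [Fintype W]

theorem sum_subst_mem_invariants (f : S ℓ) : ∑ w : W, subst (mat w.1) f ∈ invariants W := by
  rw [mem_invariants]
  intro u hu
  rw [map_sum]
  simp only [subst_subst, ← mat_mul]
  exact Fintype.sum_equiv (Equiv.mulRight (⟨u, hu⟩ : W)) _ _ fun w => rfl

/-- Averages of polynomials over an extension field are polynomials in the generators. -/
theorem exists_aeval_eq_sum_subst (hP : Algebra.adjoin ℝ (Set.range P) = invariants W)
    (g : MvPolynomial (Fin ℓ) K) :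
    ∃ Φ : MvPolynomial (Fin ℓ) K,
      aeval (fun i => map (algebraMap ℝ K) (P i)) Φ = ∑ w : W, subst (matK K w.1) g := by
  induction g using MvPolynomial.induction_on' with
  | add p q hp hq =>
    obtain ⟨Φ, hΦ⟩ := hp
    obtain ⟨Ψ, hΨ⟩ := hq
    exact ⟨Φ + Ψ, by simp only [map_add, hΦ, hΨ, Finset.sum_add_distrib]⟩
  | monomial m a =>
    obtain ⟨Ψ, hΨ⟩ := exists_aeval_eq hP (sum_subst_mem_invariants (W := W) (monomial m (1 : ℝ)))
    refine ⟨C a * map (algebraMap ℝ K) Ψ, ?_⟩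
    -- A monomial with coefficient 1 is defined over the reals, so the real invariant theory applies
    -- to it; the scalar `a` is put back by linearity.
    have h1 : (monomial m a : MvPolynomial (Fin ℓ) K)
        = C a * map (algebraMap ℝ K) (monomial m 1) := by
      simp [C_mul_monomial]
    have h2 : aeval (fun i => map (algebraMap ℝ K) (P i)) (map (algebraMap ℝ K) Ψ)
        = map (algebraMap ℝ K) (aeval P Ψ) := by
      rw [MvPolynomial.aeval_map_algebraMap]
      have : (aeval (R := ℝ) fun i => map (algebraMap ℝ K) (P i))
          = (mapAlgHom (Algebra.ofId ℝ K)).comp (aeval P) := by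
        apply MvPolynomial.algHom_ext
        intro i
        simp [Algebra.ofId]
      rw [this]
      rfl
    rw [map_mul, h2, hΨ, h1, map_sum, Finset.mul_sum]
    have h3 : ∀ c : K, aeval (fun i => map (algebraMap ℝ K) (P i)) (C c)
        = (C c : MvPolynomial (Fin ℓ) K) := fun c => by simp [MvPolynomial.algebraMap_eq]
    rw [h3]
    simp only [map_mul, map_subst, subst_C, matK]

open Classical in
/-- The stabilizer of a point with coordinates in an extension field. -/
def stab (W : Subgroup (V ℓ ≃ₗᵢ[ℝ] V ℓ)) [Fintype W] (p : Fin ℓ → K) : Finset W :=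
  Finset.univ.filter fun w => (matK K w.1).mulVec p = p

theorem mem_stab {p : Fin ℓ → K} {w : W} : w ∈ stab W p ↔ (matK K w.1).mulVec p = p := by
  simp [stab]

theorem one_mem_stab (p : Fin ℓ → K) : (1 : W) ∈ stab W p := by
  simp [mem_stab, matK_one]

/-- Every jet that is averaged over the stabilizer of `p` is the jet of a polynomial in the basic
invariants. -/
theorem exists_invariant_jet (hP : Algebra.adjoin ℝ (Set.range P) = invariants W)
    (p : Fin ℓ → K) (n : ℕ) (q : MvPolynomial (Fin ℓ) K) :
    ∃ Φ : MvPolynomial (Fin ℓ) K,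
      aeval (fun i => map (algebraMap ℝ K) (P i)) Φ - ∑ w ∈ stab W p, subst (matK K w.1) q
        ∈ pointIdeal p ^ n := by
  classical
  -- The jet `q` is prescribed at `p` and the zero jet at all other points of its orbit. In the sum
  -- over `W`, only the elements that fix `p` then contribute at `p`.
  obtain ⟨g, hg⟩ := exists_jets (Set.range fun w : W => (matK K w.1).mulVec p)
    (Set.finite_range _) n fun u => if u = p then q else 0
  obtain ⟨Φ, hΦ⟩ := exists_aeval_eq_sum_subst hP g
  refine ⟨Φ, ?_⟩
  rw [hΦ, stab, Finset.sum_filter, ← Finset.sum_sub_distrib]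
  refine Submodule.sum_mem _ fun w _ => ?_
  have h := subst_mem_pow (A := matK K w.1) (p := p) (hg _ ⟨w, rfl⟩)
  split_ifs at h ⊢ with h1
  · simpa using h
  · simpa using h

/-- Points with the same invariants lie in the same orbit. -/
theorem exists_mulVec_eq (hP : Algebra.adjoin ℝ (Set.range P) = invariants W)
    {p q : Fin ℓ → K} (h : ∀ i, aeval p (P i) = aeval q (P i)) :
    ∃ w : W, (matK K w.1).mulVec p = q := by
  classical
  have : CharZero K := charZero_of_injective_algebraMap (algebraMap ℝ K).injective
  -- Were the orbits disjoint, some polynomial would be 0 on the orbit of `p` and 1 on that of `q`.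
  -- Its sum over `W` is a polynomial in the generators, so it agrees at `p` and `q`; but the two
  -- values are 0 and the order of `W`, distinct in characteristic zero.
  by_contra! hne
  obtain ⟨g, hg⟩ := exists_jets ((Set.range fun w : W => (matK K w.1).mulVec p)
    ∪ Set.range fun w : W => (matK K w.1).mulVec q) ((Set.finite_range _).union (Set.finite_range _))
    1 fun u => if u ∈ Set.range (fun w : W => (matK K w.1).mulVec p) then 0 else 1
  obtain ⟨Φ, hΦ⟩ := exists_aeval_eq_sum_subst hP g
  have key : ∀ r : Fin ℓ → K, eval r (aeval (fun i => map (algebraMap ℝ K) (P i)) Φ)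
      = eval (fun i => aeval r (P i)) Φ := by
    intro r
    rw [← MvPolynomial.coe_aeval_eq_eval, ← MvPolynomial.coe_aeval_eq_eval]
    simp only [RingHom.coe_coe]
    have : (aeval r).comp (aeval fun i => map (algebraMap ℝ K) (P i))
        = aeval (R := K) fun i => aeval r (P i) := by
      apply MvPolynomial.algHom_ext
      intro i
      simp [aeval_def]
    exact congrArg (fun h => h Φ) this
  have hp := key p
  have hq := key q
  simp only [← h] at hq
  rw [← hp, hΦ, map_sum, map_sum] at hq
  have e1 : ∀ w : W, eval p (subst (matK K w.1) g) = 0 := by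
    intro w
    have := eval_eq_zero_of_mem_pow one_ne_zero (hg _ (Or.inl ⟨w, rfl⟩))
    rw [if_pos ⟨w, rfl⟩, sub_zero] at this
    rw [eval_subst, this]
  have e2 : ∀ w : W, eval q (subst (matK K w.1) g) = 1 := by
    intro w
    have := eval_eq_zero_of_mem_pow one_ne_zero (hg _ (Or.inr ⟨w, rfl⟩))
    rw [if_neg, map_sub, map_one, sub_eq_zero] at this
    · rw [eval_subst, this]
    · rintro ⟨u, hu⟩
      apply hne (w⁻¹ * u)
      have hu' : (matK K u.1).mulVec p = (matK K w.1).mulVec q := hu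
      rw [Subgroup.coe_mul, matK_mul, ← Matrix.mulVec_mulVec, hu', Matrix.mulVec_mulVec,
        ← matK_mul, Subgroup.coe_inv, inv_mul_cancel, matK_one, Matrix.one_mulVec]
  simp [e1, e2] at hq

theorem eval_map_eq_aeval (p : Fin ℓ → K) (f : S ℓ) :
    eval p (map (algebraMap ℝ K) f) = aeval p f := by
  rw [eval_map, aeval_def]

/-- First order consequences of the interpolation of jets. -/
theorem exists_jet_coeffs (hP : Algebra.adjoin ℝ (Set.range P) = invariants W)
    (p : Fin ℓ → K) (q : MvPolynomial (Fin ℓ) K) :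
    ∃ φ : Fin ℓ → K,
      (∀ j, ∑ i, φ i * aeval p (pderiv j (P i))
        = ∑ w ∈ stab W p, eval p (pderiv j (subst (matK K w.1) q))) ∧
      ∀ a : Fin ℓ → ℝ, (∀ i, aeval p (dirD a (P i)) = 0) →
        ∑ i, φ i * aeval p (dirD a (dirD a (P i)))
          = ∑ w ∈ stab W p, eval p (dirD (fun i => algebraMap ℝ K (a i))
              (dirD (fun i => algebraMap ℝ K (a i)) (subst (matK K w.1) q))) := by
  -- Order 3 leaves a congruence that still vanishes at `p` after two derivatives. The coefficients
  -- `φ` are the partial derivatives of `Φ` at the values of the invariants.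
  obtain ⟨Φ, hΦ⟩ := exists_invariant_jet hP p 3 q
  refine ⟨fun i => eval p (aeval (fun i => map (algebraMap ℝ K) (P i)) (pderiv i Φ)), ?_, ?_⟩
  · intro j
    have h := eval_eq_zero_of_mem_pow two_ne_zero (derivation_mem_pow (pderiv j) _ 2 hΦ)
    rw [map_sub, map_sub, sub_eq_zero, derivation_aeval, map_sum, map_sum, map_sum] at h
    rw [← h]
    refine Finset.sum_congr rfl fun i _ => ?_
    rw [smul_eq_mul, map_mul, pderiv_map, eval_map_eq_aeval]
  · intro a ha
    set b : Fin ℓ → K := fun i => algebraMap ℝ K (a i)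
    have h := eval_eq_zero_of_mem_pow one_ne_zero
      (derivation_mem_pow (dirD b) _ 1 (derivation_mem_pow (dirD b) _ 2 hΦ))
    rw [map_sub, map_sub, map_sub, sub_eq_zero, derivation_aeval, map_sum, map_sum, map_sum,
      map_sum, map_sum] at h
    rw [← h]
    -- The product rule also produces terms with a derivative of a partial derivative of `Φ`; each
    -- carries a factor `dirD a (P i)`, which vanishes at `p` by `ha`.
    refine Finset.sum_congr rfl fun i _ => ?_
    rw [smul_eq_mul, Derivation.leibniz, map_add, smul_eq_mul, smul_eq_mul, map_mul, map_mul,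
      ← map_dirD, ← map_dirD, eval_map_eq_aeval, eval_map_eq_aeval, ha]
    ring

/-- The jet of a linear form, averaged over the stabilizer. -/
theorem exists_jet_coeffs_linear (hP : Algebra.adjoin ℝ (Set.range P) = invariants W)
    (p l : Fin ℓ → K) :
    ∃ φ : Fin ℓ → K,
      (∀ j, ∑ i, φ i * aeval p (pderiv j (P i))
        = ∑ w ∈ stab W p, (matK K w.1).vecMul l j) ∧
      ∀ a : Fin ℓ → ℝ, (∀ i, aeval p (dirD a (P i)) = 0) →
        ∑ i, φ i * aeval p (dirD a (dirD a (P i))) = 0 := by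
  obtain ⟨φ, h1, h2⟩ := exists_jet_coeffs hP p (linPoly l)
  refine ⟨φ, ?_, ?_⟩
  · intro j
    rw [h1]
    simp [subst_linPoly, pderiv_linPoly]
  · intro a ha
    rw [h2 a ha]
    refine Finset.sum_eq_zero fun w _ => ?_
    rw [subst_linPoly, dirD_linPoly]
    have : dirD (fun i => algebraMap ℝ K (a i))
      (C ((matK K w.1).vecMul l ⬝ᵥ fun i => algebraMap ℝ K (a i))) = 0 := derivation_C _ _
    rw [this, map_zero]

/-- The jet of the square of a linear form that vanishes at the point. -/
theorem exists_jet_coeffs_sq (hP : Algebra.adjoin ℝ (Set.range P) = invariants W)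
    (p l : Fin ℓ → K) (hl : l ⬝ᵥ p = 0) :
    ∃ φ : Fin ℓ → K,
      (∀ j, ∑ i, φ i * aeval p (pderiv j (P i)) = 0) ∧
      ∀ a : Fin ℓ → ℝ, (∀ i, aeval p (dirD a (P i)) = 0) →
        ∑ i, φ i * aeval p (dirD a (dirD a (P i)))
          = 2 * ∑ w ∈ stab W p,
            (l ⬝ᵥ (matK K w.1).mulVec (fun i => algebraMap ℝ K (a i))) ^ 2 := by
  obtain ⟨φ, h1, h2⟩ := exists_jet_coeffs hP p (linPoly l ^ 2)
  refine ⟨φ, ?_, ?_⟩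
  · intro j
    rw [h1]
    -- The transform of `l` by an element of the stabilizer still vanishes at `p`, so its square has
    -- zero gradient there.
    refine Finset.sum_eq_zero fun w hw => ?_
    rw [map_pow, subst_linPoly, Derivation.leibniz_pow]
    simp [eval_linPoly, ← Matrix.dotProduct_mulVec, mem_stab.1 hw, hl]
  · intro a ha
    rw [h2 a ha, Finset.mul_sum]
    refine Finset.sum_congr rfl fun w hw => ?_
    rw [map_pow, subst_linPoly, Derivation.leibniz_pow]
    have h0 : ∀ c : K, dirD (fun i => algebraMap ℝ K (a i)) (C c) = 0 := fun c => derivation_C _ _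
    simp [dirD_linPoly, h0, ← Matrix.dotProduct_mulVec, Derivation.leibniz, eval_linPoly,
      mem_stab.1 hw, hl]
    exact Or.inl (by ring)

end jets

end

end CoxeterForms

namespace CoxeterForms

noncomputable section

open MvPolynomial

variable {ℓ : ℕ}

/-! ### Linear forms and reflections -/

theorem linPoly_ne_zero {a : Fin ℓ → ℝ} (ha : a ≠ 0) : linPoly a ≠ 0 := by
  obtain ⟨i, hi⟩ := Function.ne_iff.1 ha
  intro h
  apply hi
  rw [← coeff_linPoly a i, h]
  simp

theorem linPoly_totalDegree {a : Fin ℓ → ℝ} (ha : a ≠ 0) : (linPoly a).totalDegree = 1 :=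
  (linPoly_isHomogeneous a).totalDegree (linPoly_ne_zero ha)

theorem linPoly_prime {a : Fin ℓ → ℝ} (ha : a ≠ 0) : Prime (linPoly a) := by
  refine (irreducible_of_totalDegree_eq_one (linPoly_totalDegree ha) fun x hx => ?_).prime
  obtain ⟨i, hi⟩ := Function.ne_iff.1 ha
  have := hx (Finsupp.single i 1)
  rw [coeff_linPoly] at this
  exact isUnit_of_dvd_unit this (isUnit_iff_ne_zero.2 hi)

theorem eq_smul_of_linPoly_dvd {a b : Fin ℓ → ℝ} (ha : a ≠ 0) (h : linPoly a ∣ linPoly b) :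
    ∃ c : ℝ, b = c • a := by
  by_cases hb : b = 0
  · exact ⟨0, by simp [hb]⟩
  obtain ⟨g, hg⟩ := h
  have hg0 : g ≠ 0 := by
    rintro rfl
    exact linPoly_ne_zero hb (by simpa using hg)
  have hd := congrArg totalDegree hg
  rw [totalDegree_mul_of_isDomain (linPoly_ne_zero ha) hg0, linPoly_totalDegree ha,
    linPoly_totalDegree hb] at hd
  have hgC := (totalDegree_eq_zero_iff_eq_C (p := g)).1 (by omega)
  refine ⟨coeff 0 g, ?_⟩
  ext i
  rw [← coeff_linPoly b i, hg, hgC, mul_comm, coeff_C_mul, coeff_linPoly]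
  simp

theorem mat_reflectionIn (a : V ℓ) (i j : Fin ℓ) :
    mat (reflectionIn a) i j = (if i = j then 1 else 0) - 2 * (a i * a j) / ‖a‖ ^ 2 := by
  rw [mat, Matrix.of_apply, reflectionIn, Submodule.reflection_orthogonal_apply,
    Submodule.reflection_singleton_apply]
  simp [stdVec, EuclideanSpace.inner_single_right]
  ring

/-- The reflection changes each coordinate by a multiple of the linear form of `a`. It therefore
induces the identity on the quotient ring, as can be checked on the variables. -/
theorem linPoly_dvd_subst_sub (a : V ℓ) (f : S ℓ) :
    linPoly a.ofLp ∣ subst (mat (reflectionIn a)) f - f := by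
  have key : (Ideal.Quotient.mkₐ ℝ (Ideal.span {linPoly a.ofLp})).comp
      (subst (mat (reflectionIn a))) = Ideal.Quotient.mkₐ ℝ (Ideal.span {linPoly a.ofLp}) := by
    apply MvPolynomial.algHom_ext
    intro i
    rw [AlgHom.comp_apply, Ideal.Quotient.mkₐ_eq_mk, Ideal.Quotient.eq, Ideal.mem_span_singleton]
    refine ⟨C (-(2 * a i) / ‖a‖ ^ 2), ?_⟩
    have : subst (mat (reflectionIn a)) (X i)
        = X i + ∑ j, C (-(2 * (a i * a j)) / ‖a‖ ^ 2) * X j := by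
      rw [subst_X]
      simp only [mat_reflectionIn, C_sub, sub_mul, Finset.sum_sub_distrib, neg_div, C_neg,
        neg_mul, Finset.sum_neg_distrib]
      rw [← sub_eq_add_neg]
      congr 1
      simp [apply_ite C]
    rw [this, add_sub_cancel_left, linPoly, Finset.sum_mul]
    refine Finset.sum_congr rfl fun j _ => ?_
    rw [mul_right_comm, ← C_mul]
    congr 2
    ring
  have := congrArg (fun h => h f) key
  rw [← Ideal.mem_span_singleton, ← Ideal.Quotient.eq]
  exact this

theorem linPoly_dvd_of_subst_eq_neg {a : V ℓ} {f : S ℓ}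
    (h : subst (mat (reflectionIn a)) f = -f) : linPoly a.ofLp ∣ f := by
  have h1 := linPoly_dvd_subst_sub a f
  rw [h] at h1
  have h2 : f = C (-1 / 2) * (-f - f) := by
    have : (C (-1 / 2) * C (-2) : S ℓ) = 1 := by rw [← C_mul]; norm_num
    have h3 : (C (-2) : S ℓ) = -2 := by rw [C_neg, show (C 2 : S ℓ) = 2 from map_ofNat C 2]
    rw [h3] at this
    linear_combination (-f) * this
  rw [h2]
  exact h1.mul_left _

theorem mat_reflectionIn_mulVec (a : V ℓ) :
    (mat (reflectionIn a)).mulVec a.ofLp = -a.ofLp := by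
  ext i
  have := mat_mulVec (reflectionIn a) a i
  rw [this, reflectionIn, Submodule.reflection_orthogonal_apply,
    Submodule.reflection_mem_subspace_eq_self (Submodule.mem_span_singleton_self a)]
  rfl

theorem det_mat_reflectionIn {a : V ℓ} (ha : a ≠ 0) : (mat (reflectionIn a)).det = -1 := by
  rw [det_mat]
  have h := Submodule.det_reflection (𝕜 := ℝ) (ℝ ∙ a)ᗮ
  rw [Submodule.orthogonal_orthogonal, finrank_span_singleton ha, pow_one] at h
  exact h

/-- An isometry that moves every vector along a fixed direction is trivial or a reflection. -/
theorem eq_one_or_eq_reflectionIn {a : V ℓ} (ha : a ≠ 0) {w : V ℓ ≃ₗᵢ[ℝ] V ℓ} {k : Fin ℓ → ℝ}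
    (h : ∀ i j, mat w i j - (if i = j then 1 else 0) = k i * a j) :
    w = 1 ∨ w = reflectionIn a := by
  have hM : ∀ i j, mat w i j = (if i = j then 1 else 0) + k i * a j := fun i j => by
    rw [← h]; ring
  have hn : ‖a‖ ^ 2 ≠ 0 := pow_ne_zero _ (norm_ne_zero_iff.2 ha)
  have hna : ‖a‖ ^ 2 = ∑ j, a j * a j := by
    rw [EuclideanSpace.real_norm_sq_eq]; simp [sq]
  -- Here `w = 1 + k aᵀ`; the relation is the expansion of `wᵀ w = 1`.
  have hT : ∀ i j, (k i * a j + a i * k j) + (∑ m, k m * k m) * (a i * a j) = 0 := by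
    intro i j
    have h1 : (mat w).transpose * mat w = 1 := by rw [mat_transpose, mat_inv_mul]
    have h2 := congrFun (congrFun h1 i) j
    simp only [Matrix.mul_apply, Matrix.transpose_apply, hM, Matrix.one_apply, add_mul, mul_add,
      Finset.sum_add_distrib] at h2
    simp at h2
    rw [Finset.sum_mul]
    have h3 : ∑ x, k x * a i * (k x * a j) = ∑ x, k x * k x * (a i * a j) :=
      Finset.sum_congr rfl fun x _ => by ring
    rw [h3, if_congr (eq_comm (a := j) (b := i)) rfl rfl] at h2
    linarith
  set κ := ∑ m, k m * k m with hκ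
  set n := ‖a‖ ^ 2 with hnn
  set t := ∑ m, k m * a m with ht
  -- Contracting the relation with `a` shows that `k` is a multiple `μ a`. Orthogonality then leaves
  -- `μ (2 + μ n) = 0`, whose roots are the identity and the reflection.
  have hk : ∀ i, k i * n + a i * (t + κ * n) = 0 := by
    intro i
    have : ∑ j, ((k i * a j + a i * k j) + κ * (a i * a j)) * a j = 0 :=
      Finset.sum_eq_zero fun j _ => by rw [hT]; ring
    rw [← this, hna, ht, mul_add, Finset.mul_sum, Finset.mul_sum, Finset.mul_sum, Finset.mul_sum,
      ← Finset.sum_add_distrib, ← Finset.sum_add_distrib]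
    exact Finset.sum_congr rfl fun j _ => by ring
  set μ := -(t + κ * n) / n with hμ
  have hk' : ∀ i, k i = μ * a i := by
    intro i
    rw [hμ]
    field_simp
    linarith [hk i]
  have hμ2 : μ * (2 + μ * n) = 0 := by
    obtain ⟨i, hi⟩ : ∃ i, a i ≠ 0 := by
      by_contra! hc
      exact ha (by ext i; simp [hc i])
    have h1 := hT i i
    have h2 : κ = μ ^ 2 * n := by
      rw [hκ, hna, Finset.mul_sum]
      exact Finset.sum_congr rfl fun j _ => by rw [hk']; ring
    rw [h2, hk'] at h1
    have h3 : (a i * a i) * (μ * (2 + μ * n)) = 0 := by linarith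
    exact (mul_eq_zero.1 h3).resolve_left (mul_ne_zero hi hi)
  rcases mul_eq_zero.1 hμ2 with h0 | h0
  · left
    apply mat_injective
    rw [mat_one]
    ext i j
    rw [hM, hk', h0, Matrix.one_apply]
    ring
  · right
    apply mat_injective
    ext i j
    rw [hM, hk', mat_reflectionIn, ← hnn]
    have : μ = -2 / n := by field_simp; linarith
    rw [this]
    ring

/-! ### The defining polynomial -/

variable {W : Subgroup (V ℓ ≃ₗᵢ[ℝ] V ℓ)} {α : Submodule ℝ (V ℓ) → Module.Dual ℝ (V ℓ)}

/-- A reflecting hyperplane is the fixed space of its reflection, hence is determined by an element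
of `W`. -/
theorem finite_reflectingHyperplanes [Finite W] : (reflectingHyperplanes W).Finite := by
  refine (Set.finite_range fun w : W =>
    LinearMap.eqLocus w.1.toLinearEquiv.toLinearMap LinearMap.id).subset ?_
  rintro H ⟨v, -, hv, rfl⟩
  refine ⟨⟨_, hv⟩, ?_⟩
  ext x
  exact Submodule.reflection_eq_self_iff x

/-- The normal vector of a reflecting hyperplane that represents the chosen linear form. -/
def normal (α : Submodule ℝ (V ℓ) → Module.Dual ℝ (V ℓ)) (H : Submodule ℝ (V ℓ)) : V ℓ :=
  WithLp.toLp 2 fun j => α H (stdVec j)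

theorem inner_normal (H : Submodule ℝ (V ℓ)) (x : V ℓ) : inner ℝ (normal α H) x = α H x := by
  conv_rhs => rw [← sum_smul_stdVec x]
  simp [normal, PiLp.inner_apply]

theorem orthogonal_normal
    (hα : ∀ H ∈ reflectingHyperplanes W, LinearMap.ker (α H) = H)
    {H : Submodule ℝ (V ℓ)} (hH : H ∈ reflectingHyperplanes W) :
    (ℝ ∙ normal α H)ᗮ = H := by
  ext x
  rw [Submodule.mem_orthogonal_singleton_iff_inner_right, inner_normal, ← LinearMap.mem_ker,
    hα H hH]

theorem normal_ne_zero
    (hα : ∀ H ∈ reflectingHyperplanes W, LinearMap.ker (α H) = H)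
    {H : Submodule ℝ (V ℓ)} (hH : H ∈ reflectingHyperplanes W) :
    normal α H ≠ 0 := by
  intro h
  have h1 := orthogonal_normal hα hH
  obtain ⟨v, hv, -, rfl⟩ := hH
  rw [h, Submodule.span_zero_singleton, Submodule.bot_orthogonal_eq_top] at h1
  have : v ∈ (ℝ ∙ v)ᗮ := by rw [← h1]; trivial
  rw [Submodule.mem_orthogonal_singleton_iff_inner_right, inner_self_eq_zero] at this
  exact hv this

theorem span_normal
    (hα : ∀ H ∈ reflectingHyperplanes W, LinearMap.ker (α H) = H)
    {v : V ℓ} (hH : (ℝ ∙ v)ᗮ ∈ reflectingHyperplanes W) :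
    (ℝ ∙ normal α (ℝ ∙ v)ᗮ) = ℝ ∙ v := by
  have := congrArg Submodule.orthogonal (orthogonal_normal hα hH)
  rwa [Submodule.orthogonal_orthogonal, Submodule.orthogonal_orthogonal] at this

theorem reflectionIn_normal_mem
    (hα : ∀ H ∈ reflectingHyperplanes W, LinearMap.ker (α H) = H)
    {H : Submodule ℝ (V ℓ)} (hH : H ∈ reflectingHyperplanes W) :
    reflectionIn (normal α H) ∈ W := by
  have hH' := hH
  obtain ⟨v, hv, hw, rfl⟩ := hH
  have h1 := span_normal hα hH'
  have : reflectionIn (normal α (ℝ ∙ v)ᗮ) = reflectionIn v := by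
    unfold reflectionIn
    simp only [h1]
  rwa [this]

theorem eq_of_linPoly_normal_dvd
    (hα : ∀ H ∈ reflectingHyperplanes W, LinearMap.ker (α H) = H)
    {H H' : Submodule ℝ (V ℓ)} (hH : H ∈ reflectingHyperplanes W)
    (hH' : H' ∈ reflectingHyperplanes W)
    (h : linPoly (normal α H).ofLp ∣ linPoly (normal α H').ofLp) : H = H' := by
  have h0 : ∀ {v : V ℓ}, v ≠ 0 → v.ofLp ≠ 0 := fun hv h => hv (by ext i; simp [h])
  obtain ⟨c, hc⟩ := eq_smul_of_linPoly_dvd (h0 (normal_ne_zero hα hH)) h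
  have hc' : normal α H' = c • normal α H := by ext i; simp [hc]
  have hc0 : c ≠ 0 := by
    rintro rfl
    exact normal_ne_zero hα hH' (by simpa using hc')
  rw [← orthogonal_normal hα hH, ← orthogonal_normal hα hH', hc',
    Submodule.span_singleton_smul_eq (IsUnit.mk0 c hc0)]

theorem definingPolynomial_eq [Finite W] :
    definingPolynomial W α
      = ∏ H ∈ (finite_reflectingHyperplanes (W := W)).toFinset, linPoly (normal α H).ofLp := by
  rw [definingPolynomial, finprod_mem_eq_finite_toFinset_prod _ finite_reflectingHyperplanes]
  rfl

/-- Anti-invariant polynomials are divisible by the defining polynomial. -/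
theorem definingPolynomial_dvd
    (hα : ∀ H ∈ reflectingHyperplanes W, LinearMap.ker (α H) = H)
    [Finite W] {f : S ℓ}
    (hf : ∀ w ∈ W, subst (mat w) f = C (mat w).det * f) : definingPolynomial W α ∣ f := by
  rw [definingPolynomial_eq]
  have h0 : ∀ {v : V ℓ}, v ≠ 0 → v.ofLp ≠ 0 := fun hv h => hv (by ext i; simp [h])
  -- The forms of distinct hyperplanes are non-associate primes, so it suffices that each one
  -- divides `f`. This follows from `f` changing sign under the corresponding reflection.
  refine Finset.prod_dvd_of_isRelPrime ?_ ?_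
  · intro H hH H' hH' hne
    rw [Finset.mem_coe, Set.Finite.mem_toFinset] at hH hH'
    refine ((linPoly_prime (h0 (normal_ne_zero hα hH))).irreducible.isRelPrime_iff_not_dvd).2
      fun h => hne (eq_of_linPoly_normal_dvd hα hH hH' h)
  · intro H hH
    rw [Set.Finite.mem_toFinset] at hH
    refine linPoly_dvd_of_subst_eq_neg ?_
    rw [hf _ (reflectionIn_normal_mem hα hH), det_mat_reflectionIn (normal_ne_zero hα hH)]
    simp

theorem definingPolynomial_ne_zero
    (hα : ∀ H ∈ reflectingHyperplanes W, LinearMap.ker (α H) = H)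
    [Finite W] : definingPolynomial W α ≠ 0 := by
  rw [definingPolynomial_eq]
  refine Finset.prod_ne_zero_iff.2 fun H hH => linPoly_ne_zero fun h => ?_
  rw [Set.Finite.mem_toFinset] at hH
  exact normal_ne_zero hα hH (by ext i; simp [h])

end

end CoxeterForms

namespace CoxeterForms

noncomputable section

open MvPolynomial

variable {ℓ : ℕ}

/-! ### The Jacobian of the basic invariants -/

/-- The Jacobian matrix of a family of polynomials. -/
def jac (P : Fin ℓ → S ℓ) : Matrix (Fin ℓ) (Fin ℓ) (S ℓ) := Matrix.of fun i j => pderiv j (P i)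

/-- The coordinates are the classes of the variables in the fraction field of the quotient by `I`.
Membership in a prime ideal thus becomes vanishing at a single point, where linear algebra over a
field is available. -/
theorem exists_generic_point (I : Ideal (S ℓ)) [I.IsPrime] :
    ∃ (K : Type) (_ : Field K) (_ : Algebra ℝ K) (p : Fin ℓ → K),
      ∀ f : S ℓ, aeval p f = 0 ↔ f ∈ I := by
  refine ⟨FractionRing (S ℓ ⧸ I), inferInstance, inferInstance,
    fun i => algebraMap (S ℓ ⧸ I) _ (Ideal.Quotient.mk I (X i)), fun f => ?_⟩
  have : (aeval fun i => algebraMap (S ℓ ⧸ I) (FractionRing (S ℓ ⧸ I)) (Ideal.Quotient.mk I (X i)))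
      = (IsScalarTower.toAlgHom ℝ (S ℓ ⧸ I) (FractionRing (S ℓ ⧸ I))).comp
        (Ideal.Quotient.mkₐ ℝ I) := by
    apply MvPolynomial.algHom_ext
    intro i
    simp
  rw [this]
  simp [Ideal.Quotient.eq_zero_iff_mem]

theorem subst_jac {A : Matrix (Fin ℓ) (Fin ℓ) ℝ} {P : Fin ℓ → S ℓ}
    (h : ∀ i, subst A (P i) = P i) :
    (jac P).map (subst A) * A.map C = jac P := by
  ext1 i j
  simp only [Matrix.mul_apply, Matrix.map_apply, jac, Matrix.of_apply]
  conv_rhs => rw [← h i, pderiv_subst]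
  exact Finset.sum_congr rfl fun m _ => mul_comm _ _

theorem det_mat_mul_self (w : V ℓ ≃ₗᵢ[ℝ] V ℓ) : (mat w).det * (mat w).det = 1 := by
  conv_lhs => enter [1]; rw [← Matrix.det_transpose, mat_transpose]
  rw [← Matrix.det_mul, mat_inv_mul, Matrix.det_one]

variable {W : Subgroup (V ℓ ≃ₗᵢ[ℝ] V ℓ)} {P : Fin ℓ → S ℓ}

theorem generator_mem (hP : Algebra.adjoin ℝ (Set.range P) = invariants W) (i : Fin ℓ) :
    P i ∈ invariants W := hP ▸ Algebra.subset_adjoin ⟨i, rfl⟩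

theorem subst_det_jac (hP : Algebra.adjoin ℝ (Set.range P) = invariants W)
    {w : V ℓ ≃ₗᵢ[ℝ] V ℓ} (hw : w ∈ W) :
    subst (mat w) (jac P).det = C (mat w).det * (jac P).det := by
  have h := congrArg Matrix.det
    (subst_jac (A := mat w) fun i => mem_invariants.1 (generator_mem hP i) w hw)
  rw [Matrix.det_mul] at h
  have h1 : ((jac P).map (subst (mat w))).det = subst (mat w) (jac P).det :=
    ((subst (mat w)).map_det _).symm
  have h2 : ((mat w).map (C : ℝ → S ℓ)).det = C (mat w).det :=
    ((C : ℝ →+* S ℓ).map_det _).symm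
  rw [h1, h2] at h
  conv_rhs => rw [← h]
  rw [mul_comm, mul_assoc, ← C_mul, det_mat_mul_self, C_1, mul_one]

/-- With a trivial stabilizer no averaging takes place, so every coordinate differential at `p` is a
combination of the differentials of the `P i`. A vector in the kernel of the Jacobian matrix is then
killed by all coordinates. -/
theorem aeval_det_jac_ne_zero [Fintype W] {K : Type*} [Field K] [Algebra ℝ K]
    (hP : Algebra.adjoin ℝ (Set.range P) = invariants W) {p : Fin ℓ → K}
    (hp : ∀ w ∈ stab W p, w = 1) : aeval p (jac P).det ≠ 0 := by
  classical
  intro h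
  rw [AlgHom.map_det] at h
  obtain ⟨c, hc, h⟩ := Matrix.exists_mulVec_eq_zero_iff.2 h
  apply hc
  ext m
  obtain ⟨φ, hφ, -⟩ := exists_jet_coeffs_linear hP p (Pi.single m 1)
  have hs : stab W p = {1} := by
    ext w
    rw [Finset.mem_singleton]
    exact ⟨hp w, fun h => h ▸ one_mem_stab p⟩
  simp only [hs, Finset.sum_singleton, Subgroup.coe_one, matK_one, Matrix.vecMul_one] at hφ
  have : ∑ i, φ i * ∑ j, aeval p (pderiv j (P i)) * c j = c m := by
    simp only [Finset.mul_sum]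
    rw [Finset.sum_comm]
    simp only [← mul_assoc, ← Finset.sum_mul, hφ]
    simp [Pi.single_apply]
  rw [← this]
  refine Finset.sum_eq_zero fun i _ => ?_
  have h2 := congrFun h i
  simp only [Matrix.mulVec, dotProduct, AlgHom.mapMatrix_apply, Matrix.map_apply, jac,
    Matrix.of_apply, Pi.zero_apply] at h2
  rw [h2, mul_zero]

/-- The reflection sends `a` to `-a`, so the derivative of an invariant along `a` changes sign under
it. -/
theorem linPoly_dvd_dirD {a : V ℓ} {f : S ℓ} (hf : subst (mat (reflectionIn a)) f = f) :
    linPoly a.ofLp ∣ dirD a.ofLp f := by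
  apply linPoly_dvd_of_subst_eq_neg
  conv_rhs => rw [← hf, dirD_subst, mat_reflectionIn_mulVec]
  simp [dirD_apply]

/-- At the generic point of a prime ideal this places every row of `w - 1`, read as a linear form,
in that ideal. -/
theorem generic_stab {K : Type*} [Field K] [Algebra ℝ K] [Fintype W] {p : Fin ℓ → K} {w : W}
    (hw : w ∈ stab W p) (i : Fin ℓ) :
    aeval p (linPoly fun j => mat w.1 i j - if i = j then 1 else 0) = 0 := by
  rw [mem_stab] at hw
  have := congrFun hw i
  simp only [Matrix.mulVec, dotProduct, matK, Matrix.map_apply] at this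
  rw [aeval_linPoly]
  simp only [dotProduct, map_sub, sub_mul, Finset.sum_sub_distrib, this]
  simp

theorem ofLp_ne_zero {v : V ℓ} (hv : v ≠ 0) : v.ofLp ≠ 0 := fun h => hv (by ext i; simp [h])

/-- The Jacobian determinant vanishes only to first order along a reflecting hyperplane. -/
theorem not_sq_dvd_det_jac [Finite W] (hP : Algebra.adjoin ℝ (Set.range P) = invariants W)
    {a : V ℓ} (ha : a ≠ 0) (hs : reflectionIn a ∈ W) : ¬ linPoly a.ofLp ^ 2 ∣ (jac P).det := by
  classical
  have := Fintype.ofFinite W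
  rintro ⟨g, hg⟩
  have hpr := linPoly_prime (ofLp_ne_zero ha)
  choose R hR using fun i => linPoly_dvd_dirD (a := a)
    (mem_invariants.1 (generator_mem hP i) _ hs)
  obtain ⟨m, hm⟩ := Function.ne_iff.1 (ofLp_ne_zero ha)
  -- The combination of the columns of the Jacobian matrix with coefficients `a` is the linear form
  -- of `a` times `R`. Putting it in column `m`, where `a m ≠ 0`, splits one factor off the
  -- determinant; a square factor would make the remaining determinant vanish on the whole
  -- hyperplane.
  have h1 : C (a m) * (jac P).det = linPoly a.ofLp * ((jac P).updateCol m R).det := by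
    have h : (jac P).updateCol m (fun k => ∑ i, (C (a.ofLp i) : S ℓ) • jac P k i)
        = (jac P).updateCol m (linPoly a.ofLp • R) := by
      congr 1
      ext1 i
      rw [Pi.smul_apply, smul_eq_mul, ← hR, dirD_apply]
      rfl
    rw [← smul_eq_mul, ← Matrix.det_updateCol_sum (jac P) m fun j => C (a j), h,
      Matrix.det_updateCol_smul]
  have h2 : linPoly a.ofLp ∣ ((jac P).updateCol m R).det := by
    refine ⟨C (a m) * g, mul_left_cancel₀ hpr.ne_zero ?_⟩
    rw [← h1, hg]
    ring
  have : (Ideal.span {linPoly a.ofLp}).IsPrime :=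
    (Ideal.span_singleton_prime hpr.ne_zero).2 hpr
  -- At the generic point of the hyperplane the modified matrix has a kernel vector `c`. The rest of
  -- the proof shows `c = 0`.
  obtain ⟨K, _, _, p, hp⟩ := exists_generic_point (Ideal.span {linPoly a.ofLp})
  have : CharZero K := charZero_of_injective_algebraMap (algebraMap ℝ K).injective
  have hpa : aeval p (linPoly a.ofLp) = 0 := (hp _).2 (Ideal.mem_span_singleton_self _)
  have h3 := (hp _).2 (Ideal.mem_span_singleton.2 h2)
  rw [AlgHom.map_det] at h3
  obtain ⟨c, hc, h3⟩ := Matrix.exists_mulVec_eq_zero_iff.2 h3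
  have h4 : ∀ i, aeval p (R i) * c m
      + ∑ j ∈ Finset.univ.erase m, aeval p (pderiv j (P i)) * c j = 0 := by
    intro i
    have := congrFun h3 i
    simp only [Matrix.mulVec, dotProduct, AlgHom.mapMatrix_apply, Matrix.map_apply,
      Matrix.updateCol_apply, Pi.zero_apply] at this
    rw [← Finset.add_sum_erase _ _ (Finset.mem_univ m), if_pos rfl] at this
    rw [← this]
    congr 1
    refine Finset.sum_congr rfl fun j hj => ?_
    rw [if_neg (Finset.ne_of_mem_erase hj)]
    rfl
  set n : ℝ := a.ofLp ⬝ᵥ a.ofLp with hn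
  have hn0 : n ≠ 0 := fun h => ofLp_ne_zero ha (dotProduct_self_eq_zero.1 h)
  have h5 : ∀ i, aeval p (dirD a.ofLp (P i)) = 0 := by
    intro i
    rw [hR, map_mul, hpa, zero_mul]
  have h6 : ∀ i, aeval p (dirD a.ofLp (dirD a.ofLp (P i))) = algebraMap ℝ K n * aeval p (R i) := by
    intro i
    rw [hR, Derivation.leibniz, map_add, smul_eq_mul, smul_eq_mul, map_mul, map_mul, hpa,
      dirD_linPoly, aeval_C]
    ring
  -- The jet of the square of the form gives coefficients `φ` that annihilate all gradients but not
  -- `R`: the second derivatives along `a` are `n R`, and their `φ`-combination is a sum of real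
  -- squares whose term at `w = 1` is positive.
  have hcm : c m = 0 := by
    obtain ⟨φ, hφ1, hφ2⟩ := exists_jet_coeffs_sq hP p (fun i => algebraMap ℝ K (a i)) (by
      rw [← hpa, aeval_linPoly])
    have h7 := hφ2 _ h5
    simp only [h6] at h7
    have h8 : ∑ i, φ i * (aeval p (R i) * c m) = 0 := by
      have : ∑ i, φ i * (aeval p (R i) * c m
          + ∑ j ∈ Finset.univ.erase m, aeval p (pderiv j (P i)) * c j) = 0 :=
        Finset.sum_eq_zero fun i _ => by rw [h4, mul_zero]
      simp only [mul_add, Finset.sum_add_distrib, Finset.mul_sum] at this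
      rw [Finset.sum_comm (s := Finset.univ)] at this
      simp only [← mul_assoc, ← Finset.sum_mul, hφ1] at this
      simpa only [zero_mul, Finset.sum_const_zero, add_zero, ← mul_assoc, ← Finset.sum_mul] using this
    simp only [← mul_assoc, ← Finset.sum_mul] at h8
    refine (mul_eq_zero.1 h8).resolve_left fun h9 => ?_
    have h10 : ∑ i, φ i * (algebraMap ℝ K n * aeval p (R i)) = 0 := by
      rw [← mul_zero (algebraMap ℝ K n), ← h9, Finset.mul_sum]
      exact Finset.sum_congr rfl fun i _ => by ring
    rw [h10] at h7
    have h11 : ∀ w : W, ((fun i => algebraMap ℝ K (a i)) ⬝ᵥ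
        (matK K w.1).mulVec fun i => algebraMap ℝ K (a i))
        = algebraMap ℝ K (a.ofLp ⬝ᵥ (mat w.1).mulVec a.ofLp) := by
      intro w
      simp [dotProduct, Matrix.mulVec, matK]
    simp only [h11, ← map_pow, ← map_sum] at h7
    have h12 := (mul_eq_zero.1 h7.symm).resolve_left two_ne_zero
    rw [map_eq_zero] at h12
    have h13 := (Finset.sum_eq_zero_iff_of_nonneg fun w _ => sq_nonneg _).1 h12 1 (one_mem_stab p)
    rw [Subgroup.coe_one, mat_one, Matrix.one_mulVec] at h13
    exact hn0 (pow_eq_zero_iff two_ne_zero |>.1 h13)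
  have hst : stab W p = {1, ⟨_, hs⟩} := by
    ext w
    rw [Finset.mem_insert, Finset.mem_singleton]
    constructor
    · intro hw
      have hk : ∀ i, ∃ k : ℝ, (fun j => mat w.1 i j - if i = j then 1 else 0) = k • a.ofLp :=
        fun i => eq_smul_of_linPoly_dvd (ofLp_ne_zero ha)
          (Ideal.mem_span_singleton.1 ((hp _).1 (generic_stab hw i)))
      choose k hk using hk
      rcases eq_one_or_eq_reflectionIn ha (fun i j => congrFun (hk i) j) with h | h
      · exact Or.inl (Subtype.ext h)
      · exact Or.inr (Subtype.ext h)
    · rintro (rfl | rfl)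
      · exact one_mem_stab p
      · rw [mem_stab]
        ext i
        have h := linPoly_dvd_subst_sub a (X i)
        have h' := (hp _).2 (Ideal.mem_span_singleton.2 h)
        rw [map_sub, aeval_subst, sub_eq_zero, aeval_X, aeval_X] at h'
        exact h'
  -- Jets of linear forms show that `c` is killed by the sum of `l` over the stabilizer, which
  -- consists of the identity and the reflection. Hence `c` is in the kernel of `1 + s`, so it is a
  -- multiple of `a`, and `c m = 0` with `a m ≠ 0` forces it to vanish.
  have h14 : ∀ l : Fin ℓ → K, ∑ j, (∑ w ∈ stab W p, (matK K w.1).vecMul l j) * c j = 0 := by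
    intro l
    obtain ⟨φ, hφ1, -⟩ := exists_jet_coeffs_linear hP p l
    simp only [← hφ1, Finset.sum_mul]
    rw [Finset.sum_comm]
    refine Finset.sum_eq_zero fun i _ => ?_
    have := h4 i
    rw [hcm, mul_zero, zero_add] at this
    rw [← Finset.add_sum_erase _ _ (Finset.mem_univ m), hcm, mul_zero, zero_add]
    simp only [mul_assoc, ← Finset.mul_sum, this, mul_zero]
  by_cases h1s : (1 : W) = ⟨_, hs⟩
  · apply_fun fun w : W => (mat w.1).det at h1s
    simp only [Subgroup.coe_one, mat_one, Matrix.det_one, det_mat_reflectionIn ha] at h1s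
    norm_num at h1s
  · have h15 : ∀ i, ∑ j, ((2 : K) * (if i = j then 1 else 0)
        - algebraMap ℝ K (2 * (a i * a j) / ‖a‖ ^ 2)) * c j = 0 := by
      intro i
      have := h14 (Pi.single i 1)
      refine Eq.trans ?_ this
      refine Finset.sum_congr rfl fun j _ => ?_
      have hrow : ∀ M : Matrix (Fin ℓ) (Fin ℓ) K, M.vecMul (Pi.single i 1) j = M i j := by
        intro M
        simp
      rw [hst, Finset.sum_pair h1s, hrow, hrow, Subgroup.coe_one, matK_one, matK,
        Matrix.map_apply, mat_reflectionIn, Matrix.one_apply, map_sub,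
        apply_ite (algebraMap ℝ K), map_one, map_zero]
      ring
    have h16 : ∀ i, 2 * c i = algebraMap ℝ K (a i)
        * ∑ j, algebraMap ℝ K (2 * a j / ‖a‖ ^ 2) * c j := by
      intro i
      have := h15 i
      simp only [sub_mul, Finset.sum_sub_distrib, sub_eq_zero] at this
      rw [Finset.mul_sum]
      simp only [mul_ite, mul_one, mul_zero, ite_mul, zero_mul, Finset.sum_ite_eq, Finset.mem_univ,
        if_true] at this
      rw [this]
      refine Finset.sum_congr rfl fun j _ => ?_
      rw [← mul_assoc (algebraMap ℝ K (a i)), ← map_mul]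
      congr 2
      ring
    have h17 : ∑ j, algebraMap ℝ K (2 * a j / ‖a‖ ^ 2) * c j = 0 := by
      have := h16 m
      rw [hcm, mul_zero] at this
      exact (mul_eq_zero.1 this.symm).resolve_left
        fun h => hm ((map_eq_zero (algebraMap ℝ K)).1 h)
    apply hc
    ext i
    have := h16 i
    rw [h17, mul_zero] at this
    exact (mul_eq_zero.1 this).resolve_left two_ne_zero

/-- The Jacobian determinant of the basic invariants is a constant multiple of the defining
polynomial. -/
theorem exists_det_jac_eq [Finite W] (hP : Algebra.adjoin ℝ (Set.range P) = invariants W)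
    {α : Submodule ℝ (V ℓ) → Module.Dual ℝ (V ℓ)}
    (hα : ∀ H ∈ reflectingHyperplanes W, LinearMap.ker (α H) = H) :
    ∃ c : ℝ, c ≠ 0 ∧ (jac P).det = C c * definingPolynomial W α := by
  have := Fintype.ofFinite W
  obtain ⟨g, hg⟩ := definingPolynomial_dvd hα fun w hw => subst_det_jac hP hw
  -- If the Jacobian determinant vanishes at the generic point of `I`, that point has a nontrivial
  -- stabilizer.
  have key : ∀ I : Ideal (S ℓ), I.IsPrime → (jac P).det ∈ I →
      ∃ w : W, w ≠ 1 ∧ ∀ i, linPoly (fun j => mat w.1 i j - if i = j then 1 else 0) ∈ I := by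
    intro I hI hJ
    obtain ⟨K, _, _, p, hp⟩ := exists_generic_point I
    by_contra! hne
    refine aeval_det_jac_ne_zero hP (p := p) (fun w hw => ?_) ((hp _).2 hJ)
    by_contra h1
    obtain ⟨i, hi⟩ := hne w h1
    exact hi ((hp _).1 (generic_stab hw i))
  have rows : ∀ w : W, w ≠ 1 → ∃ i, (fun j => mat w.1 i j - if i = j then 1 else 0) ≠ 0 := by
    intro w hw
    by_contra! hc
    apply hw
    apply Subtype.ext
    apply mat_injective
    rw [Subgroup.coe_one, mat_one]
    ext i j
    rw [Matrix.one_apply, ← sub_eq_zero]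
    exact congrFun (hc i) j
  have hg0 : g ≠ 0 := by
    rintro rfl
    obtain ⟨w, hw, h⟩ := key ⊥ inferInstance (by rw [hg, mul_zero]; exact Ideal.zero_mem _)
    obtain ⟨i, hi⟩ := rows w hw
    exact linPoly_ne_zero hi (h i)
  -- A prime factor `π` of the cofactor `g` divides all rows of some `w - 1` with `w ≠ 1`. A nonzero
  -- row `r` is then associate to `π` and all rows are multiples of it, so `w` is the reflection in
  -- `r`. Thus `r` divides both `Q` and `g`, and its square divides the Jacobian determinant, which
  -- is excluded.
  have hu : IsUnit g := by
    by_contra hnu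
    obtain ⟨π, hπ, hπg⟩ := WfDvdMonoid.exists_irreducible_factor hnu hg0
    have : (Ideal.span {π}).IsPrime := (Ideal.span_singleton_prime hπ.ne_zero).2 hπ.prime
    obtain ⟨w, hw, h⟩ := key _ this
      (Ideal.mem_span_singleton.2 (hg ▸ hπg.mul_left _))
    obtain ⟨i, hi⟩ := rows w hw
    simp only [Ideal.mem_span_singleton] at h
    set r : V ℓ := WithLp.toLp 2 (fun j => mat w.1 i j - if i = j then 1 else 0) with hr
    have hr0 : r ≠ 0 := fun h0 => hi (by
      have := congrArg WithLp.ofLp h0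
      exact this)
    have hrp : linPoly r.ofLp ∣ π :=
      (hπ.dvd_symm (linPoly_prime (ofLp_ne_zero hr0)).irreducible (h i))
    have hk : ∀ i, ∃ k : ℝ, (fun j => mat w.1 i j - if i = j then 1 else 0) = k • r.ofLp :=
      fun i => eq_smul_of_linPoly_dvd (ofLp_ne_zero hr0) (hrp.trans (h i))
    choose k hk using hk
    have hw' : w.1 = reflectionIn r :=
      (eq_one_or_eq_reflectionIn hr0 (fun i j => congrFun (hk i) j)).resolve_left
        fun h => hw (Subtype.ext h)
    have hrW : reflectionIn r ∈ W := hw' ▸ w.2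
    have hH : (ℝ ∙ r)ᗮ ∈ reflectingHyperplanes W := ⟨r, hr0, hrW, rfl⟩
    have hrQ : linPoly r.ofLp ∣ definingPolynomial W α := by
      have h1 : linPoly (normal α (ℝ ∙ r)ᗮ).ofLp ∣ definingPolynomial W α := by
        rw [definingPolynomial_eq]
        exact Finset.dvd_prod_of_mem (fun H => linPoly (normal α H).ofLp)
          ((Set.Finite.mem_toFinset _).2 hH)
      refine dvd_trans ?_ h1
      have h2 : normal α (ℝ ∙ r)ᗮ ∈ ℝ ∙ r := by
        have h3 := Submodule.mem_span_singleton_self (R := ℝ) (normal α (ℝ ∙ r)ᗮ)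
        rwa [span_normal hα hH] at h3
      obtain ⟨c, hc⟩ := Submodule.mem_span_singleton.1 h2
      rw [← hc]
      exact ⟨C c, by rw [mul_comm, ← linPoly_smul]; rfl⟩
    refine not_sq_dvd_det_jac hP hr0 hrW ?_
    rw [hg, sq]
    exact mul_dvd_mul hrQ (hrp.trans hπg)
  obtain ⟨c, hc, rfl⟩ := isUnit_iff_eq_C_of_isReduced.1 hu
  exact ⟨c, hc.ne_zero, by rw [hg, mul_comm]⟩

end

end CoxeterForms

namespace CoxeterForms

noncomputable section

open MvPolynomial

variable {ℓ : ℕ}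

/-! ### Degrees of the basic invariants -/

theorem aeval_smul_of_isHomogeneous {K : Type*} [Field K] [Algebra ℝ K] {f : S ℓ} {n : ℕ}
    (hf : f.IsHomogeneous n) (c : K) (p : Fin ℓ → K) :
    aeval (c • p) f = c ^ n * aeval p f := by
  rw [aeval_def, aeval_def, eval₂_eq, eval₂_eq, Finset.mul_sum]
  refine Finset.sum_congr rfl fun m hm => ?_
  have hd : ∑ i ∈ m.support, m i = n := by
    have := hf (mem_support_iff.1 hm)
    rw [← this, Finsupp.weight_apply, Finsupp.sum]
    simp
  simp only [Pi.smul_apply, smul_eq_mul, mul_pow, Finset.prod_mul_distrib]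
  rw [Finset.prod_pow_eq_pow_sum, hd]
  ring

theorem isHomogeneous_dirD {f : S ℓ} {n : ℕ} (hf : f.IsHomogeneous n) (a : Fin ℓ → ℝ) :
    (dirD a f).IsHomogeneous (n - 1) := by
  rw [dirD_apply]
  exact IsHomogeneous.sum _ _ _ fun i _ => (hf.pderiv).C_mul _

variable {W : Subgroup (V ℓ ≃ₗᵢ[ℝ] V ℓ)} {P : Fin ℓ → S ℓ}

theorem exists_eq_C_of_isHomogeneous_zero {f : S ℓ} (hf : f.IsHomogeneous 0) : ∃ c : ℝ, f = C c :=
  ⟨_, totalDegree_eq_zero_iff_eq_C.1 (Nat.le_zero.1 hf.totalDegree_le)⟩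

theorem exists_eq_linPoly {f : S ℓ} (hf : f.IsHomogeneous 1) : ∃ a : Fin ℓ → ℝ, f = linPoly a := by
  choose a ha using fun j => exists_eq_C_of_isHomogeneous_zero (hf.pderiv (i := j))
  refine ⟨a, ?_⟩
  have := hf.sum_X_mul_pderiv
  rw [one_smul] at this
  rw [← this, linPoly]
  exact Finset.sum_congr rfl fun j _ => by rw [ha, mul_comm]

theorem linPoly_injective : Function.Injective (linPoly : (Fin ℓ → ℝ) → S ℓ) := by
  intro a b h
  ext i
  rw [← coeff_linPoly a i, h, coeff_linPoly]

/-- The line spanned by a nonzero fixed vector would be a stable subspace, proper because `ℓ ≥ 2`.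
-/
theorem invariant_vector_eq_zero (hℓ : 2 ≤ ℓ) (hW : IsRealCoxeterGroup W) {a : V ℓ}
    (ha : ∀ w ∈ W, w a = a) : a = 0 := by
  rcases hW.irreducible (ℝ ∙ a) (fun w hw u hu => by
    obtain ⟨c, rfl⟩ := Submodule.mem_span_singleton.1 hu
    rw [map_smul, ha w hw]
    exact Submodule.smul_mem _ _ (Submodule.mem_span_singleton_self a)) with h | h
  · exact Submodule.span_singleton_eq_bot.1 h
  · have h1 := finrank_span_le_card (R := ℝ) ({a} : Set (V ℓ))
    rw [h, finrank_top, finrank_euclideanSpace_fin] at h1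
    simp at h1
    omega

theorem invariant_linPoly_eq_zero (hℓ : 2 ≤ ℓ) (hW : IsRealCoxeterGroup W) {a : Fin ℓ → ℝ}
    (ha : linPoly a ∈ invariants W) : a = 0 := by
  have h := invariant_vector_eq_zero hℓ hW (a := WithLp.toLp 2 a) (fun w hw => by
    have h1 := mem_invariants.1 ha _ (inv_mem hw)
    rw [subst_linPoly] at h1
    have h2 := linPoly_injective h1
    rw [← mat_transpose, Matrix.vecMul_transpose] at h2
    ext i
    rw [← mat_mulVec]
    exact congrFun h2 i)
  exact congrArg WithLp.ofLp h

/-- A constant generator contradicts algebraic independence, and irreducibility leaves no nonzero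
invariant linear form. -/
theorem two_le_totalDegree (hℓ : 2 ≤ ℓ) (hW : IsRealCoxeterGroup W) (hP : IsBasicInvariants W P)
    (i : Fin ℓ) : 2 ≤ (P i).totalDegree := by
  have h0 : ∀ c : ℝ, P i ≠ C c := by
    intro c hc
    have : (X i : MvPolynomial (Fin ℓ) ℝ) = C c := by
      apply hP.algebraicIndependent
      rw [aeval_X, hc, aeval_C]
      rfl
    have h1 := congrArg totalDegree this
    simp at h1
  by_contra! hlt
  have hh := hP.homogeneous i
  interval_cases hd : (P i).totalDegree
  · obtain ⟨c, hc⟩ := exists_eq_C_of_isHomogeneous_zero hh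
    exact h0 c hc
  · obtain ⟨a, ha⟩ := exists_eq_linPoly hh
    have h1 := generator_mem hP.adjoin_eq i
    rw [ha] at h1
    have h2 := invariant_linPoly_eq_zero hℓ hW h1
    apply h0 0
    rw [ha, h2]
    simp [linPoly]

theorem pderiv_comm (i j : Fin ℓ) (f : S ℓ) : pderiv i (pderiv j f) = pderiv j (pderiv i f) := by
  have h := Derivation.congr_fun (D1 := ⁅pderiv (R := ℝ) i, pderiv j⁆) (D2 := 0) (by
    apply MvPolynomial.derivation_ext
    intro m
    simp [Derivation.commutator_apply, pderiv_X, Pi.single_apply, apply_ite]) f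
  rw [Derivation.commutator_apply, Derivation.zero_apply, sub_eq_zero] at h
  exact h

/-- Invariant quadratic forms of an irreducible group are multiples of the square norm. -/
theorem exists_pderiv_eq (hW : IsRealCoxeterGroup W) {f : S ℓ} (hf : f ∈ invariants W)
    (hd : f.IsHomogeneous 2) : ∃ c : ℝ, ∀ j, pderiv j f = C c * X j := by
  have := hW.nontrivial
  choose H hH using fun j => exists_eq_linPoly (hd.pderiv (i := j))
  have hsymm : ∀ i j, H i j = H j i := by
    intro i j
    have h1 := pderiv_comm i j f
    rw [hH, hH, pderiv_linPoly, pderiv_linPoly] at h1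
    exact (C_injective _ _ h1).symm
  have hmat : ∀ w ∈ W, (mat w).transpose * (Matrix.of H * mat w) = Matrix.of H := by
    intro w hw
    ext i j
    have h1 : pderiv i f = ∑ m, C (mat w m i) * subst (mat w) (pderiv m f) := by
      conv_lhs => rw [← mem_invariants.1 hf w hw, pderiv_subst]
    simp only [hH, subst_linPoly] at h1
    have h2 := congrArg (coeff (Finsupp.single j 1)) h1
    simp only [coeff_sum, coeff_C_mul, coeff_linPoly] at h2
    rw [Matrix.of_apply, h2, Matrix.mul_apply]
    refine Finset.sum_congr rfl fun m _ => ?_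
    rw [Matrix.transpose_apply]
    rfl
  have hcomm : ∀ w ∈ W, Matrix.of H * mat w = mat w * Matrix.of H := by
    intro w hw
    conv_rhs => rw [← hmat w hw, ← Matrix.mul_assoc, mat_transpose, mat_mul_inv, Matrix.one_mul]
  set T := Matrix.toEuclideanLin (Matrix.of H) with hT
  have hTs : T.IsSymmetric := by
    rw [hT, Matrix.isSymmetric_toEuclideanLin_iff]
    ext i j
    simp [hsymm i j]
  -- Schur's lemma over the reals: the Hessian commutes with `W` and is symmetric, so it has a real
  -- eigenvalue, and the stable eigenspace is everything.
  obtain ⟨c, hc⟩ : ∃ c : ℝ, Module.End.HasEigenvalue T c :=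
    ⟨_, hTs.hasEigenvalue_iSup_of_finiteDimensional⟩
  have hTw : ∀ w ∈ W, ∀ x, T (w x) = w (T x) := by
    intro w hw x
    have e : ∀ y : V ℓ, (w y).ofLp = (mat w).mulVec y.ofLp := fun y => by
      ext i; exact (mat_mulVec w y i).symm
    have e' : ∀ y : V ℓ, (T y).ofLp = (Matrix.of H).mulVec y.ofLp := fun y => rfl
    ext i
    rw [e, e', e, e', Matrix.mulVec_mulVec, Matrix.mulVec_mulVec, hcomm w hw]
  have htop : Module.End.eigenspace T c = ⊤ := by
    refine (hW.irreducible _ fun w hw u hu => ?_).resolve_left hc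
    rw [Module.End.mem_eigenspace_iff] at hu ⊢
    rw [hTw w hw, hu, map_smul]
  refine ⟨c, fun j => ?_⟩
  have h1 : T (stdVec j) = c • stdVec j :=
    Module.End.mem_eigenspace_iff.1 (htop ▸ Submodule.mem_top)
  rw [hH]
  have h2 : ∀ i, H i j = c * if i = j then 1 else 0 := by
    intro i
    have := congrArg (fun x : V ℓ => x i) h1
    simpa [hT, stdVec, Matrix.toLpLin_apply, Matrix.mulVec, dotProduct, Pi.single_apply] using this
  have h3 : H j = c • Pi.single j 1 := by
    ext i
    rw [hsymm, h2]
    simp [Pi.single_apply]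
  rw [h3, linPoly_smul]
  congr 1
  rw [linPoly, Finset.sum_eq_single j]
  · simp
  · intro b _ hb
    simp [hb]
  · simp

/-! ### The regular eigenvector -/

/-- Over a suitable extension field there is a point at which exactly one basic invariant does not
vanish. -/
theorem exists_axis_point [Finite W] (hP : IsBasicInvariants W P) (k : Fin ℓ) {n : ℕ} (hn : n ≠ 0) :
    ∃ (K : Type) (_ : Field K) (_ : Algebra ℝ K) (v : Fin ℓ → K) (ζ : K),
      IsPrimitiveRoot ζ n ∧ (∀ j, j ≠ k → aeval v (P j) = 0) ∧ aeval v (P k) ≠ 0 := by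
  classical
  have := Fintype.ofFinite W
  set I : Ideal (S ℓ) := Ideal.span (P '' {j | j ≠ k}) with hI
  -- Summing a relation `P_k^m = ∑ c_j P_j` over `W` makes the coefficients invariant, hence
  -- polynomials in the generators. Algebraic independence lifts the relation to the variables,
  -- where it fails at the `k`-th unit point.
  have hrad : P k ∉ I.radical := by
    rintro ⟨m, hm⟩
    rw [hI, Ideal.span, Submodule.mem_span_image_iff_exists_fun] at hm
    obtain ⟨t, ht, c, hc⟩ := hm
    choose Ψ hΨ using fun f : S ℓ =>
      exists_aeval_eq hP.adjoin_eq (sum_subst_mem_invariants (W := W) f)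
    have hinv : ∀ i, ∀ w : W, subst (mat w.1) (P i) = P i := fun i w =>
      mem_invariants.1 (generator_mem hP.adjoin_eq i) w.1 w.2
    have key : (C (Fintype.card W : ℝ) * X k ^ m : MvPolynomial (Fin ℓ) ℝ)
        = ∑ j : t, Ψ (c j) * X j.1 := by
      apply hP.algebraicIndependent
      simp only [map_mul, map_pow, map_sum, aeval_X, hΨ, map_natCast]
      have : ∑ w : W, subst (mat w.1) (P k ^ m) = ∑ w : W, subst (mat w.1) (∑ j : t, c j • P j) := by
        rw [hc]
      simp only [map_pow, hinv, map_sum, smul_eq_mul, map_mul, Finset.sum_const, Finset.card_univ,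
        nsmul_eq_mul] at this
      rw [this, Finset.sum_comm]
      simp only [Finset.sum_mul]
    have h2 := congrArg (eval (Pi.single k 1)) key
    simp only [map_mul, map_pow, eval_C, eval_X, map_sum] at h2
    rw [Finset.sum_eq_zero] at h2
    · simp at h2
    · intro j _
      have hj : j.1 ≠ k := ht j.2
      simp [hj]
  rw [Ideal.radical_eq_sInf, Submodule.mem_sInf] at hrad
  push Not at hrad
  -- The generic point of a prime containing the other invariants but not `P k` has the required
  -- vanishing; the algebraic closure supplies the root of unity.
  obtain ⟨J, ⟨hIJ, hJ⟩, hkJ⟩ := hrad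
  obtain ⟨K, _, _, p, hp⟩ := exists_generic_point J
  have : CharZero K := charZero_of_injective_algebraMap (algebraMap ℝ K).injective
  have : NeZero n := ⟨hn⟩
  have : NeZero (n : AlgebraicClosure K) := ⟨Nat.cast_ne_zero.2 hn⟩
  obtain ⟨ζ, hζ⟩ := HasEnoughRootsOfUnity.exists_primitiveRoot (AlgebraicClosure K) n
  have hev : ∀ f : S ℓ, aeval (fun i => algebraMap K (AlgebraicClosure K) (p i)) f
      = algebraMap K (AlgebraicClosure K) (aeval p f) := by
    intro f
    exact aeval_algebraMap_apply _ p f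
  refine ⟨AlgebraicClosure K, inferInstance, inferInstance,
    fun i => algebraMap K (AlgebraicClosure K) (p i), ζ, hζ, ?_, ?_⟩
  · intro j hj
    rw [hev, (hp _).2 (hIJ (Ideal.subset_span ⟨j, hj, rfl⟩)), map_zero]
  · rw [hev, Ne, map_eq_zero, hp]
    exact hkJ

/-- Used with `e = d_i - 2`, where summing over the powers of an eigenvalue isolates the invariants
of degree 2. -/
theorem sum_pow_mul {K : Type*} [Field K] {ζ : K} {n e : ℕ} (hζ : IsPrimitiveRoot ζ n)
    (he : e < n) : ∑ r ∈ Finset.range n, ζ ^ (r * e) = if e = 0 then (n : K) else 0 := by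
  split_ifs with h
  · simp [h]
  · have h1 : ζ ^ e ≠ 1 := hζ.pow_ne_one_of_pos_of_lt h he
    have h2 := geom_sum_mul (ζ ^ e) n
    rw [← pow_mul, mul_comm e, pow_mul, hζ.pow_eq_one, one_pow, sub_self] at h2
    have h3 := (mul_eq_zero.1 h2).resolve_right (sub_ne_zero.2 h1)
    rw [← h3]
    exact Finset.sum_congr rfl fun r _ => by rw [← pow_mul, mul_comm]

theorem matK_pow_mulVec {K : Type*} [Field K] [Algebra ℝ K] {w : V ℓ ≃ₗᵢ[ℝ] V ℓ} {v : Fin ℓ → K}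
    {c : K} (h : (matK K w).mulVec v = c • v) (r : ℕ) :
    (matK K (w ^ r)).mulVec v = c ^ r • v := by
  induction r with
  | zero => simp [matK_one]
  | succ r ih =>
    rw [pow_succ', matK_mul, ← Matrix.mulVec_mulVec, ih, Matrix.mulVec_smul, h, smul_smul, pow_succ]

/-- Differentiating `f ∘ w = f` at `v` gives a derivative at `w v = c v`, from which homogeneity
extracts a power of `c`. -/
theorem aeval_dirD_eigen {K : Type*} [Field K] [Algebra ℝ K] {w : V ℓ ≃ₗᵢ[ℝ] V ℓ}
    {v : Fin ℓ → K} {c : K} (h : (matK K w).mulVec v = c • v) {f : S ℓ}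
    (hf : subst (mat w) f = f) {n : ℕ} (hn : f.IsHomogeneous n) (a : Fin ℓ → ℝ) :
    aeval v (dirD a f) = c ^ (n - 1) * aeval v (dirD ((mat w).mulVec a) f) := by
  conv_lhs => rw [← hf, dirD_subst, aeval_subst]
  have h' : ((mat w).map (algebraMap ℝ K)).mulVec v = c • v := h
  rw [h', aeval_smul_of_isHomogeneous (isHomogeneous_dirD hn _)]

theorem aeval_dirD_dirD_eigen {K : Type*} [Field K] [Algebra ℝ K] {w : V ℓ ≃ₗᵢ[ℝ] V ℓ}
    {v : Fin ℓ → K} {c : K} (h : (matK K w).mulVec v = c • v) {f : S ℓ}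
    (hf : subst (mat w) f = f) {n : ℕ} (hn : f.IsHomogeneous n) (a : Fin ℓ → ℝ) :
    aeval v (dirD a (dirD a f)) = c ^ (n - 2) *
      aeval v (dirD ((mat w).mulVec a) (dirD ((mat w).mulVec a) f)) := by
  conv_lhs => rw [← hf, dirD_subst, dirD_subst, aeval_subst]
  have h' : ((mat w).map (algebraMap ℝ K)).mulVec v = c • v := h
  rw [h', aeval_smul_of_isHomogeneous (isHomogeneous_dirD (isHomogeneous_dirD hn _) _)]
  rfl

/-- A point on the axis of a basic invariant of the highest degree lies on no reflecting
hyperplane. -/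
theorem aeval_linPoly_ne_zero_of_axis [Finite W] (hℓ : 2 ≤ ℓ) (hW : IsRealCoxeterGroup W)
    (hP : IsBasicInvariants W P) {h : ℕ} (hmax : ∀ j, (P j).totalDegree ≤ h)
    {K : Type*} [Field K] [Algebra ℝ K] {v : Fin ℓ → K} {ζ : K} (hζ : IsPrimitiveRoot ζ h)
    {w : V ℓ ≃ₗᵢ[ℝ] V ℓ} (hw : w ∈ W) (hwv : (matK K w).mulVec v = ζ⁻¹ • v) (hv : v ≠ 0)
    {a : V ℓ} (ha : a ≠ 0) (hs : reflectionIn a ∈ W) : aeval v (linPoly a.ofLp) ≠ 0 := by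
  classical
  have := Fintype.ofFinite W
  have : CharZero K := charZero_of_injective_algebraMap (algebraMap ℝ K).injective
  intro hav
  set d := fun i => (P i).totalDegree with hd
  have hd2 : ∀ i, 2 ≤ d i := two_le_totalDegree hℓ hW hP
  have hh0 : h ≠ 0 := by
    have := (hd2 ⟨0, by omega⟩).trans (hmax ⟨0, by omega⟩)
    omega
  have hζ0 : ζ ≠ 0 := hζ.ne_zero hh0
  have hinv : ∀ i, ∀ u ∈ W, subst (mat u) (P i) = P i := fun i =>
    mem_invariants.1 (generator_mem hP.adjoin_eq i)
  have hwr : ∀ r : ℕ, (matK K (w ^ r)).mulVec v = (ζ⁻¹) ^ r • v := matK_pow_mulVec hwv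
  have grad : ∀ (r : ℕ) i (b : Fin ℓ → ℝ), aeval v (dirD ((mat (w ^ r)).mulVec b) (P i))
      = ζ ^ (r * (d i - 1)) * aeval v (dirD b (P i)) := by
    intro r i b
    rw [aeval_dirD_eigen (hwr r) (hinv i _ (pow_mem hw r)) (hP.homogeneous i) b, ← pow_mul,
      ← mul_assoc, inv_pow, mul_inv_cancel₀ (pow_ne_zero _ hζ0), one_mul]
  have hess : ∀ (r : ℕ) i (b : Fin ℓ → ℝ),
      aeval v (dirD ((mat (w ^ r)).mulVec b) (dirD ((mat (w ^ r)).mulVec b) (P i)))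
      = ζ ^ (r * (d i - 2)) * aeval v (dirD b (dirD b (P i))) := by
    intro r i b
    rw [aeval_dirD_dirD_eigen (hwr r) (hinv i _ (pow_mem hw r)) (hP.homogeneous i) b, ← pow_mul,
      ← mul_assoc, inv_pow, mul_inv_cancel₀ (pow_ne_zero _ hζ0), one_mul]
  have ha1 : ∀ i, aeval v (dirD a.ofLp (P i)) = 0 := by
    intro i
    obtain ⟨g, hg⟩ := linPoly_dvd_dirD (a := a) (hinv i _ hs)
    rw [hg, map_mul, hav, zero_mul]
  obtain ⟨φ, hφ1, hφ2⟩ := exists_jet_coeffs_sq hP.adjoin_eq v (fun i => algebraMap ℝ K (a i))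
    (by rw [← hav, aeval_linPoly])
  have hφ1' : ∀ b : Fin ℓ → ℝ, ∑ i, φ i * aeval v (dirD b (P i)) = 0 := by
    intro b
    simp only [dirD_apply, map_sum, map_mul, aeval_C, Finset.mul_sum]
    rw [Finset.sum_comm]
    refine Finset.sum_eq_zero fun j _ => ?_
    simp only [mul_left_comm (φ _), ← Finset.mul_sum, hφ1, mul_zero]
  -- Maximality of `h` enters here: `0 ≤ d i - 2 < h`, so the sum over `r` kills every degree except
  -- 2.
  have hsum : ∀ g : Fin ℓ → K, ∑ r ∈ Finset.range h, ∑ i, φ i * (ζ ^ (r * (d i - 2)) * g i)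
      = h * ∑ i, if d i = 2 then φ i * g i else 0 := by
    intro g
    rw [Finset.sum_comm, Finset.mul_sum]
    refine Finset.sum_congr rfl fun i _ => ?_
    have h1 := hmax i
    have h2 := hd2 i
    rw [← Finset.mul_sum, ← Finset.sum_mul, sum_pow_mul hζ (by simp only [hd] at *; omega)]
    by_cases h3 : d i = 2
    · rw [if_pos h3, if_pos (by omega)]
      ring
    · rw [if_neg h3, if_neg (by omega)]
      ring
  choose! lam hlam using fun (i : Fin ℓ) (hi : d i = 2) =>
    exists_pderiv_eq hW (generator_mem hP.adjoin_eq i) (hi ▸ hP.homogeneous i)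
  -- The relation among the gradients, taken along the rotated directions `w^r e_m` and summed over
  -- `r`, keeps only the degree 2 invariants. Their gradients at `v` are multiples of `v`, and `v m
  -- ≠ 0`.
  have hlin : ∑ i, (if d i = 2 then φ i * algebraMap ℝ K (lam i) else 0) = 0 := by
    obtain ⟨m, hm⟩ := Function.ne_iff.1 hv
    have h1 : ∀ r : ℕ, ∑ i, φ i * (ζ ^ (r * (d i - 2)) * aeval v (dirD (Pi.single m 1) (P i))) = 0 := by
      intro r
      have h2 := hφ1' ((mat (w ^ r)).mulVec (Pi.single m 1))
      simp only [grad] at h2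
      apply mul_left_cancel₀ (pow_ne_zero r hζ0)
      rw [mul_zero, ← h2, Finset.mul_sum]
      refine Finset.sum_congr rfl fun i _ => ?_
      have h3 : r * (d i - 1) = r + r * (d i - 2) := by
        obtain ⟨e, he⟩ := Nat.exists_eq_add_of_le (hd2 i)
        rw [he]
        simp only [Nat.add_sub_cancel_left]
        rw [show 2 + e - 1 = 1 + e by omega]
        ring
      rw [h3, pow_add]
      ring
    have h4 := hsum fun i => aeval v (dirD (Pi.single m 1) (P i))
    rw [Finset.sum_eq_zero fun r _ => h1 r] at h4
    have h5 := (mul_eq_zero.1 h4.symm).resolve_left (Nat.cast_ne_zero.2 hh0)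
    refine (mul_eq_zero.1 (?_ : _ * v m = 0)).resolve_right hm
    refine Eq.trans ?_ h5
    rw [Finset.sum_mul]
    refine Finset.sum_congr rfl fun i _ => ?_
    split_ifs with h6
    · rw [dirD_apply, Finset.sum_eq_single m]
      · rw [hlam i h6]
        simp
        ring
      · intro b _ hb
        simp [hb]
      · simp
    · rw [zero_mul]
  -- The same summation applied to the second derivatives along `w^r a` also leaves only degree 2,
  -- where the Hessians are scalar, so the previous relation makes it zero.
  have hleft : ∑ r ∈ Finset.range h, ∑ i,
      φ i * (ζ ^ (r * (d i - 2)) * aeval v (dirD a.ofLp (dirD a.ofLp (P i)))) = 0 := by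
    rw [hsum]
    refine mul_eq_zero_of_right _ ?_
    have hz := congrArg (· * algebraMap ℝ K (a.ofLp ⬝ᵥ a.ofLp)) hlin
    simp only [zero_mul, Finset.sum_mul] at hz
    refine Eq.trans ?_ hz
    refine Finset.sum_congr rfl fun i _ => ?_
    split_ifs with h6
    · have : dirD a.ofLp (P i) = C (lam i) * linPoly a.ofLp := by
        rw [dirD_apply, linPoly, Finset.mul_sum]
        refine Finset.sum_congr rfl fun j _ => ?_
        rw [hlam i h6]
        ring
      rw [this, Derivation.leibniz, dirD_linPoly]
      have h0 : dirD a.ofLp (C (lam i)) = 0 := derivation_C _ _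
      rw [h0, smul_zero, add_zero, smul_eq_mul, map_mul, aeval_C, aeval_C]
      ring
    · rw [zero_mul]
  -- By the choice of `φ` each summand is twice a sum of real squares. The term with `r = 0` and
  -- trivial stabilizer element is the square of `a · a`, which contradicts the vanishing of the
  -- total.
  have hright : ∀ r : ℕ, ∑ i,
      φ i * (ζ ^ (r * (d i - 2)) * aeval v (dirD a.ofLp (dirD a.ofLp (P i))))
      = algebraMap ℝ K (2 * ∑ u ∈ stab W v,
        (a.ofLp ⬝ᵥ (mat u.1).mulVec ((mat (w ^ r)).mulVec a.ofLp)) ^ 2) := by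
    intro r
    have h1 := hφ2 ((mat (w ^ r)).mulVec a.ofLp) fun i => by rw [grad, ha1, mul_zero]
    simp only [hess] at h1
    rw [h1]
    simp [dotProduct, Matrix.mulVec, matK]
    exact Or.inl (map_ofNat _ 2).symm
  simp only [hright, ← map_sum, map_eq_zero] at hleft
  have h2 := (Finset.sum_eq_zero_iff_of_nonneg fun r _ => mul_nonneg zero_le_two
    (Finset.sum_nonneg fun u _ => sq_nonneg _)).1 hleft 0
    (Finset.mem_range.2 (Nat.pos_of_ne_zero hh0))
  have h3 := (mul_eq_zero.1 h2).resolve_left two_ne_zero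
  have h4 := (Finset.sum_eq_zero_iff_of_nonneg fun u _ => sq_nonneg _).1 h3 1 (one_mem_stab v)
  rw [pow_zero, Subgroup.coe_one, mat_one, Matrix.one_mulVec, Matrix.one_mulVec] at h4
  exact ofLp_ne_zero ha (dotProduct_self_eq_zero.1 ((pow_eq_zero_iff two_ne_zero).1 h4))

/-- The regular eigenvector attached to a basic invariant of the highest degree. -/
theorem exists_regular_eigenvector [Finite W] (hℓ : 2 ≤ ℓ) (hW : IsRealCoxeterGroup W)
    (hP : IsBasicInvariants W P) {k : Fin ℓ}
    (hmax : ∀ j, (P j).totalDegree ≤ (P k).totalDegree)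
    {α : Submodule ℝ (V ℓ) → Module.Dual ℝ (V ℓ)}
    (hα : ∀ H ∈ reflectingHyperplanes W, LinearMap.ker (α H) = H) :
    ∃ (K : Type) (_ : Field K) (_ : Algebra ℝ K) (v : Fin ℓ → K) (ζ : K) (w : V ℓ ≃ₗᵢ[ℝ] V ℓ),
      IsPrimitiveRoot ζ (P k).totalDegree ∧ w ∈ W ∧ (matK K w).mulVec v = ζ • v ∧
      (∀ j, j ≠ k → aeval v (P j) = 0) ∧ aeval v (P k) ≠ 0 ∧
      aeval v (definingPolynomial W α) ≠ 0 := by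
  have := Fintype.ofFinite W
  have hk : (P k).totalDegree ≠ 0 := by
    have := two_le_totalDegree hℓ hW hP k
    omega
  obtain ⟨K, _, _, v, ζ, hζ, h0, hv⟩ := exists_axis_point hP k hk
  -- The points `v` and `ζ⁻¹ v` have the same invariants: only `P k` is nonzero there, and its
  -- degree is the order of `ζ`.
  obtain ⟨w, hw⟩ := exists_mulVec_eq hP.adjoin_eq (p := v) (q := ζ⁻¹ • v) fun i => by
    rw [aeval_smul_of_isHomogeneous (hP.homogeneous i)]
    by_cases hi : i = k
    · rw [hi, inv_pow, hζ.pow_eq_one, inv_one, one_mul]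
    · rw [h0 i hi, mul_zero]
  have hv0 : v ≠ 0 := by
    rintro rfl
    apply hv
    have := aeval_smul_of_isHomogeneous (hP.homogeneous k) (0 : K) 0
    rwa [zero_smul, zero_pow hk, zero_mul] at this
  refine ⟨K, inferInstance, inferInstance, v, ζ⁻¹, w, hζ.inv, w.2, hw, h0, hv, ?_⟩
  rw [definingPolynomial_eq, map_prod]
  refine Finset.prod_ne_zero_iff.2 fun H hH => ?_
  rw [Set.Finite.mem_toFinset] at hH
  exact aeval_linPoly_ne_zero_of_axis hℓ hW hP hmax hζ w.2 hw hv0 (normal_ne_zero hα hH)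
    (reflectionIn_normal_mem hα hH)

end

end CoxeterForms

namespace CoxeterForms

noncomputable section

open MvPolynomial

variable {ℓ : ℕ}

/-! ### Scaling and gradients -/

theorem coeff_subst_smul_one (c : ℝ) (f : S ℓ) (m : Fin ℓ →₀ ℕ) :
    coeff m (subst (c • (1 : Matrix (Fin ℓ) (Fin ℓ) ℝ)) f) = c ^ m.degree * coeff m f := by
  classical
  have hX : ∀ i, subst (c • (1 : Matrix (Fin ℓ) (Fin ℓ) ℝ)) (X i) = C c * X i := by
    intro i
    rw [subst_X, Finset.sum_eq_single i]
    · simp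
    · intro j _ hj
      simp [Ne.symm hj]
    · simp
  induction f using MvPolynomial.induction_on' with
  | add p q hp hq => simp only [map_add, coeff_add, hp, hq, mul_add]
  | monomial n r =>
    have : subst (c • (1 : Matrix (Fin ℓ) (Fin ℓ) ℝ)) (monomial n r)
        = monomial n (c ^ n.degree * r) := by
      rw [monomial_eq, map_mul, subst_C, Finsupp.prod, map_prod, monomial_eq, Finsupp.prod]
      simp only [map_pow, hX, mul_pow, Finset.prod_mul_distrib]
      rw [Finset.prod_pow_eq_pow_sum, C_mul, C_pow, Finsupp.degree_apply]
      ring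
    rw [this, coeff_monomial, coeff_monomial]
    split_ifs with h
    · rw [h]
    · rw [mul_zero]

theorem subst_smul_one_of_isHomogeneous {f : S ℓ} {n : ℕ} (hf : f.IsHomogeneous n) (c : ℝ) :
    subst (c • (1 : Matrix (Fin ℓ) (Fin ℓ) ℝ)) f = C (c ^ n) * f := by
  ext m
  rw [coeff_subst_smul_one, coeff_C_mul]
  by_cases h : m.degree = n
  · rw [h]
  · rw [hf.coeff_eq_zero h, mul_zero, mul_zero]

theorem eq_C_of_subst_two {f : S ℓ} (h : subst ((2 : ℝ) • (1 : Matrix (Fin ℓ) (Fin ℓ) ℝ)) f = f) :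
    f = C (coeff 0 f) := by
  classical
  ext m
  rw [coeff_C]
  split_ifs with hm
  · rw [hm]
  · have h1 := congrArg (coeff m) h
    rw [coeff_subst_smul_one] at h1
    have h2 : (2 : ℝ) ^ m.degree ≠ 1 := by
      refine (one_lt_pow₀ one_lt_two ?_).ne'
      rw [Ne, Finsupp.degree_eq_zero_iff]
      exact Ne.symm hm
    have h3 : ((2 : ℝ) ^ m.degree - 1) * coeff m f = 0 := by linarith
    exact (mul_eq_zero.1 h3).resolve_left (sub_ne_zero.2 h2)

/-- The scalar product of the gradients of two polynomials. -/
def gradDot (f g : S ℓ) : S ℓ := ∑ m, pderiv m f * pderiv m g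

theorem subst_gradDot {A : Matrix (Fin ℓ) (Fin ℓ) ℝ} (hA : A * A.transpose = 1) (f g : S ℓ) :
    subst A (gradDot f g) = gradDot (subst A f) (subst A g) := by
  simp only [gradDot, pderiv_subst, map_sum, map_mul, Finset.sum_mul_sum]
  rw [Finset.sum_comm]
  refine Finset.sum_congr rfl fun i _ => ?_
  rw [Finset.sum_comm]
  have h : ∀ j, ∑ m, C (A i m) * subst A (pderiv i f) * (C (A j m) * subst A (pderiv j g))
      = C ((A * A.transpose) i j) * (subst A (pderiv i f) * subst A (pderiv j g)) := by
    intro j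
    rw [Matrix.mul_apply, map_sum, Finset.sum_mul]
    refine Finset.sum_congr rfl fun m _ => ?_
    rw [Matrix.transpose_apply, C_mul]
    ring
  simp only [h, hA, Matrix.one_apply, apply_ite C, C_1, C_0, ite_mul, one_mul, zero_mul,
    Finset.sum_ite_eq, Finset.mem_univ, if_true]

theorem isHomogeneous_gradDot {f g : S ℓ} {m n : ℕ} (hf : f.IsHomogeneous m)
    (hg : g.IsHomogeneous n) : (gradDot f g).IsHomogeneous ((m - 1) + (n - 1)) :=
  IsHomogeneous.sum _ _ _ fun _ _ => hf.pderiv.mul hg.pderiv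

theorem gradDot_of_pderiv_eq {f g : S ℓ} {n : ℕ} (hf : f.IsHomogeneous n) {c : ℝ}
    (hg : ∀ j, pderiv j g = C c * X j) : gradDot f g = C c * (n • f) := by
  rw [← hf.sum_X_mul_pderiv, gradDot, Finset.mul_sum]
  refine Finset.sum_congr rfl fun i _ => ?_
  rw [hg]
  ring

theorem mat_mul_transpose (w : V ℓ ≃ₗᵢ[ℝ] V ℓ) : mat w * (mat w).transpose = 1 := by
  rw [mat_transpose, mat_mul_inv]

theorem mat_transpose_mul (w : V ℓ ≃ₗᵢ[ℝ] V ℓ) : (mat w).transpose * mat w = 1 := by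
  rw [mat_transpose, mat_inv_mul]

/-- The Jacobian matrix of a vector field. -/
def fieldJac (y : Fin ℓ → S ℓ) : Matrix (Fin ℓ) (Fin ℓ) (S ℓ) := Matrix.of fun a m => pderiv m (y a)

/-- The pairing matrix of the gradients of basic invariants with the differentials of the
components of a vector field. -/
def pairing (P : Fin ℓ → S ℓ) (y : Fin ℓ → S ℓ) : Matrix (Fin ℓ) (Fin ℓ) (S ℓ) :=
  jac P * fieldJac y * (jac P).transpose

theorem jac_eq_zero_of_mulVec {P : Fin ℓ → S ℓ} (hJ : (jac P).det ≠ 0) {z y : Fin ℓ → S ℓ}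
    (h : (jac P).mulVec z = (jac P).mulVec y) : z = y := by
  rw [← sub_eq_zero, ← Matrix.mulVec_sub] at h
  by_contra hne
  exact hJ (Matrix.exists_mulVec_eq_zero_iff.1 ⟨z - y, sub_ne_zero.2 hne, h⟩)

/-- The transformation law of the pairing matrix under similarities. -/
theorem subst_pairing {P : Fin ℓ → S ℓ} {y : Fin ℓ → S ℓ} {Q : S ℓ} {k : Fin ℓ} {d : Fin ℓ → ℕ}
    (hJ : (jac P).det ≠ 0) (hy : (jac P).mulVec y = Pi.single k Q)
    {A : Matrix (Fin ℓ) (Fin ℓ) ℝ} {τ χ : ℝ} (hτ : τ ≠ 0)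
    (hA1 : A * A.transpose = τ ^ 2 • (1 : Matrix (Fin ℓ) (Fin ℓ) ℝ))
    (hA2 : A.transpose * A = τ ^ 2 • (1 : Matrix (Fin ℓ) (Fin ℓ) ℝ))
    (hAP : ∀ i, subst A (P i) = C (τ ^ d i) * P i) (hQ : subst A Q = C χ * Q) (j i : Fin ℓ) :
    C (τ ^ (d k + 2)) * subst A (pairing P y j i) = C (χ * τ ^ (d j + d i)) * pairing P y j i := by
  set J := jac P with hJdef
  set σJ := J.map (subst A)
  set B : Matrix (Fin ℓ) (Fin ℓ) (S ℓ) := A.map C with hB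
  set D : Matrix (Fin ℓ) (Fin ℓ) (S ℓ) := Matrix.diagonal fun i => C (τ ^ d i)
  have hB1 : B * B.transpose = (C (τ ^ 2) : S ℓ) • (1 : Matrix (Fin ℓ) (Fin ℓ) (S ℓ)) := by
    rw [hB, ← Matrix.transpose_map, ← Matrix.map_mul, hA1]
    ext1 a b
    by_cases hab : a = b <;> simp [hab]
  have hB2 : B.transpose * B = (C (τ ^ 2) : S ℓ) • (1 : Matrix (Fin ℓ) (Fin ℓ) (S ℓ)) := by
    rw [hB, ← Matrix.transpose_map, ← Matrix.map_mul, hA2]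
    ext1 a b
    by_cases hab : a = b <;> simp [hab]
  have h1 : σJ * B = D * J := by
    ext1 a b
    rw [Matrix.diagonal_mul, Matrix.mul_apply]
    simp only [σJ, hJdef, jac, Matrix.map_apply, Matrix.of_apply, hB]
    rw [← pderiv_C_mul, ← hAP, pderiv_subst]
    exact Finset.sum_congr rfl fun m _ => mul_comm _ _
  have h2 : σJ.mulVec (fun a => subst A (y a)) = Pi.single k (C χ * Q) := by
    ext1 a
    have h := congrArg (subst A) (congrFun hy a)
    simp only [Matrix.mulVec, dotProduct, map_sum, map_mul] at h
    simp only [Matrix.mulVec, dotProduct, σJ, Matrix.map_apply]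
    rw [h]
    by_cases hak : a = k
    · subst hak; simp [hQ]
    · simp [hak]
  have hτC : ∀ n : ℕ, (C (τ ^ n) : S ℓ) ≠ 0 := fun n => by
    rw [Ne, C_eq_zero]
    exact pow_ne_zero n hτ
  -- The system `J y = Q e_k` determines `y`, so its transformation law follows from those of `J`
  -- and `Q`.
  have h3 : ∀ a, C (τ ^ d k) * subst A (y a) = C χ * B.mulVec y a := by
    set z := B.transpose.mulVec fun a => subst A (y a) with hz
    have hz1 : (D * J).mulVec z = (C (τ ^ 2) : S ℓ) • Pi.single k (C χ * Q) := by
      rw [← h1, hz, ← Matrix.mulVec_mulVec, Matrix.mulVec_mulVec _ B, hB1, Matrix.smul_mulVec,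
        Matrix.one_mulVec, Matrix.mulVec_smul, h2]
    have hz2 : J.mulVec ((C (τ ^ d k) : S ℓ) • z) = J.mulVec ((C (τ ^ 2 * χ) : S ℓ) • y) := by
      rw [Matrix.mulVec_smul, Matrix.mulVec_smul, hy]
      ext1 a
      have h := congrFun hz1 a
      rw [← Matrix.mulVec_mulVec, Matrix.mulVec_diagonal] at h
      by_cases hak : a = k
      · subst hak
        simp only [Pi.smul_apply, Pi.single_eq_same, smul_eq_mul, C_mul] at h ⊢
        rw [h]
        ring
      · simp only [Pi.smul_apply, Pi.single_eq_of_ne hak, smul_eq_mul, mul_zero] at h ⊢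
        rw [(mul_eq_zero.1 h).resolve_left (hτC _), mul_zero]
    have hz3 := jac_eq_zero_of_mulVec hJ hz2
    intro a
    have hz4 := congrFun (congrArg B.mulVec hz3) a
    rw [Matrix.mulVec_smul, Matrix.mulVec_smul, hz, Matrix.mulVec_mulVec, hB1, Matrix.smul_mulVec,
      Matrix.one_mulVec] at hz4
    simp only [Pi.smul_apply, smul_eq_mul] at hz4
    apply mul_left_cancel₀ (hτC 2)
    rw [C_mul] at hz4
    linear_combination hz4
  set σY := (fieldJac y).map (subst A) with hσY
  have h4 : (C (τ ^ d k) : S ℓ) • (σY * B) = (C χ : S ℓ) • (B * fieldJac y) := by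
    ext1 a m
    have h := congrArg (pderiv m) (h3 a)
    rw [pderiv_C_mul, pderiv_C_mul, pderiv_subst] at h
    simp only [Matrix.smul_apply, smul_eq_mul, Matrix.mul_apply]
    have e1 : ∑ n, σY a n * B n m = ∑ n, C (A n m) * subst A (pderiv n (y a)) :=
      Finset.sum_congr rfl fun n _ => mul_comm _ _
    have e2 : ∑ n, B a n * fieldJac y n m = pderiv m (B.mulVec y a) := by
      simp only [Matrix.mulVec, dotProduct, map_sum, hB, Matrix.map_apply, pderiv_C_mul]
      rfl
    rw [e1, e2, h]
  -- Multiplying by `Bᵀ` replaces inverting `B`; the resulting powers of `τ ^ 2` are cancelled at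
  -- the end.
  have h5 : (C (τ ^ 2) : S ℓ) • σJ = D * J * B.transpose := by
    rw [← h1, Matrix.mul_assoc, hB1, Matrix.mul_smul, Matrix.mul_one]
  have h6 : (C (τ ^ (d k + 2)) : S ℓ) • σY = (C χ : S ℓ) • (B * fieldJac y * B.transpose) := by
    have := congrArg (· * B.transpose) h4
    simp only [Matrix.smul_mul, Matrix.mul_assoc, hB1, Matrix.mul_smul, Matrix.mul_one,
      smul_smul] at this
    rw [pow_add, C_mul, this, Matrix.mul_assoc]
  have hE : (pairing P y).map (subst A) = σJ * σY * σJ.transpose := by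
    simp only [pairing, σJ, hσY]
    rw [Matrix.map_mul, Matrix.map_mul]
    rfl
  have h7 : (C (τ ^ 2) : S ℓ) • (C (τ ^ 2) : S ℓ) • (C (τ ^ (d k + 2)) : S ℓ) • (pairing P y).map (subst A)
      = (C (τ ^ 2) : S ℓ) • (C (τ ^ 2) : S ℓ) • (C χ : S ℓ) • (D * pairing P y * D) := by
    have e : (C (τ ^ 2) : S ℓ) • (C (τ ^ 2) : S ℓ) • (C (τ ^ (d k + 2)) : S ℓ) • (pairing P y).map (subst A)
        = ((C (τ ^ 2) : S ℓ) • σJ) * ((C (τ ^ (d k + 2)) : S ℓ) • σY) * ((C (τ ^ 2) : S ℓ) • σJ).transpose := by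
      rw [hE, Matrix.transpose_smul]
      simp only [Matrix.smul_mul, Matrix.mul_smul, smul_smul]
      congr 1
      ring
    have hDt : D.transpose = D := Matrix.diagonal_transpose _
    rw [e, h5, h6, Matrix.transpose_mul, Matrix.transpose_mul, Matrix.transpose_transpose, hDt]
    have e2 : D * J * B.transpose * ((C χ : S ℓ) • (B * fieldJac y * B.transpose)) * (B * (J.transpose * D))
        = (C χ : S ℓ) • (D * J * (B.transpose * B) * fieldJac y * (B.transpose * B) * J.transpose * D) := by
      simp only [Matrix.smul_mul, Matrix.mul_smul, Matrix.mul_assoc]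
    rw [e2, hB2]
    simp only [Matrix.smul_mul, Matrix.mul_smul, Matrix.mul_one, smul_smul, pairing,
      Matrix.mul_assoc]
    congr 1
    ring
  have h8 := congrFun (congrFun h7 j) i
  simp only [Matrix.smul_apply, smul_eq_mul, Matrix.map_apply, D, Matrix.diagonal_mul,
    Matrix.mul_diagonal] at h8
  have h9 := mul_left_cancel₀ (hτC 2) (mul_left_cancel₀ (hτC 2) h8)
  rw [h9, pow_add, C_mul, C_mul]
  ring

end

end CoxeterForms

namespace CoxeterForms

noncomputable section

open MvPolynomial

variable {ℓ : ℕ}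

/-! ### The pairing matrix at a regular eigenvector -/

theorem pairing_apply (P y : Fin ℓ → S ℓ) (j i : Fin ℓ) :
    pairing P y j i
      = ∑ m, (∑ a, pderiv a (P j) * pderiv m (y a)) * pderiv m (P i) := by
  simp only [pairing, Matrix.mul_apply, Matrix.transpose_apply]
  rfl

theorem jac_mulVec (P y : Fin ℓ → S ℓ) (i : Fin ℓ) :
    (jac P).mulVec y i = ∑ a, pderiv a (P i) * y a := rfl

theorem sum_mul_aeval_pderiv {K : Type*} [Field K] [Algebra ℝ K] {f : S ℓ} {n : ℕ}
    (hf : f.IsHomogeneous n) (v : Fin ℓ → K) :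
    ∑ a, aeval v (pderiv a f) * v a = n * aeval v f := by
  have h := congrArg (aeval v) hf.sum_X_mul_pderiv
  simp only [map_sum, map_mul, aeval_X, nsmul_eq_mul, map_natCast] at h
  rw [← h]
  exact Finset.sum_congr rfl fun a _ => mul_comm _ _

/-- Evaluating `f` at `w v = ζ v` in two ways: a nonzero value at the eigenvector fixes the degree
of `f` modulo the order of `ζ`. -/
theorem aeval_eigen {K : Type*} [Field K] [Algebra ℝ K] {w : V ℓ ≃ₗᵢ[ℝ] V ℓ}
    {v : Fin ℓ → K} {ζ : K} (h : (matK K w).mulVec v = ζ • v) {f : S ℓ} {χ : ℝ}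
    (hf : subst (mat w) f = C χ * f) {n : ℕ} (hn : f.IsHomogeneous n) :
    algebraMap ℝ K χ * aeval v f = ζ ^ n * aeval v f := by
  have h1 := congrArg (aeval v) hf
  rw [aeval_subst, map_mul, aeval_C] at h1
  have h' : ((mat w).map (algebraMap ℝ K)).mulVec v = ζ • v := h
  rw [h', aeval_smul_of_isHomogeneous hn] at h1
  exact h1.symm

variable {W : Subgroup (V ℓ ≃ₗᵢ[ℝ] V ℓ)} {P : Fin ℓ → S ℓ}

/-- The scalar product of two gradients of invariants is invariant under the orthogonal group `W`
and homogeneous of degree `(d_i - 1) + (d_j - 1)`. -/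
theorem aeval_gradDot_eq_zero (hP : IsBasicInvariants W P) {h : ℕ}
    {K : Type*} [Field K] [Algebra ℝ K] {v : Fin ℓ → K} {ζ : K} (hζ : IsPrimitiveRoot ζ h)
    {w : V ℓ ≃ₗᵢ[ℝ] V ℓ} (hw : w ∈ W) (hwv : (matK K w).mulVec v = ζ • v) {i j : Fin ℓ}
    (hij : ¬ h ∣ ((P i).totalDegree - 1) + ((P j).totalDegree - 1)) :
    aeval v (gradDot (P i) (P j)) = 0 := by
  have hinv : ∀ i, subst (mat w) (P i) = P i := fun i =>
    mem_invariants.1 (generator_mem hP.adjoin_eq i) w hw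
  have h1 := aeval_eigen hwv (f := gradDot (P i) (P j)) (χ := 1)
    (by rw [subst_gradDot (mat_mul_transpose w), hinv, hinv, C_1, one_mul])
    (isHomogeneous_gradDot (hP.homogeneous i) (hP.homogeneous j))
  rw [map_one] at h1
  by_contra hne
  exact hij ((hζ.pow_eq_one_iff_dvd _).1 (mul_right_cancel₀ hne h1).symm)

/-- The sum of the degrees is determined by the regular eigenvector. -/
theorem two_mul_sum_totalDegree (hP : IsBasicInvariants W P)
    (hd2 : ∀ i, 2 ≤ (P i).totalDegree) {h : ℕ} (hmax : ∀ j, (P j).totalDegree ≤ h)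
    {K : Type*} [Field K] [Algebra ℝ K] {v : Fin ℓ → K} {ζ : K} (hζ : IsPrimitiveRoot ζ h)
    {w : V ℓ ≃ₗᵢ[ℝ] V ℓ} (hw : w ∈ W) (hwv : (matK K w).mulVec v = ζ • v)
    (hJ : aeval v (jac P).det ≠ 0) : 2 * ∑ i, (P i).totalDegree = ℓ * (h + 2) := by
  set G : Matrix (Fin ℓ) (Fin ℓ) (S ℓ) := jac P * (jac P).transpose with hG
  have hGd : aeval v G.det ≠ 0 := by
    rw [hG, Matrix.det_mul, Matrix.det_transpose, map_mul]
    exact mul_ne_zero hJ hJ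
  rw [Matrix.det_apply, map_sum] at hGd
  obtain ⟨σ, -, hσ⟩ := Finset.exists_ne_zero_of_sum_ne_zero hGd
  have hσ' : aeval v (∏ i, G (σ i) i) ≠ 0 := by
    intro h0
    rw [Units.smul_def, map_zsmul, h0, smul_zero] at hσ
    exact hσ rfl
  rw [map_prod, Finset.prod_ne_zero_iff] at hσ'
  -- A nonzero entry of the Gram matrix has `h` dividing `d_σ(i) + d_i - 2`. This number lies
  -- between 2 and `2 h - 2`, so it equals `h`.
  have key : ∀ i, (P (σ i)).totalDegree + (P i).totalDegree = h + 2 := by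
    intro i
    have h1 := hσ' i (Finset.mem_univ i)
    have h2 : G (σ i) i = gradDot (P (σ i)) (P i) := rfl
    rw [h2] at h1
    have h3 : h ∣ ((P (σ i)).totalDegree - 1) + ((P i).totalDegree - 1) := by
      by_contra hn
      exact h1 (aeval_gradDot_eq_zero hP hζ hw hwv hn)
    obtain ⟨c, hc⟩ := h3
    have := hmax i
    have := hmax (σ i)
    have := hd2 i
    have := hd2 (σ i)
    have hc1 : c = 1 := by
      rcases Nat.lt_or_ge c 2 with h4 | h4
      · interval_cases c
        · omega
        · rfl
      · have : h * 2 ≤ h * c := Nat.mul_le_mul_left h h4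
        omega
    rw [hc1] at hc
    omega
  have h5 : ∑ i, ((P (σ i)).totalDegree + (P i).totalDegree) = ℓ * (h + 2) := by
    simp [key]
  rw [Finset.sum_add_distrib, Equiv.sum_comp σ fun i => (P i).totalDegree] at h5
  omega

/-- The value of the pairing matrix at the regular eigenvector. -/
theorem aeval_pairing (hW : IsRealCoxeterGroup W) (hP : IsBasicInvariants W P)
    (hd2 : ∀ i, 2 ≤ (P i).totalDegree) {k : Fin ℓ}
    (hmax : ∀ j, (P j).totalDegree ≤ (P k).totalDegree) {Q : S ℓ} {N : ℕ} (hN : 2 ≤ N)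
    (hQ : Q.IsHomogeneous N)
    {y : Fin ℓ → S ℓ} (hy : (jac P).mulVec y = Pi.single k Q)
    {K : Type*} [Field K] [Algebra ℝ K] {v : Fin ℓ → K} {ζ : K}
    (hζ : IsPrimitiveRoot ζ (P k).totalDegree)
    {w : V ℓ ≃ₗᵢ[ℝ] V ℓ} (hw : w ∈ W) (hQw : ∃ χ : ℝ, subst (mat w) Q = C χ * Q)
    (hwv : (matK K w).mulVec v = ζ • v)
    (hJ : aeval v (jac P).det ≠ 0) (h0 : ∀ j, j ≠ k → aeval v (P j) = 0)
    (hk : aeval v (P k) ≠ 0) (hQv : aeval v Q ≠ 0) (j i : Fin ℓ) :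
    aeval v (pairing P y j i)
      = aeval v Q / ((P k).totalDegree * aeval v (P k))
        * ((if j = k then (N : K) else 0) - ((P j).totalDegree - 1))
        * aeval v (gradDot (P j) (P i)) := by
  have : CharZero K := charZero_of_injective_algebraMap (algebraMap ℝ K).injective
  set h := (P k).totalDegree with hh
  have hh0 : (h : K) ≠ 0 := by
    have := hd2 k
    exact Nat.cast_ne_zero.2 (by omega)
  set κ := aeval v Q / (h * aeval v (P k)) with hκ
  -- By Euler's identity `J(v) v` is the vector of the `d_i P_i(v)`, of which only the `k`-th is
  -- nonzero. So `κ v` solves the system that defines `y` at `v`.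
  have hyv : ∀ a, aeval v (y a) = κ * v a := by
    have h1 : ((jac P).map (aeval v)).mulVec (fun a => aeval v (y a))
        = ((jac P).map (aeval v)).mulVec (fun a => κ * v a) := by
      ext i
      have h2 := congrArg (aeval v) (congrFun hy i)
      rw [jac_mulVec, map_sum] at h2
      simp only [map_mul] at h2
      have h3 := sum_mul_aeval_pderiv (hP.homogeneous i) v
      have h4 : ((jac P).map (aeval v)).mulVec (fun a => κ * v a) i
          = κ * ∑ a, aeval v (pderiv a (P i)) * v a := by
        rw [Finset.mul_sum]
        simp only [Matrix.mulVec, dotProduct, jac, Matrix.map_apply, Matrix.of_apply]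
        exact Finset.sum_congr rfl fun a _ => by ring
      rw [h4, h3]
      refine h2.trans ?_
      by_cases hik : i = k
      · subst hik
        rw [Pi.single_eq_same, hκ]
        field_simp
        rw [hh]
      · rw [Pi.single_eq_of_ne hik, h0 i hik, map_zero, mul_zero, mul_zero]
    have hdet : ((jac P).map (aeval v)).det ≠ 0 := by
      rw [AlgHom.map_det] at hJ
      exact hJ
    intro a
    have h5 := Matrix.mulVec_injective_iff_isUnit.2
      ((Matrix.isUnit_iff_isUnit_det _).2 (isUnit_iff_ne_zero.2 hdet)) h1
    exact congrFun h5 a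
  -- The derivative of `J y = Q e_k`; the term with second derivatives of `P j` is evaluated by
  -- `y(v) = κ v` and Euler's identity.
  have hder : ∀ m, ∑ a, aeval v (pderiv a (P j)) * aeval v (pderiv m (y a))
      = (if j = k then aeval v (pderiv m Q) else 0)
        - κ * ((P j).totalDegree - 1) * aeval v (pderiv m (P j)) := by
    intro m
    have h1 := congrArg (fun f => aeval v (pderiv m f)) (congrFun hy j)
    simp only [jac_mulVec, map_sum, pderiv_mul, map_add, map_mul, Finset.sum_add_distrib] at h1
    have h2 : ∑ a, aeval v (pderiv m (pderiv a (P j))) * aeval v (y a)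
        = κ * ((P j).totalDegree - 1) * aeval v (pderiv m (P j)) := by
      have h3 := sum_mul_aeval_pderiv ((hP.homogeneous j).pderiv (i := m)) v
      rw [Nat.cast_sub (by have := hd2 j; omega), Nat.cast_one] at h3
      rw [mul_assoc, ← h3, Finset.mul_sum]
      refine Finset.sum_congr rfl fun a _ => ?_
      rw [hyv, pderiv_comm]
      ring
    rw [h2] at h1
    have h4 : aeval v (pderiv m ((Pi.single k Q : Fin ℓ → S ℓ) j))
        = if j = k then aeval v (pderiv m Q) else 0 := by
      split_ifs with hjk
      · rw [hjk, Pi.single_eq_same]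
      · rw [Pi.single_eq_of_ne hjk, map_zero, map_zero]
    rw [h4] at h1
    linear_combination h1
  have hG : ∀ f g : S ℓ, aeval v (gradDot f g)
      = ∑ m, aeval v (pderiv m f) * aeval v (pderiv m g) := by
    intro f g
    simp [gradDot]
  have hpair : aeval v (pairing P y j i) = (if j = k then aeval v (gradDot Q (P i)) else 0)
      - κ * ((P j).totalDegree - 1) * aeval v (gradDot (P j) (P i)) := by
    rw [pairing_apply, map_sum]
    simp only [map_mul, map_sum, hder, hG, sub_mul, Finset.sum_sub_distrib, ite_mul, zero_mul]
    congr 1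
    · split_ifs <;> simp
    · rw [Finset.mul_sum]
      exact Finset.sum_congr rfl fun m _ => by ring
  rw [hpair]
  split_ifs with hjk
  · rw [hjk]
    -- For degree 2 this is Euler's identity. Otherwise both sides vanish by the eigenvalue
    -- argument, since `0 < d_i - 2 < h`.
    have hT : aeval v (gradDot Q (P i)) = κ * N * aeval v (gradDot (P k) (P i)) := by
      by_cases hi : (P i).totalDegree = 2
      · obtain ⟨c, hc⟩ := exists_pderiv_eq hW (generator_mem hP.adjoin_eq i) (hi ▸ hP.homogeneous i)
        rw [gradDot_of_pderiv_eq hQ hc, gradDot_of_pderiv_eq (hP.homogeneous k) hc, hκ]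
        simp only [nsmul_eq_mul, map_mul, map_natCast, ← hh]
        field_simp
      · have hdi := hd2 i
        have hmi := hmax i
        have h1 : aeval v (gradDot (P k) (P i)) = 0 := by
          refine aeval_gradDot_eq_zero hP hζ hw hwv fun hdvd => ?_
          have h2 : (P k).totalDegree - 1 + ((P i).totalDegree - 1)
              = h + ((P i).totalDegree - 2) := by omega
          rw [h2, Nat.dvd_add_right (dvd_refl h)] at hdvd
          have := Nat.le_of_dvd (by omega) hdvd
          omega
        rw [h1, mul_zero]
        obtain ⟨χ, hχ⟩ := hQw
        have hχζ : algebraMap ℝ K χ = ζ ^ N :=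
          mul_right_cancel₀ hQv (aeval_eigen hwv hχ hQ)
        have h3 := aeval_eigen hwv (f := gradDot Q (P i)) (χ := χ) (by
          rw [subst_gradDot (mat_mul_transpose w), hχ,
            mem_invariants.1 (generator_mem hP.adjoin_eq i) w hw]
          simp only [gradDot, pderiv_C_mul, Finset.mul_sum, mul_assoc])
          (isHomogeneous_gradDot hQ (hP.homogeneous i))
        by_contra hne
        have h4 := mul_right_cancel₀ hne h3
        rw [hχζ, show N - 1 + ((P i).totalDegree - 1) = N + ((P i).totalDegree - 2) by omega,
          pow_add] at h4
        have hζ0 : ζ ^ N ≠ 0 := pow_ne_zero _ (hζ.ne_zero (Nat.cast_ne_zero.1 hh0))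
        have h5 : ζ ^ ((P i).totalDegree - 2) = 1 := by
          apply mul_left_cancel₀ hζ0
          rw [← h4, mul_one]
        have h6 := (hζ.pow_eq_one_iff_dvd _).1 h5
        have := Nat.le_of_dvd (by omega) h6
        omega
    rw [hT]
    ring
  · ring

/-- The pairing matrix of the basic invariants with the primitive vector field is the defining
polynomial times an invertible matrix of invariants. -/
theorem exists_pairing_matrix [Finite W] (hℓ : 2 ≤ ℓ) (hW : IsRealCoxeterGroup W)
    (hP : IsBasicInvariants W P) {k : Fin ℓ}
    (hmax : ∀ j, (P j).totalDegree ≤ (P k).totalDegree)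
    {α : Submodule ℝ (V ℓ) → Module.Dual ℝ (V ℓ)}
    (hα : ∀ H ∈ reflectingHyperplanes W, LinearMap.ker (α H) = H) :
    ∃ (y : Fin ℓ → S ℓ) (M : Matrix (Fin ℓ) (Fin ℓ) (S ℓ)),
      (jac P).mulVec y = Pi.single k (definingPolynomial W α) ∧
      (∀ j i, M j i ∈ invariants W) ∧ (∃ c : ℝ, c ≠ 0 ∧ M.det = C c) ∧
      pairing P y = definingPolynomial W α • M := by
  classical
  have := Fintype.ofFinite W
  set Q := definingPolynomial W α with hQdef
  have hQ0 : Q ≠ 0 := definingPolynomial_ne_zero hα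
  obtain ⟨c, hc, hdet⟩ := exists_det_jac_eq hP.adjoin_eq hα
  rw [← hQdef] at hdet
  have hdet0 : (jac P).det ≠ 0 := by
    rw [hdet]
    exact mul_ne_zero (by rwa [Ne, C_eq_zero]) hQ0
  have hcC : ∀ {r : ℝ}, r ≠ 0 → (C r : S ℓ) ≠ 0 := fun h => by rwa [Ne, C_eq_zero]
  have hQW : ∀ w ∈ W, subst (mat w) Q = C (mat w).det * Q := by
    intro w hw
    have h := subst_det_jac hP.adjoin_eq hw
    rw [hdet, map_mul, subst_C] at h
    apply mul_left_cancel₀ (hcC hc)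
    rw [h]
    ring
  set d := fun i => (P i).totalDegree with hd
  have hd2 : ∀ i, 2 ≤ d i := two_le_totalDegree hℓ hW hP
  obtain ⟨N, hQN⟩ : ∃ N, Q.IsHomogeneous N := by
    rw [hQdef, definingPolynomial_eq]
    exact ⟨_, IsHomogeneous.prod _ _ (fun _ => 1) fun H _ => linPoly_isHomogeneous _⟩
  set y : Fin ℓ → S ℓ := fun a => C c⁻¹ * (jac P).adjugate a k with hydef
  have hy : (jac P).mulVec y = Pi.single k Q := by
    ext1 i
    have h := congrFun (congrFun (Matrix.mul_adjugate (jac P)) i) k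
    rw [Matrix.mul_apply, Matrix.smul_apply, smul_eq_mul, hdet] at h
    have h1 : (jac P).mulVec y i = C c⁻¹ * ∑ a, jac P i a * (jac P).adjugate a k := by
      rw [Finset.mul_sum]
      simp only [Matrix.mulVec, dotProduct, hydef]
      exact Finset.sum_congr rfl fun a _ => by ring
    rw [h1, h, ← mul_assoc, ← mul_assoc, ← C_mul, inv_mul_cancel₀ hc, C_1, one_mul]
    by_cases hik : i = k
    · subst hik; simp
    · simp [hik]
  have hPinv : ∀ i, ∀ w ∈ W, subst (mat w) (P i) = P i := fun i =>
    mem_invariants.1 (generator_mem hP.adjoin_eq i)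
  have hpW : ∀ w ∈ W, ∀ j i, subst (mat w) (pairing P y j i) = C (mat w).det * pairing P y j i := by
    intro w hw j i
    have h := subst_pairing (d := d) hdet0 hy (A := mat w) (τ := 1) one_ne_zero
      (by rw [mat_mul_transpose, one_pow, one_smul]) (by rw [mat_transpose_mul, one_pow, one_smul])
      (fun i => by rw [one_pow, C_1, one_mul, hPinv i w hw]) (hQW w hw) j i
    simpa using h
  choose M hM using fun j i => definingPolynomial_dvd hα fun w hw => hpW w hw j i
  have hMinv : ∀ j i, M j i ∈ invariants W := by
    intro j i
    rw [mem_invariants]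
    intro w hw
    have h := hpW w hw j i
    rw [hM, map_mul, ← hQdef, hQW w hw] at h
    have h0 : (C (mat w).det * Q : S ℓ) ≠ 0 :=
      mul_ne_zero (hcC (left_ne_zero_of_mul (det_mat_mul_self w ▸ one_ne_zero))) hQ0
    apply mul_left_cancel₀ h0
    rw [h]
    ring
  have hpair : pairing P y = Q • Matrix.of M := by
    ext1 j i
    rw [hM]
    rfl
  refine ⟨y, Matrix.of M, hy, hMinv, ?_, hpair⟩
  obtain ⟨K, _, _, v, ζ, w, hζ, hw, hwv, h0, hk, hQv⟩ :=
    exists_regular_eigenvector hℓ hW hP hmax hα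
  have : CharZero K := charZero_of_injective_algebraMap (algebraMap ℝ K).injective
  rw [← hQdef] at hQv
  have hJv : aeval v (jac P).det ≠ 0 := by
    rw [hdet, map_mul, aeval_C]
    exact mul_ne_zero ((map_ne_zero _).2 hc) hQv
  have hsum : 2 * ∑ i, d i = ℓ * (d k + 2) := two_mul_sum_totalDegree hP hd2 hmax hζ hw hwv hJv
  set A2 : Matrix (Fin ℓ) (Fin ℓ) ℝ := (2 : ℝ) • 1 with hA2
  have hA2P : ∀ i, subst A2 (P i) = C (2 ^ d i) * P i := fun i =>
    subst_smul_one_of_isHomogeneous (hP.homogeneous i) 2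
  have hA2Q : subst A2 Q = C (2 ^ N) * Q := subst_smul_one_of_isHomogeneous hQN 2
  -- Degree count for the Jacobian determinant, by comparing its two scaling factors under `x ↦ 2
  -- x`.
  have hNsum : N + ℓ = ∑ i, d i := by
    have h1 : (jac P).map (subst A2) * A2.map C
        = Matrix.diagonal (fun i => C (2 ^ d i)) * jac P := by
      ext1 a b
      rw [Matrix.diagonal_mul, Matrix.mul_apply]
      simp only [jac, Matrix.map_apply, Matrix.of_apply]
      rw [← pderiv_C_mul, ← hA2P, pderiv_subst]
      exact Finset.sum_congr rfl fun m _ => mul_comm _ _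
    have h2 := congrArg Matrix.det h1
    have e1 : ((jac P).map (subst A2)).det = subst A2 (jac P).det := ((subst A2).map_det _).symm
    have e2 : (A2.map (C : ℝ → S ℓ)).det = C (2 ^ ℓ) := by
      have : (A2.map (C : ℝ → S ℓ)).det = C A2.det := ((C : ℝ →+* S ℓ).map_det _).symm
      rw [this, hA2, Matrix.det_smul, Matrix.det_one, Fintype.card_fin, mul_one]
    rw [Matrix.det_mul, Matrix.det_mul, e1, e2, Matrix.det_diagonal, hdet, map_mul, subst_C, hA2Q,
      ← map_prod, Finset.prod_pow_eq_pow_sum] at h2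
    have h3 : (C (2 ^ (N + ℓ)) : S ℓ) = C (2 ^ ∑ i, d i) := by
      apply mul_right_cancel₀ (mul_ne_zero (hcC hc) hQ0)
      rw [← h2, pow_add, C_mul]
      ring
    exact Nat.pow_right_injective le_rfl (by exact_mod_cast C_injective _ _ h3)
  have hsumle : 2 * ℓ ≤ ∑ i, d i := by
    have := Finset.sum_le_sum fun i (_ : i ∈ Finset.univ) => hd2 i
    simpa [mul_comm] using this
  -- The entry `M j i` scales with exponent `d j + d i - (d k + 2)`, so the determinant has exponent
  -- `2 ∑ d i - ℓ (d k + 2) = 0`.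
  have hdetM : subst A2 (Matrix.of M).det = (Matrix.of M).det := by
    have h1 : (C (2 ^ (d k + 2)) : S ℓ) • (Matrix.of M).map (subst A2)
        = Matrix.diagonal (fun i => C (2 ^ d i)) * Matrix.of M
          * Matrix.diagonal (fun i => C (2 ^ d i)) := by
      ext1 j i
      have h := subst_pairing (d := d) hdet0 hy (A := A2) (τ := 2) (χ := 2 ^ N) two_ne_zero
        (by rw [hA2]; simp [smul_smul, sq])
        (by rw [hA2]; simp [smul_smul, sq]) hA2P hA2Q j i
      rw [hM, map_mul, ← hQdef, hA2Q] at h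
      simp only [Matrix.smul_apply, smul_eq_mul, Matrix.map_apply, Matrix.diagonal_mul,
        Matrix.mul_diagonal, Matrix.of_apply]
      apply mul_left_cancel₀ (mul_ne_zero (hcC (pow_ne_zero N two_ne_zero)) hQ0)
      rw [C_mul, pow_add 2 (d j), C_mul] at h
      linear_combination h
    have h2 := congrArg Matrix.det h1
    have e1 : ((Matrix.of M).map (subst A2)).det = subst A2 (Matrix.of M).det :=
      ((subst A2).map_det _).symm
    rw [Matrix.det_smul, e1, Matrix.det_mul, Matrix.det_mul, Matrix.det_diagonal, Fintype.card_fin,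
      ← map_prod, Finset.prod_pow_eq_pow_sum, ← C_pow, ← pow_mul, mul_comm (d k + 2), ← hsum,
      two_mul, pow_add, C_mul] at h2
    apply mul_left_cancel₀ (mul_ne_zero (hcC (pow_ne_zero (∑ i, d i) two_ne_zero))
      (hcC (pow_ne_zero (∑ i, d i) two_ne_zero)))
    rw [h2]
    ring
  have hconst := eq_C_of_subst_two hdetM
  refine ⟨_, ?_, hconst⟩
  have hne : aeval v (Matrix.of M).det ≠ 0 := by
    set κ := aeval v Q / ((d k : K) * aeval v (P k)) with hκ
    have hκ0 : κ ≠ 0 := by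
      refine div_ne_zero hQv (mul_ne_zero (Nat.cast_ne_zero.2 ?_) hk)
      have := hd2 k
      omega
    -- It remains to see that the diagonal factors do not vanish, the Gram determinant being nonzero
    -- at `v`.
    have h1 : (aeval v).mapMatrix (pairing P y)
        = Matrix.diagonal (fun j => κ * ((if j = k then (N : K) else 0) - ((d j : K) - 1)))
          * (aeval v).mapMatrix (jac P * (jac P).transpose) := by
      ext1 j i
      rw [Matrix.diagonal_mul]
      exact aeval_pairing hW hP hd2 hmax (by omega) hQN hy hζ hw ⟨_, hQW w hw⟩ hwv hJv h0 hk hQv j i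
    have h2 := congrArg Matrix.det h1
    rw [← AlgHom.map_det, Matrix.det_mul, ← AlgHom.map_det, Matrix.det_mul, Matrix.det_transpose,
      Matrix.det_diagonal, hpair, Matrix.det_smul, map_mul, map_mul] at h2
    intro hz
    rw [hz, mul_zero] at h2
    refine mul_ne_zero (Finset.prod_ne_zero_iff.2 fun j _ => mul_ne_zero hκ0 ?_)
      (mul_ne_zero hJv hJv) h2.symm
    have hdj := hd2 j
    split_ifs with hjk
    · subst hjk
      -- The other degrees are at least 2, so `N = ∑ d i - ℓ ≥ d j + ℓ - 2 ≥ d j`; in particular `N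
      -- ≠ d j - 1`.
      have h3 : d j + 2 * (ℓ - 1) ≤ ∑ i, d i := by
        rw [← Finset.add_sum_erase _ _ (Finset.mem_univ j)]
        have := Finset.sum_le_sum fun i (_ : i ∈ Finset.univ.erase j) => hd2 i
        simp only [Finset.sum_const, Finset.card_erase_of_mem (Finset.mem_univ j),
          Finset.card_univ, Fintype.card_fin, smul_eq_mul] at this
        omega
      rw [sub_ne_zero]
      have h4 : (N : K) ≠ ((d j - 1 : ℕ) : K) := Nat.cast_injective.ne (by omega)
      rwa [Nat.cast_sub (by omega), Nat.cast_one] at h4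
    · rw [zero_sub, neg_ne_zero]
      have h4 : ((d j - 1 : ℕ) : K) ≠ 0 := Nat.cast_ne_zero.2 (by omega)
      rwa [Nat.cast_sub (by omega), Nat.cast_one] at h4
  intro hz
  rw [hconst, hz, C_0, map_zero] at hne
  exact hne rfl

end

end CoxeterForms

namespace CoxeterForms

noncomputable section

open MvPolynomial

variable {ℓ : ℕ}

/-! ### Forms on polynomial vector fields -/

/-- Alternating forms on the module of polynomial vector fields. -/
abbrev FieldForm (ℓ p : ℕ) : Type := (Fin ℓ → S ℓ) [⋀^Fin p]→ₗ[S ℓ] S ℓ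

/-- Vectors as constant vector fields. -/
def constField : V ℓ →ₗ[ℝ] (Fin ℓ → S ℓ) where
  toFun v := fun i => C (v i)
  map_add' u v := by ext1 i; simp
  map_smul' c v := by ext1 i; simp [MvPolynomial.smul_eq_C_mul]

theorem constField_apply (v : V ℓ) (i : Fin ℓ) : constField v i = C (v i) := rfl

theorem constField_stdVec (i : Fin ℓ) : constField (stdVec i) = Pi.single i (1 : S ℓ) := by
  ext1 j
  rw [constField_apply]
  by_cases h : j = i
  · subst h; simp [stdVec]
  · simp [stdVec, h]

theorem constField_isometry (w : V ℓ ≃ₗᵢ[ℝ] V ℓ) (v : V ℓ) :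
    constField (w v) = ((mat w).map C).mulVec (constField v) := by
  ext1 i
  rw [constField_apply, ← mat_mulVec]
  simp [Matrix.mulVec, dotProduct, constField_apply]

variable {p : ℕ}

theorem alternatingMap_sum_apply {R M N ι κ : Type*} [CommSemiring R] [AddCommMonoid M]
    [AddCommMonoid N] [Module R M] [Module R N] (s : Finset κ) (g : κ → M [⋀^ι]→ₗ[R] N)
    (v : ι → M) : (∑ k ∈ s, g k) v = ∑ k ∈ s, g k v := by
  classical
  induction s using Finset.induction_on with
  | empty => simp
  | insert a s ha ih => rw [Finset.sum_insert ha, Finset.sum_insert ha, ← ih]; rfl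

/-- The restriction of a form to constant vector fields. -/
def FieldForm.res (Ω : FieldForm ℓ p) : PolyForm ℓ p where
  toFun v := Ω fun i => constField (v i)
  map_update_add' v i x y := by
    have h : ∀ z, (fun j => constField (Function.update v i z j))
        = Function.update (fun j => constField (v j)) i (constField z) := fun z => by
      ext1 j; by_cases hj : j = i
      · subst hj; simp
      · simp [hj]
    simp only [h, map_add, Ω.map_update_add]
  map_update_smul' v i c x := by
    have h : ∀ z, (fun j => constField (Function.update v i z j))
        = Function.update (fun j => constField (v j)) i (constField z) := fun z => by
      ext1 j; by_cases hj : j = i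
      · subst hj; simp
      · simp [hj]
    have h2 : constField (c • x) = (C c : S ℓ) • constField x := by
      rw [map_smul]
      ext1 j
      simp [MvPolynomial.smul_eq_C_mul]
    simp only [h, h2, Ω.map_update_smul, smul_eq_mul, MvPolynomial.smul_eq_C_mul]
  map_eq_zero_of_eq' v i j h hij := Ω.map_eq_zero_of_eq _ (by rw [h]) hij

theorem FieldForm.res_apply (Ω : FieldForm ℓ p) (v : Fin p → V ℓ) :
    Ω.res v = Ω fun i => constField (v i) := rfl

theorem FieldForm.res_injective : Function.Injective (FieldForm.res : FieldForm ℓ p → PolyForm ℓ p) := by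
  intro Ω Ω' h
  refine Module.Basis.ext_alternating (Pi.basisFun (S ℓ) (Fin ℓ)) fun n _ => ?_
  have := congrArg (fun ω : PolyForm ℓ p => ω fun i => stdVec (n i)) h
  simp only [FieldForm.res_apply, constField_stdVec] at this
  simpa [Pi.basisFun_apply] using this

/-- `T` takes the values of `ω` on tuples of constant basis fields. Since `ω` is already
alternating, alternatization multiplies these values by `p!`. -/
theorem FieldForm.exists_res_eq (ω : PolyForm ℓ p) : ∃ Ω : FieldForm ℓ p, Ω.res = ω := by
  set T : MultilinearMap (S ℓ) (fun _ : Fin p => Fin ℓ → S ℓ) (S ℓ) :=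
    ∑ n : Fin p → Fin ℓ, (ω fun i => stdVec (n i)) •
      (MultilinearMap.mkPiAlgebra (S ℓ) (Fin p) (S ℓ)).compLinearMap
        fun i => LinearMap.proj (n i) with hT
  have hTe : ∀ n : Fin p → Fin ℓ, T (fun i => Pi.single (n i) (1 : S ℓ)) = ω fun i => stdVec (n i) := by
    intro n
    rw [hT, sum_apply, Finset.sum_eq_single n]
    · simp
    · intro m _ hm
      obtain ⟨i, hi⟩ := Function.ne_iff.1 hm
      simp only [smul_apply, MultilinearMap.compLinearMap_apply,
        MultilinearMap.mkPiAlgebra_apply, LinearMap.proj_apply, smul_eq_mul]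
      rw [Finset.prod_eq_zero (Finset.mem_univ i), mul_zero]
      exact Pi.single_eq_of_ne hi 1
    · simp
  refine ⟨(C ((p.factorial : ℝ)⁻¹) : S ℓ) • MultilinearMap.alternatization T, ?_⟩
  refine Module.Basis.ext_alternating (EuclideanSpace.basisFun (Fin ℓ) ℝ).toBasis fun n _ => ?_
  have he : ∀ i : Fin ℓ, (EuclideanSpace.basisFun (Fin ℓ) ℝ).toBasis i = stdVec i := fun i => by
    simp [stdVec]
  simp only [he, FieldForm.res_apply, constField_stdVec, AlternatingMap.smul_apply,
    MultilinearMap.alternatization_apply, MultilinearMap.domDomCongr_apply]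
  have h : ∀ σ : Equiv.Perm (Fin p), Equiv.Perm.sign σ •
      T (fun i => Pi.single (n (σ i)) (1 : S ℓ)) = ω fun i => stdVec (n i) := by
    intro σ
    rw [hTe fun i => n (σ i)]
    have := ω.map_perm (fun i => stdVec (n i)) σ
    rw [Function.comp_def] at this
    rw [this, smul_smul, Int.units_mul_self, one_smul]
  simp only [h, Finset.sum_const, Finset.card_univ, Fintype.card_perm, Fintype.card_fin]
  rw [nsmul_eq_mul, smul_eq_mul, ← mul_assoc, ← map_natCast (C : ℝ →+* S ℓ), ← C_mul,
    inv_mul_cancel₀ (Nat.cast_ne_zero.2 p.factorial_ne_zero), C_1, one_mul]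

theorem FieldForm.apply_expand (Ω : FieldForm ℓ p) (B : Matrix (Fin ℓ) (Fin ℓ) (S ℓ))
    (z : Fin p → Fin ℓ → S ℓ) :
    Ω (fun i => B.mulVec (z i))
      = ∑ n : Fin p → Fin ℓ, (∏ i, z i (n i)) * Ω fun i => B.mulVec (Pi.single (n i) 1) := by
  have h : ∀ i, B.mulVec (z i) = ∑ m, z i m • B.mulVec (Pi.single m 1) := by
    intro i
    simp only [← Matrix.mulVec_smul]
    rw [← Matrix.mulVec_sum]
    congr 1
    ext1 j
    simp [Finset.sum_apply, Pi.single_apply]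
  simp only [h]
  rw [← AlternatingMap.coe_multilinearMap, MultilinearMap.map_sum]
  refine Finset.sum_congr rfl fun n _ => ?_
  rw [MultilinearMap.map_smul_univ, smul_eq_mul]

variable {W : Subgroup (V ℓ ≃ₗᵢ[ℝ] V ℓ)}

theorem subst_apply_of_mem {ω : PolyForm ℓ p} (hω : ω ∈ antiInvariantForms W p)
    {w : V ℓ ≃ₗᵢ[ℝ] V ℓ} (hw : w ∈ W) (v : Fin p → V ℓ) :
    subst (mat w) (ω v) = C (mat w).det * ω fun i => w⁻¹ (v i) := by
  have h := hω w⁻¹ (inv_mem hw)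
  have h1 := congrArg (fun η : PolyForm ℓ p => η fun i => w⁻¹ (v i)) h
  have hdet : LinearMap.det (w⁻¹).toLinearEquiv.toLinearMap = (mat w).det := by
    rw [← det_mat, ← mat_transpose, Matrix.det_transpose]
  rw [hdet] at h1
  simp only [actForm, act_eq_subst, inv_inv, LinearMap.compAlternatingMap_apply,
    AlternatingMap.compLinearMap_apply, AlternatingMap.smul_apply, AlgHom.toLinearMap_apply] at h1
  rw [MvPolynomial.smul_eq_C_mul] at h1
  rw [← h1]
  congr 2
  ext1 i
  exact (w.apply_symm_apply (v i)).symm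

/-- The values of anti-invariant forms on invariant vector fields are anti-invariant. -/
theorem subst_fieldForm_apply {Ω : FieldForm ℓ p} (hΩ : Ω.res ∈ antiInvariantForms W p)
    {w : V ℓ ≃ₗᵢ[ℝ] V ℓ} (hw : w ∈ W) {u : Fin p → Fin ℓ → S ℓ}
    (hu : ∀ i, (fun m => subst (mat w) (u i m)) = ((mat w).map C).mulVec (u i)) :
    subst (mat w) (Ω u) = C (mat w).det * Ω u := by
  -- Substitution is only semilinear over `S`, so `Ω u` is expanded over constant fields, where the
  -- coefficients and the form transform separately, and then collected again.
  have h1 := Ω.apply_expand 1 u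
  simp only [Matrix.one_mulVec] at h1
  conv_lhs => rw [h1]
  have h2 : ∀ n : Fin p → Fin ℓ, subst (mat w) (Ω fun i => Pi.single (n i) 1)
      = C (mat w).det * Ω fun i => ((mat w⁻¹).map C).mulVec (Pi.single (n i) 1) := by
    intro n
    have := subst_apply_of_mem hΩ hw fun i => stdVec (n i)
    simpa only [FieldForm.res_apply, constField_isometry, constField_stdVec] using this
  simp only [map_sum, map_mul, map_prod, h2]
  have h3 := Ω.apply_expand ((mat w⁻¹).map C) fun i m => subst (mat w) (u i m)
  have h4 : (fun i => ((mat w⁻¹).map C).mulVec fun m => subst (mat w) (u i m)) = u := by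
    ext1 i
    rw [hu, Matrix.mulVec_mulVec, ← Matrix.map_mul, mat_inv_mul, Matrix.map_one _ C_0 C_1,
      Matrix.one_mulVec]
  rw [h4] at h3
  rw [h3, Finset.mul_sum]
  exact Finset.sum_congr rfl fun n _ => by ring

theorem extend_update {I : Fin p → Fin ℓ} (hI : Function.Injective I) (v : Fin p → Fin ℓ → S ℓ)
    (g : Fin ℓ → Fin ℓ → S ℓ) (i : Fin p) (x : Fin ℓ → S ℓ) :
    Function.extend I (Function.update v i x) g
      = Function.update (Function.extend I v g) (I i) x := by
  ext1 j
  by_cases hj : ∃ a, I a = j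
  · obtain ⟨a, rfl⟩ := hj
    rw [hI.extend_apply]
    by_cases ha : a = i
    · subst ha; simp
    · rw [Function.update_of_ne ha, Function.update_of_ne (hI.ne ha), hI.extend_apply]
  · rw [Function.extend_apply' _ _ _ hj, Function.update_of_ne, Function.extend_apply' _ _ _ hj]
    rintro rfl
    exact hj ⟨i, rfl⟩

/-- The matrix `U` with the rows indexed by `I` replaced by `v`. -/
def replaceRows (U : Matrix (Fin ℓ) (Fin ℓ) (S ℓ)) (I : Fin p ↪o Fin ℓ)
    (v : Fin p → Fin ℓ → S ℓ) : Matrix (Fin ℓ) (Fin ℓ) (S ℓ) :=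
  Matrix.of (Function.extend I v fun j m => U j m)

theorem replaceRows_mem (U : Matrix (Fin ℓ) (Fin ℓ) (S ℓ)) (I : Fin p ↪o Fin ℓ)
    (v : Fin p → Fin ℓ → S ℓ) (i : Fin p) (m : Fin ℓ) : replaceRows U I v (I i) m = v i m := by
  rw [replaceRows, Matrix.of_apply, I.injective.extend_apply]

theorem replaceRows_of_notMem (U : Matrix (Fin ℓ) (Fin ℓ) (S ℓ)) {I : Fin p ↪o Fin ℓ}
    (v : Fin p → Fin ℓ → S ℓ) {j : Fin ℓ} (hj : ¬ ∃ a, I a = j) (m : Fin ℓ) :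
    replaceRows U I v j m = U j m := by
  rw [replaceRows, Matrix.of_apply, Function.extend_apply' _ _ _ hj]

/-- The form `v ↦ det`, where the rows of the matrix indexed by `I` are replaced by `v`. -/
def replaceForm (U : Matrix (Fin ℓ) (Fin ℓ) (S ℓ)) (I : Fin p ↪o Fin ℓ) : FieldForm ℓ p where
  toFun v := Matrix.detRowAlternating (Function.extend I v fun j m => U j m)
  map_update_add' {inst} v i x y := by
    obtain rfl := Subsingleton.elim inst (instDecidableEqFin p)
    simp only [extend_update I.injective, AlternatingMap.map_update_add]
  map_update_smul' {inst} v i c x := by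
    obtain rfl := Subsingleton.elim inst (instDecidableEqFin p)
    simp only [extend_update I.injective, AlternatingMap.map_update_smul]
  map_eq_zero_of_eq' v i j h hij := by
    refine AlternatingMap.map_eq_zero_of_eq _ _ ?_ (I.injective.ne hij)
    rw [I.injective.extend_apply, I.injective.extend_apply, h]

theorem replaceForm_apply (U : Matrix (Fin ℓ) (Fin ℓ) (S ℓ)) (I : Fin p ↪o Fin ℓ)
    (v : Fin p → Fin ℓ → S ℓ) : replaceForm U I v = (replaceRows U I v).det := rfl

theorem replaceForm_self (U : Matrix (Fin ℓ) (Fin ℓ) (S ℓ)) (I : Fin p ↪o Fin ℓ) :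
    replaceForm U I (fun i => U (I i)) = U.det := by
  rw [replaceForm_apply]
  congr 1
  ext1 j m
  by_cases hj : ∃ a, I a = j
  · obtain ⟨a, rfl⟩ := hj
    rw [replaceRows_mem]
  · rw [replaceRows_of_notMem U _ hj]

/-- `I` and `J` have the same size and an order embedding is determined by its range, so some `J i`
lies outside `I`. That row of `U` then occurs twice. -/
theorem replaceForm_of_ne (U : Matrix (Fin ℓ) (Fin ℓ) (S ℓ)) {I J : Fin p ↪o Fin ℓ} (h : I ≠ J) :
    replaceForm U I (fun i => U (J i)) = 0 := by
  obtain ⟨i, hi⟩ : ∃ i, J i ∉ Set.range I := by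
    by_contra! hc
    apply h
    have h1 : Set.range J ⊆ Set.range I := by
      rintro _ ⟨i, rfl⟩
      exact hc i
    have h2 : Set.range J = Set.range I := by
      refine Set.eq_of_subset_of_ncard_le h1 ?_ (Set.finite_range _)
      rw [Set.ncard_range_of_injective I.injective, Set.ncard_range_of_injective J.injective]
    have h3 := (StrictMono.range_inj I.strictMono J.strictMono).1 h2.symm
    exact DFunLike.coe_injective h3
  rw [replaceForm_apply]
  refine Matrix.det_zero_of_row_eq (i := I i) (j := J i) (fun h => hi ⟨i, h⟩) ?_
  ext1 m
  rw [replaceRows_mem, replaceRows_of_notMem U _ (fun ⟨a, ha⟩ => hi ⟨a, ha⟩)]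

/-- A form that vanishes on a frame of vector fields is zero. -/
theorem FieldForm.eq_zero_of_frame {U : Matrix (Fin ℓ) (Fin ℓ) (S ℓ)} (hU : U.det ≠ 0)
    {Ω : FieldForm ℓ p} (h : ∀ J : Fin p ↪o Fin ℓ, Ω (fun i => U (J i)) = 0) : Ω = 0 := by
  have h1 : Ω.compLinearMap U.vecMulLinear = 0 := by
    refine Module.Basis.ext_alternating (Pi.basisFun (S ℓ) (Fin ℓ)) fun n hn => ?_
    have h2 : ∀ m : Fin p → Fin ℓ, Ω.compLinearMap U.vecMulLinear
        (fun i => Pi.basisFun (S ℓ) (Fin ℓ) (m i)) = Ω fun i => U (m i) := by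
      intro m
      rw [AlternatingMap.compLinearMap_apply]
      congr 1
      ext1 i
      rw [Pi.basisFun_apply, Matrix.vecMulLinear_apply, Matrix.single_one_vecMul]
      rfl
    rw [h2, AlternatingMap.zero_apply]
    set σ := Tuple.sort n
    have hs : StrictMono (n ∘ σ) :=
      (Tuple.monotone_sort n).strictMono_of_injective (hn.comp σ.injective)
    have h3 := h (OrderEmbedding.ofStrictMono _ hs)
    have h4 := Ω.map_perm (fun i => U (n i)) σ
    have h5 : Ω ((fun i => U (n i)) ∘ σ) = 0 := h3
    rw [h5] at h4
    have h6 := congrArg (fun x => Equiv.Perm.sign σ • x) h4.symm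
    simpa [smul_smul, Int.units_mul_self] using h6
  ext1 z
  -- Multiplying the arguments by the adjugate gives `(det U)^p Ω(z) = 0` for arbitrary fields `z`.
  have h2 := congrArg (fun Ψ : FieldForm ℓ p => Ψ fun i => U.adjugate.vecMulLinear (z i)) h1
  simp only [AlternatingMap.compLinearMap_apply, AlternatingMap.zero_apply,
    Matrix.vecMulLinear_apply, Matrix.vecMul_vecMul, Matrix.adjugate_mul, Matrix.vecMul_smul,
    Matrix.vecMul_one] at h2
  rw [← AlternatingMap.coe_multilinearMap, MultilinearMap.map_smul_univ, smul_eq_mul] at h2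
  rw [AlternatingMap.zero_apply]
  refine (mul_eq_zero.1 h2).resolve_left ?_
  exact Finset.prod_ne_zero_iff.2 fun _ _ => hU

/-- The determinant identity behind the complementary minors of a dual frame. -/
theorem replaceForm_mul_det {U Θ : Matrix (Fin ℓ) (Fin ℓ) (S ℓ)} {Q : S ℓ}
    (h : U * Θ.transpose = Q • (1 : Matrix (Fin ℓ) (Fin ℓ) (S ℓ))) (I : Fin p ↪o Fin ℓ)
    (v : Fin p → Fin ℓ → S ℓ) :
    replaceForm U I v * Θ.det
      = Q ^ (ℓ - p) * (Matrix.of fun j i => Θ.mulVec (v j) (I i)).det := by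
  classical
  set N : Matrix (Fin ℓ) (Fin ℓ) (S ℓ) := replaceRows U I v with hN
  have hrow : ∀ i j, (N * Θ.transpose) (I i) j = Θ.mulVec (v i) j := by
    intro i j
    rw [Matrix.mul_apply]
    simp only [hN, replaceRows_mem, Matrix.transpose_apply,
      Matrix.mulVec, dotProduct]
    exact Finset.sum_congr rfl fun m _ => mul_comm _ _
  have hrow' : ∀ i, i ∉ Set.range I → ∀ j, (N * Θ.transpose) i j = if i = j then Q else 0 := by
    intro i hi j
    have h1 := congrFun (congrFun h i) j
    rw [Matrix.mul_apply] at h1 ⊢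
    have hi' : ¬ ∃ a, I a = i := fun ⟨a, ha⟩ => hi ⟨a, ha⟩
    simp only [hN, replaceRows_of_notMem U _ hi']
    rw [h1, Matrix.smul_apply, Matrix.one_apply, smul_eq_mul, mul_ite, mul_one, mul_zero]
  -- In the product with `Θᵀ`, the rows outside `I` are `Q` times unit vectors. The matrix is block
  -- triangular: one block is `Q` times the identity of size `ℓ - p`, the other is the required
  -- minor of `Θ`.
  rw [replaceForm_apply, ← Matrix.det_transpose Θ, ← Matrix.det_mul,
    Matrix.twoBlockTriangular_det _ (fun i => i ∈ Set.range I) (fun i hi j hj => by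
      rw [hrow' i hi, if_neg]
      rintro rfl
      exact hi hj), mul_comm]
  congr 1
  · have h2 : Matrix.toSquareBlockProp (N * Θ.transpose) (fun i => ¬ i ∈ Set.range I)
        = Q • (1 : Matrix _ _ (S ℓ)) := by
      ext1 i j
      have h3 := hrow' i.1 i.2 j.1
      rw [Matrix.smul_apply, Matrix.one_apply, smul_eq_mul, mul_ite, mul_one, mul_zero]
      simp only [← Subtype.ext_iff] at h3
      exact h3
    rw [h2, Matrix.det_smul, Matrix.det_one, mul_one]
    congr 1
    rw [Fintype.card_subtype_compl, Fintype.card_fin]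
    congr 1
    rw [Fintype.card_eq_nat_card]
    exact (Nat.card_congr (Equiv.ofInjective I I.injective).symm).trans (Nat.card_fin p)
  · set X : Matrix (Set.range I) (Set.range I) (S ℓ) :=
      (N * Θ.transpose).submatrix Subtype.val Subtype.val
    have h2 : X.det = (X.submatrix (Equiv.ofInjective I I.injective)
        (Equiv.ofInjective I I.injective)).det := (Matrix.det_submatrix_equiv_self _ X).symm
    have h3 : Matrix.toSquareBlockProp (N * Θ.transpose) (fun i => i ∈ Set.range I) = X := rfl
    rw [h3]
    refine Eq.trans ?_ (h2.trans ?_)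
    · congr!
    congr 1
    ext1 i j
    exact hrow i (I j)

theorem exists_basis_of_existsUnique {R M ι : Type*} [Semiring R] [AddCommMonoid M] [Module R M]
    [Fintype ι] (b : ι → M) (hinj : ∀ r s : ι → R, ∑ i, r i • b i = ∑ i, s i • b i → r = s)
    (hspan : ∀ x, ∃ r : ι → R, x = ∑ i, r i • b i) : ∃ β : Module.Basis ι R M, ⇑β = b := by
  have hli : LinearIndependent R b := by
    rw [Fintype.linearIndependent_iffₛ]
    intro r s h i
    exact congrFun (hinj r s h) i
  refine ⟨Module.Basis.mk hli fun x _ => ?_, Module.Basis.coe_mk _ _⟩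
  obtain ⟨r, rfl⟩ := hspan x
  exact Submodule.sum_mem _ fun i _ => Submodule.smul_mem _ _ (Submodule.subset_span ⟨i, rfl⟩)

/-- A dual pair of frames with determinant proportional to `Q` gives a basis of the module of
anti-invariant forms. -/
theorem exists_basis_of_dual {Q : S ℓ} (hQ0 : Q ≠ 0)
    (hQW : ∀ w ∈ W, subst (mat w) Q = C (mat w).det * Q)
    (hdvd : ∀ f : S ℓ, (∀ w ∈ W, subst (mat w) f = C (mat w).det * f) → Q ∣ f)
    {U Θ : Matrix (Fin ℓ) (Fin ℓ) (S ℓ)} {e : ℝ} (he : e ≠ 0) (hU : U.det = C e * Q)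
    (hUΘ : U * Θ.transpose = Q • (1 : Matrix (Fin ℓ) (Fin ℓ) (S ℓ)))
    (hUW : ∀ w ∈ W, ∀ j, (fun m => subst (mat w) (U j m)) = ((mat w).map C).mulVec (U j))
    (hp : p ≤ ℓ) :
    ∃ b : Module.Basis (Fin p ↪o Fin ℓ) (invariants W) (antiInvariantForms W p),
      ∀ (I : Fin p ↪o Fin ℓ) (v : Fin p → V ℓ), Q ^ p * (b I : PolyForm ℓ p) v
        = Q * (Matrix.of fun j i => Θ.mulVec (constField (v j)) (I i)).det := by
  classical
  have heC : ∀ {r : ℝ}, r ≠ 0 → (C r : S ℓ) ≠ 0 := fun h => by rwa [Ne, C_eq_zero]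
  have hdetC : ∀ w : V ℓ ≃ₗᵢ[ℝ] V ℓ, (C (mat w).det : S ℓ) ≠ 0 := fun w =>
    heC (left_ne_zero_of_mul (det_mat_mul_self w ▸ one_ne_zero))
  have hU0 : U.det ≠ 0 := by
    rw [hU]
    exact mul_ne_zero (heC he) hQ0
  -- The factor `e⁻¹` makes these forms dual to the frame up to `Q`: they take the value `Q` on
  -- their own rows and 0 on the other choices.
  set B : (Fin p ↪o Fin ℓ) → FieldForm ℓ p := fun I => (C e⁻¹ : S ℓ) • replaceForm U I with hB
  have hBself : ∀ I, B I (fun i => U (I i)) = Q := by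
    intro I
    rw [hB, AlternatingMap.smul_apply, replaceForm_self, hU, smul_eq_mul, ← mul_assoc, ← C_mul,
      inv_mul_cancel₀ he, C_1, one_mul]
  have hBne : ∀ I J, I ≠ J → B I (fun i => U (J i)) = 0 := by
    intro I J h
    rw [hB, AlternatingMap.smul_apply, replaceForm_of_ne U h, smul_zero]
  have hBmem : ∀ I, (B I).res ∈ antiInvariantForms W p := by
    intro I w hw
    ext1 v
    have hmat : (replaceRows U I fun i => constField (w⁻¹ (v i))).map (subst (mat w⁻¹))
        = (replaceRows U I fun i => constField (v i)) * ((mat w⁻¹).map C).transpose := by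
      ext1 j m
      rw [Matrix.map_apply]
      have hr : ∀ X Y : Matrix (Fin ℓ) (Fin ℓ) (S ℓ),
          (X * Y.transpose) j m = Y.mulVec (X j) m := by
        intro X Y
        rw [Matrix.mul_apply]
        simp only [Matrix.transpose_apply, Matrix.mulVec, dotProduct]
        exact Finset.sum_congr rfl fun m _ => mul_comm _ _
      rw [hr]
      by_cases hj : ∃ a, I a = j
      · obtain ⟨a, rfl⟩ := hj
        have h1 : (replaceRows U I fun i => constField (v i)) (I a) = constField (v a) :=
          funext fun _ => replaceRows_mem U I _ a _
        rw [replaceRows_mem, h1, ← constField_isometry, constField_apply, subst_C]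
      · have h1 : (replaceRows U I fun i => constField (v i)) j = U j :=
          funext fun _ => replaceRows_of_notMem U _ hj _
        rw [replaceRows_of_notMem U _ hj, h1, ← hUW _ (inv_mem hw)]
    have hdet := congrArg Matrix.det hmat
    have e1 : ∀ X : Matrix (Fin ℓ) (Fin ℓ) (S ℓ),
        (X.map (subst (mat w⁻¹))).det = subst (mat w⁻¹) X.det := fun X =>
      ((subst (mat w⁻¹)).map_det X).symm
    have e2 : ((mat w⁻¹).map (C : ℝ → S ℓ)).det = C (mat w⁻¹).det :=
      ((C : ℝ →+* S ℓ).map_det _).symm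
    rw [Matrix.det_mul, Matrix.det_transpose, e1, e2, ← replaceForm_apply,
      ← replaceForm_apply] at hdet
    have hdw : LinearMap.det w.toLinearEquiv.toLinearMap = (mat w⁻¹).det := by
      rw [← det_mat, ← mat_transpose, Matrix.det_transpose]
    rw [hdw]
    simp only [actForm, act_eq_subst, LinearMap.compAlternatingMap_apply,
      AlternatingMap.compLinearMap_apply, AlternatingMap.smul_apply, AlgHom.toLinearMap_apply,
      FieldForm.res_apply, hB, smul_eq_mul, map_mul, subst_C]
    rw [MvPolynomial.smul_eq_C_mul]
    have e3 : ∀ x : V ℓ, (w⁻¹).toLinearEquiv.toLinearMap x = w⁻¹ x := fun x => rfl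
    simp only [e3]
    rw [hdet]
    ring
  set b : (Fin p ↪o Fin ℓ) → antiInvariantForms W p := fun I => ⟨(B I).res, hBmem I⟩ with hb
  have hsum : ∀ r : (Fin p ↪o Fin ℓ) → invariants W,
      ((∑ I, r I • b I : antiInvariantForms W p) : PolyForm ℓ p)
        = (∑ I, ((r I : S ℓ)) • B I).res := by
    intro r
    ext1 v
    rw [FieldForm.res_apply, Submodule.coe_sum, alternatingMap_sum_apply,
      alternatingMap_sum_apply]
    rfl
  have heval : ∀ (r : (Fin p ↪o Fin ℓ) → S ℓ) (J : Fin p ↪o Fin ℓ),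
      (∑ I, r I • B I) (fun i => U (J i)) = r J * Q := by
    intro r J
    rw [alternatingMap_sum_apply, Finset.sum_eq_single J]
    · rw [AlternatingMap.smul_apply, hBself, smul_eq_mul]
    · intro I _ hI
      rw [AlternatingMap.smul_apply, hBne I J hI, smul_zero]
    · simp
  obtain ⟨β, hβ⟩ := exists_basis_of_existsUnique (R := invariants W) b (by
    intro r s hrs
    ext1 J
    have h1 : (∑ I, ((r I : S ℓ)) • B I) = ∑ I, ((s I : S ℓ)) • B I := by
      apply FieldForm.res_injective
      rw [← hsum, ← hsum, hrs]
    have h3 := heval (fun I => r I) J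
    rw [h1, heval (fun I => s I) J] at h3
    exact Subtype.ext (mul_right_cancel₀ hQ0 h3.symm)) (by
    rintro ⟨ω, hω⟩
    obtain ⟨Ω, rfl⟩ := FieldForm.exists_res_eq ω
    have hanti : ∀ J : Fin p ↪o Fin ℓ, ∀ w ∈ W,
        subst (mat w) (Ω fun i => U (J i)) = C (mat w).det * Ω fun i => U (J i) :=
      fun J w hw => subst_fieldForm_apply hω hw fun i => hUW w hw _
    -- The coordinates of the form are its values on the frame divided by `Q`; they are invariant as
    -- quotients of two anti-invariants.
    choose r hr using fun J => hdvd _ (hanti J)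
    have hrW : ∀ J, r J ∈ invariants W := by
      intro J
      rw [mem_invariants]
      intro w hw
      have h := hanti J w hw
      rw [hr, map_mul, hQW w hw] at h
      apply mul_left_cancel₀ (mul_ne_zero (hdetC w) hQ0)
      rw [h]
      ring
    have h1 : Ω = ∑ I, r I • B I := by
      rw [← sub_eq_zero]
      refine FieldForm.eq_zero_of_frame hU0 fun J => ?_
      rw [AlternatingMap.sub_apply, heval, hr]
      ring
    refine ⟨fun I => ⟨r I, hrW I⟩, Subtype.ext ?_⟩
    rw [hsum]
    exact congrArg FieldForm.res h1)
  refine ⟨β, fun I v => ?_⟩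
  rw [hβ]
  have h1 := replaceForm_mul_det hUΘ I fun j => constField (v j)
  -- This converts the factor `Q^(ℓ-p) / det Θ` of the minor identity into `e Q^(1-p)`.
  have h2 : Θ.det * (C e * Q) = Q ^ ℓ := by
    have := congrArg Matrix.det hUΘ
    rw [Matrix.det_mul, Matrix.det_transpose, hU, Matrix.det_smul, Matrix.det_one, mul_one,
      Fintype.card_fin] at this
    rw [← this]
    ring
  have h3 : (b I : PolyForm ℓ p) v
      = C e⁻¹ * replaceForm U I fun j => constField (v j) := rfl
  have h4 : Q ^ ℓ = Q ^ p * Q ^ (ℓ - p) := by rw [← pow_add, Nat.add_sub_cancel' hp]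
  have h5 : (C e⁻¹ * C e : S ℓ) = 1 := by rw [← C_mul, inv_mul_cancel₀ he, C_1]
  rw [h3]
  apply mul_left_cancel₀ (pow_ne_zero ℓ hQ0)
  set R := replaceForm U I fun j => constField (v j)
  calc Q ^ ℓ * (Q ^ p * (C e⁻¹ * R)) = Q ^ p * (R * Θ.det) * (C e⁻¹ * C e) * Q := by
        rw [← h2]; ring
    _ = _ := by
        rw [h5, h1, h4]
        ring

end

end CoxeterForms

namespace CoxeterForms

noncomputable section

open MvPolynomial

variable {ℓ : ℕ} {W : Subgroup (V ℓ ≃ₗᵢ[ℝ] V ℓ)} {P : Fin ℓ → S ℓ}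

/-! ### The frame dual to the differentials -/

theorem exists_jac_eq_mul (hP : Algebra.adjoin ℝ (Set.range P) = invariants W) {f : Fin ℓ → S ℓ}
    (hf : ∀ j, f j ∈ invariants W) :
    ∃ A : Matrix (Fin ℓ) (Fin ℓ) (S ℓ), (∀ j i, A j i ∈ invariants W) ∧ jac f = A * jac P := by
  choose Ψ hΨ using fun j => exists_aeval_eq hP (hf j)
  refine ⟨Matrix.of fun j i => aeval P (pderiv i (Ψ j)), fun j i => ?_, ?_⟩
  · rw [Matrix.of_apply, ← hP, Algebra.adjoin_range_eq_range_aeval]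
    exact ⟨_, rfl⟩
  · ext1 j m
    rw [Matrix.mul_apply]
    simp only [jac, Matrix.of_apply]
    rw [← hΨ j, derivation_aeval]
    rfl

theorem map_subst_eq {A : Matrix (Fin ℓ) (Fin ℓ) (S ℓ)} (hA : ∀ j i, A j i ∈ invariants W)
    {w : V ℓ ≃ₗᵢ[ℝ] V ℓ} (hw : w ∈ W) : A.map (subst (mat w)) = A := by
  ext1 j i
  exact mem_invariants.1 (hA j i) w hw

/-- With `J(f) = A J(P)`, the pairing relation reads `Θ J(P)ᵀ = Q A M`, so `U = ((A M)ᵀ)⁻¹ J(P)` is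
dual to `Θ`. The matrix `A M` consists of invariants, so the rows of `U` are invariant combinations
of gradients, hence invariant fields. -/
theorem exists_dual_frame {f y : Fin ℓ → S ℓ} {Q : S ℓ} {c : ℝ} (hc : c ≠ 0)
    (hP : Algebra.adjoin ℝ (Set.range P) = invariants W)
    (hf : Algebra.adjoin ℝ (Set.range f) = invariants W) (hQ0 : Q ≠ 0)
    (hJ : (jac P).det = C c * Q) {M : Matrix (Fin ℓ) (Fin ℓ) (S ℓ)}
    (hM : ∀ j i, M j i ∈ invariants W) (hdet : ∃ m : ℝ, m ≠ 0 ∧ M.det = C m)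
    (hPM : pairing P y = Q • M) :
    ∃ (U : Matrix (Fin ℓ) (Fin ℓ) (S ℓ)) (e : ℝ), e ≠ 0 ∧ U.det = C e * Q ∧
      U * (jac f * fieldJac y).transpose = Q • (1 : Matrix (Fin ℓ) (Fin ℓ) (S ℓ)) ∧
      ∀ w ∈ W, ∀ j, (fun m => subst (mat w) (U j m)) = ((mat w).map C).mulVec (U j) := by
  obtain ⟨A, hA, hfA⟩ := exists_jac_eq_mul hP (generator_mem hf)
  obtain ⟨A', hA', hPA⟩ := exists_jac_eq_mul hf (generator_mem hP)
  obtain ⟨m, hm, hMm⟩ := hdet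
  have hJ0 : (jac P).det ≠ 0 := by
    rw [hJ]
    exact mul_ne_zero (by rwa [Ne, C_eq_zero]) hQ0
  -- Both families generate the invariants, so the chain rule holds in both directions and `A` is
  -- invertible over `S`.
  have hdetA : A'.det * A.det = 1 := by
    have h := congrArg Matrix.det hPA
    rw [hfA, Matrix.det_mul, Matrix.det_mul, ← mul_assoc] at h
    exact (mul_right_cancel₀ hJ0 ((one_mul _).trans h)).symm
  set N : Matrix (Fin ℓ) (Fin ℓ) (S ℓ) := (A * M).transpose with hN
  have hNu : IsUnit N.det := by
    rw [hN, Matrix.det_transpose, Matrix.det_mul, hMm]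
    exact (IsUnit.of_mul_eq_one_right _ hdetA).mul ((isUnit_iff_ne_zero.2 hm).map C)
  have hBu : IsUnit (N⁻¹).det := (Matrix.isUnit_nonsing_inv_det_iff).2 hNu
  obtain ⟨r, hr, hrB⟩ := MvPolynomial.isUnit_iff_eq_C_of_isReduced.1 hBu
  have hsub : ∀ (w : V ℓ ≃ₗᵢ[ℝ] V ℓ) (X Y : Matrix (Fin ℓ) (Fin ℓ) (S ℓ)),
      (X * Y).map (subst (mat w)) = X.map (subst (mat w)) * Y.map (subst (mat w)) :=
    fun w X Y => Matrix.map_mul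
  refine ⟨N⁻¹ * jac P, r * c, mul_ne_zero hr.ne_zero hc, ?_, ?_, ?_⟩
  · rw [Matrix.det_mul, hrB, hJ, C_mul, mul_assoc]
  · have h1 : N⁻¹ * jac P * (jac f * fieldJac y).transpose
        = N⁻¹ * (A * pairing P y).transpose := by
      rw [hfA, pairing]
      simp only [Matrix.transpose_mul, Matrix.transpose_transpose, Matrix.mul_assoc]
    rw [h1, hPM, Matrix.mul_smul, Matrix.transpose_smul, ← hN, Matrix.mul_smul,
      Matrix.nonsing_inv_mul _ hNu]
  · intro w hw j
    have hNw : N.map (subst (mat w)) = N := by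
      rw [hN, Matrix.transpose_map, hsub, map_subst_eq hA hw, map_subst_eq hM hw]
    have hBw : (N⁻¹).map (subst (mat w)) = N⁻¹ := by
      refine (Matrix.inv_eq_left_inv ?_).symm
      conv_lhs => rw [← hNw]
      rw [← hsub, hNw, Matrix.nonsing_inv_mul _ hNu]
      exact Matrix.map_one _ (map_zero _) (map_one _)
    have hJw : (jac P).map (subst (mat w)) = jac P * ((mat w).map C).transpose := by
      conv_rhs => rw [← subst_jac fun i => mem_invariants.1 (generator_mem hP i) w hw]
      rw [Matrix.mul_assoc, ← Matrix.transpose_map, ← Matrix.map_mul, mat_mul_transpose,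
        Matrix.map_one _ C_0 C_1, Matrix.mul_one]
    ext1 n
    have h := congrFun (congrFun (hsub w N⁻¹ (jac P)) j) n
    rw [hBw, hJw, ← Matrix.mul_assoc, Matrix.mul_apply] at h
    rw [Matrix.map_apply] at h
    rw [h]
    simp only [Matrix.transpose_apply, Matrix.mulVec, dotProduct]
    exact Finset.sum_congr rfl fun _ _ => mul_comm _ _

/-! ### The operator `hatD` on polynomials -/

/-- By the chain rule for `D` on the `P j`, both sides solve the linear system with matrix `J(P)`
and right-hand side `Q e_k`. -/
theorem algebraMap_mul_derivation_X {y : Fin ℓ → S ℓ} {Q : S ℓ} {k : Fin ℓ}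
    {D : Derivation ℝ (F ℓ) (F ℓ)} (hJ : (jac P).det ≠ 0)
    (hDP : ∀ j, D (algebraMap (S ℓ) (F ℓ) (P j)) = if j = k then 1 else 0)
    (hy : (jac P).mulVec y = Pi.single k Q) (a : Fin ℓ) :
    algebraMap (S ℓ) (F ℓ) Q * D (algebraMap (S ℓ) (F ℓ) (X a)) = algebraMap (S ℓ) (F ℓ) (y a) := by
  set φ := algebraMap (S ℓ) (F ℓ) with hφ
  have hD : ∀ f : S ℓ, D (φ f) = ∑ a, φ (pderiv a f) * D (φ (X a)) := by
    intro f
    have h : ∀ g : S ℓ, aeval (fun i => φ (X i)) g = φ g := fun g => by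
      have := MvPolynomial.aeval_unique (IsScalarTower.toAlgHom ℝ (S ℓ) (F ℓ))
      exact (DFunLike.congr_fun this g).symm
    have h1 := derivation_aeval D (fun i => φ (X i)) f
    simpa only [h, smul_eq_mul] using h1
  have hker : ((jac P).map φ).mulVec (fun a => φ Q * D (φ (X a)) - φ (y a)) = 0 := by
    ext1 j
    have h1 := congrArg φ (congrFun hy j)
    rw [jac_mulVec, map_sum] at h1
    simp only [Matrix.mulVec, dotProduct, Matrix.map_apply, mul_sub, Finset.sum_sub_distrib]
    have h2 : ∀ a, φ (jac P j a) = φ (pderiv a (P j)) := fun a => rfl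
    simp only [h2]
    simp only [map_mul] at h1
    rw [h1, Pi.zero_apply, sub_eq_zero]
    calc ∑ a, φ (pderiv a (P j)) * (φ Q * D (φ (X a)))
        = φ Q * D (φ (P j)) := by
          rw [hD, Finset.mul_sum]
          exact Finset.sum_congr rfl fun _ _ => by ring
      _ = φ ((Pi.single k Q : Fin ℓ → S ℓ) j) := by
          rw [hDP]
          by_cases hj : j = k
          · subst hj; simp
          · simp [hj]
  have hdet : ((jac P).map φ).det ≠ 0 := by
    have h : ((jac P).map φ).det = φ (jac P).det := (φ.map_det _).symm
    rw [h]
    exact algebraMap_ne_zero hJ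
  exact sub_eq_zero.1 (congrFun (Matrix.eq_zero_of_mulVec_eq_zero hdet hker) a)

theorem hatD_apply {y : Fin ℓ → S ℓ} {Q : S ℓ} {D : Derivation ℝ (F ℓ) (F ℓ)}
    (hD : ∀ a, algebraMap (S ℓ) (F ℓ) Q * D (algebraMap (S ℓ) (F ℓ) (X a))
      = algebraMap (S ℓ) (F ℓ) (y a)) (f : Fin ℓ → S ℓ) (i : Fin ℓ) (v : V ℓ) :
    hatD Q D (f i) v
      = algebraMap (S ℓ) (F ℓ) ((jac f * fieldJac y).mulVec (constField v) i) := by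
  rw [← Matrix.mulVec_mulVec, jac_mulVec, map_sum]
  simp only [hatD, LinearMap.sum_apply, LinearMap.smul_apply, hD, smul_eq_mul, map_mul]
  refine Finset.sum_congr rfl fun a _ => ?_
  congr 1
  change ∑ m, v m • ratPderiv m _ = algebraMap (S ℓ) (F ℓ) (∑ m, pderiv m (y a) * C (v m))
  rw [map_sum]
  refine Finset.sum_congr rfl fun m _ => ?_
  rw [ratPderiv_algebraMap, map_mul, mul_comm, Algebra.smul_def]
  rfl

end

end CoxeterForms

theorem corollary5 (ℓ : ℕ) (hℓ : 2 ≤ ℓ)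
    (W : Subgroup (V ℓ ≃ₗᵢ[ℝ] V ℓ)) (hW : IsRealCoxeterGroup W)
    (α : Submodule ℝ (V ℓ) → Module.Dual ℝ (V ℓ))
    (hα : ∀ H ∈ reflectingHyperplanes W, LinearMap.ker (α H) = H)
    (D : Derivation ℝ (F ℓ) (F ℓ)) (hD : IsSaitoDerivation W D)
    (f : Fin ℓ → S ℓ) (hf : IsBasicInvariants W f)
    (p : ℕ) (hp : p ≤ ℓ) :
    ∃ b : Module.Basis (Fin p ↪o Fin ℓ) (invariants W) (antiInvariantForms W p),
      ∀ I : Fin p ↪o Fin ℓ,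
        PolyForm.toRat (b I : PolyForm ℓ p) =
          (algebraMap (S ℓ) (F ℓ) (definingPolynomial W α)) ^ (1 - (p : ℤ)) •
            wedge (fun j => hatD (definingPolynomial W α) D (f (I j))) := by
  have := hW.finite
  obtain ⟨P, k, hP, hmax, hDP⟩ := hD
  set Q := definingPolynomial W α
  have hQ0 : Q ≠ 0 := definingPolynomial_ne_zero hα
  obtain ⟨y, M, hy, hM, hdet, hPM⟩ := exists_pairing_matrix hℓ hW hP hmax hα
  obtain ⟨c, hc, hJ⟩ := exists_det_jac_eq hP.adjoin_eq hα
  have hc' : (MvPolynomial.C c : S ℓ) ≠ 0 := by rwa [Ne, MvPolynomial.C_eq_zero]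
  have hJ0 : (jac P).det ≠ 0 := hJ ▸ mul_ne_zero hc' hQ0
  obtain ⟨U, e, he, hU, hUΘ, hUW⟩ :=
    exists_dual_frame hc hP.adjoin_eq hf.adjoin_eq hQ0 hJ hM hdet hPM
  have hQW : ∀ w ∈ W, subst (mat w) Q = MvPolynomial.C (mat w).det * Q := by
    intro w hw
    have h := subst_det_jac hP.adjoin_eq hw
    rw [hJ, map_mul, subst_C] at h
    apply mul_left_cancel₀ hc'
    rw [h]
    ring
  obtain ⟨b, hb⟩ := exists_basis_of_dual hQ0 hQW (fun g hg => definingPolynomial_dvd hα hg) he hU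
    hUΘ hUW hp
  refine ⟨b, fun I => ?_⟩
  ext1 v
  have hat := hatD_apply (algebraMap_mul_derivation_X hJ0 hDP hy) f
  set φ := algebraMap (S ℓ) (F ℓ) with hφ
  have hφQ : φ Q ≠ 0 := algebraMap_ne_zero hQ0
  have h1 := congrArg φ (hb I v)
  rw [map_mul, map_mul, map_pow] at h1
  have h2 : wedge (fun j => hatD Q D (f (I j))) v
      = φ (Matrix.of fun j i =>
          (jac f * fieldJac y).mulVec (constField (v j)) (I i)).det := by
    rw [RingHom.map_det]
    change Matrix.det _ = _
    congr 1
    ext1 j i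
    exact hat (I i) (v j)
  rw [AlternatingMap.smul_apply, h2, smul_eq_mul]
  change φ ((b I : PolyForm ℓ p) v) = _
  -- Multiplying by `Q^p` turns the possibly negative power `Q^(1-p)` into `Q`, the form in which
  -- the basis was computed over `S`.
  apply mul_left_cancel₀ (pow_ne_zero p hφQ)
  rw [h1, ← mul_assoc, ← zpow_natCast, ← zpow_add₀ hφQ, add_sub_cancel, zpow_one]
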